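/- Let $M=T^*\mathbb{CP}^1$ be the Eguchi--Hanson manifold, obtained by gluing two copies of $\mathbb C^2$, with coordinates $(\zeta,w)$, along $\zeta\neq 0$ by $(\zeta,w)\mapsto(-1/\zeta,\ \zeta^2w)$; away from the zero section $w=0$ it is $(\mathbb C^2\setminus 0)/\pm1$, with $(\zeta,w)=(z_2/z_1,\,z_1^2)$ in the first chart and $(\zeta,w)=(-z_1/z_2,\,z_2^2)$ in the second. In both charts put $\rho=\sqrt{1+|w|^2(1+|\zeta|^2)^2}$ and $$g=\frac{\rho\,|d\zeta|^2}{(1+|\zeta|^2)^2}+\frac{1}{4\rho}\,\bigl|(1+|\zeta|^2)\,dw+2\bar\zeta w\,d\zeta\bigr|^2 ,$$ let $I$ be multiplication by $\sqrt{-1}$, let $J$ be the endomorphism field such that, with $K=IJ$, $g(J\cdot,\cdot)+\sqrt{-1}\,g(K\cdot,\cdot)=\tfrac12\,d\zeta\wedge dw$, and let $Q=\mathrm{span}_{\mathbb R}(I,J,K)\subset\mathrm{End}(TM)$. **Proposition.** $M$ is connected and $(g,I,J,K)$ is a hyperkähler structure on $M$ (the Eguchi--Hanson structure: $g$ is a Riemannian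 metric, $I,J,K$ are $g$-orthogonal, satisfy the quaternionic relations and are parallel for the Levi-Civita connection of $g$). In the local coordinates $\rho>1$, $\phi,\psi\in(0,\pi)$, $\theta\in\mathbb R$ given by $z_1=(\rho^2-1)^{1/4}(\cos\phi+\sqrt{-1}\sin\phi\cos\psi)$, $z_2=(\rho^2-1)^{1/4}\sin\phi\sin\psi\,e^{\sqrt{-1}\theta}$, one has, with $ab=a\otimes b+b\otimes a$ for $a\ne b$ and $a^2=a\otimes a$, $$\begin{aligned}g={}&\tfrac{\rho}{4(\rho^2-1)}d\rho^2+\tfrac1\rho\bigl((\rho^2-\cos^2\psi)\,d\phi^2+\cos\psi\cos\phi\sin\psi\sin\phi\,d\phi\,d\psi-\sin^2\psi\sin^2\phi\cos\psi\,d\phi\,d\theta\\&+\sin^2\phi(\cos^2\psi\cos^2\phi+\rho^2-\cos^2\phi)\,d\psi^2+\sin^3\phi\sin^3\psi\cos\phi\,d\psi\,d\theta\\&-\sin^2\psi\sin^2\phi(\cos^2\psi\cos^2\phi-\rho^2+1-\cos^2\psi-\cos^2\phi)\,d\theta^2\bigr),\end{aligned}$$ and the vector fields $$\begin{aligned}v_1&=\cos\psi\,\partial_\phi-\tfrac{\sin\psi\cos\phi}{\sin\phi}\partial_\psi+\partial_\theta,\\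 v_2&=\sin\psi\cos\theta\,\partial_\phi+\tfrac{\cos\theta\cos\psi\cos\phi+\sin\phi\sin\theta}{\sin\phi}\partial_\psi+\tfrac{\sin\phi\cos\theta\cos\psi-\sin\theta\cos\phi}{\sin\phi\sin\psi}\partial_\theta,\\ v_3&=\sin\psi\sin\theta\,\partial_\phi-\tfrac{\sin\phi\cos\theta-\sin\theta\cos\phi\cos\psi}{\sin\phi}\partial_\psi+\tfrac{\sin\phi\sin\theta\cos\psi+\cos\theta\cos\phi}{\sin\phi\sin\psi}\partial_\theta,\\ v_4&=\cos\psi\,\partial_\phi-\tfrac{\sin\psi\cos\phi}{\sin\phi}\partial_\psi-\partial_\theta\end{aligned}$$ are those induced by the linearly independent elements $\begin{pmatrix}i&0\\0&i\end{pmatrix},\begin{pmatrix}0&-1\\1&0\end{pmatrix},\begin{pmatrix}0&i\\i&0\end{pmatrix},\begin{pmatrix}i&0\\0&-i\end{pmatrix}$ of $\mathfrak u(2)$, where $A\in\mathfrak u(2)$ induces on $M$ the velocity field $X_A$ of the one-parameter group $z\mapsto e^{tA}z$. For every nonempty connected open set $U\subset M$ (in particular for $U=M$), let $\mathfrak s(U)$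 be the space of infinitesimal quaternionic symmetries on $U$, i.e. of smooth vector fields $X$ on $U$ such that $\mathcal L_X$ maps local sections of $Q$ to local sections of $Q$. Then $\mathfrak s(U)$ is equal to the space of Killing vector fields of $g$ on $U$, it has dimension $4$, and $A\mapsto X_{-A}|_U$ is an isomorphism of Lie algebras from $\mathfrak u(2)$ onto $\mathfrak s(U)$. -/

import Mathlib

open scoped ContDiff

noncomputable section

namespace EguchiHanson

/-! ### The manifold -/

/-- The model space of the charts, with coordinates `(ζ, w)`. -/
abbrev Coord : Type := ℂ × ℂ

/-- The transition map between the two charts (in both directions), meaningful for `ζ ≠ 0`. -/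
def transition (p : Coord) : Coord := (-p.1⁻¹, p.1 ^ 2 * p.2)

theorem transition_transition {p : Coord} (hp : p.1 ≠ 0) : transition (transition p) = p := by
  obtain ⟨z, w⟩ := p
  have hz : z ≠ 0 := hp
  ext
  · simp [transition]
  · simp only [transition]
    field_simp

/-- Points of the two chart domains are identified by the transition map. -/
instance gluing : Setoid (Bool × Coord) where
  r a b := (a.1 = b.1 ∧ a.2 = b.2) ∨ (a.1 ≠ b.1 ∧ a.2.1 ≠ 0 ∧ b.2 = transition a.2)
  iseqv := by
    refine ⟨fun a => Or.inl ⟨rfl, rfl⟩, ?_, ?_⟩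
    · rintro ⟨i, p⟩ ⟨j, q⟩ (⟨h1, h2⟩ | ⟨h1, h2, h3⟩)
      · exact Or.inl ⟨h1.symm, h2.symm⟩
      · simp only at h1 h2 h3
        subst h3
        refine Or.inr ⟨Ne.symm h1, ?_, (transition_transition h2).symm⟩
        simpa [transition] using h2
    · rintro ⟨i, p⟩ ⟨j, q⟩ ⟨k, r⟩ (⟨h1, h2⟩ | ⟨h1, h2, h3⟩) (⟨h4, h5⟩ | ⟨h4, h5, h6⟩)
      · exact Or.inl ⟨h1.trans h4, h2.trans h5⟩
      · simp only at h1 h2 h4 h5 h6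
        subst h1 h2
        exact Or.inr ⟨h4, h5, h6⟩
      · simp only at h1 h2 h3 h4 h5
        subst h4 h5
        exact Or.inr ⟨h1, h2, h3⟩
      · simp only at h1 h2 h3 h4 h5 h6
        refine Or.inl ⟨?_, ?_⟩
        · revert h1 h4
          cases i <;> cases j <;> cases k <;> simp
        · simp only
          rw [h6, h3, transition_transition h2]

/-- The Eguchi--Hanson manifold `T*ℂP¹`: two copies of `ℂ²` glued along `ζ ≠ 0`. Away from the zero
section `w = 0` it is `(ℂ² ∖ 0)/±1`, with `ζ = z₂/z₁`, `w = z₁²` in the chart `false` and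
`ζ = -z₁/z₂`, `w = z₂²` in the chart `true`. -/
def Space : Type := Quotient gluing

instance : TopologicalSpace Space := inferInstanceAs (TopologicalSpace (Quotient gluing))

/-- The parametrization of an open subset of the manifold by the chart with index `i`. -/
def chart (i : Bool) (p : Coord) : Space := Quotient.mk gluing (i, p)

theorem continuous_chart (i : Bool) : Continuous (chart i) :=
  continuous_quotient_mk'.comp (Continuous.prodMk continuous_const continuous_id)

theorem isOpen_chart_preimage (U : TopologicalSpace.Opens Space) (i : Bool) :
    IsOpen (chart i ⁻¹' (U : Set Space)) :=
  U.isOpen.preimage (continuous_chart i)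

/-! ### The hyperkähler structure (given by the same formulas in both charts) -/

/-- `1 + |ζ|²`. -/
def width (p : Coord) : ℝ := 1 + ‖p.1‖ ^ 2

/-- The radial function `ρ = √(1 + |w|² (1 + |ζ|²)²)`; it equals `1` on the zero section. -/
def radius (p : Coord) : ℝ := √(1 + ‖p.2‖ ^ 2 * width p ^ 2)

/-- The `(1,0)`-form `(1 + |ζ|²) dw + 2 ζ̄ w dζ`. -/
def fibreForm (p : Coord) : Coord →L[ℝ] ℂ :=
  (width p : ℂ) • ContinuousLinearMap.snd ℝ ℂ ℂ
    + (2 * (starRingEnd ℂ) p.1 * p.2) • ContinuousLinearMap.fst ℝ ℂ ℂ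

/-- The Eguchi--Hanson metric
`ρ |dζ|² / (1 + |ζ|²)² + |(1 + |ζ|²) dw + 2 ζ̄ w dζ|² / (4 ρ)`. -/
def metric (p u v : Coord) : ℝ :=
  radius p / width p ^ 2 * (u.1 * (starRingEnd ℂ) v.1).re
    + 1 / (4 * radius p) * (fibreForm p u * (starRingEnd ℂ) (fibreForm p v)).re

/-- The complex structure `I`, multiplication by the imaginary unit in the charts. -/
def structI (_p : Coord) : Coord →L[ℝ] Coord := Complex.I • ContinuousLinearMap.id ℝ Coord

/-- The complex structure `J`, for which `g(J·,·) + i g(K·,·)` is the holomorphic symplectic form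
`½ dζ ∧ dw`. -/
def structJ (p : Coord) : Coord →L[ℝ] Coord :=
  let conjForm : Coord →L[ℝ] ℂ := (Complex.conjCLE : ℂ →L[ℝ] ℂ) ∘L fibreForm p
  let conjFst : Coord →L[ℝ] ℂ := (Complex.conjCLE : ℂ →L[ℝ] ℂ) ∘L ContinuousLinearMap.fst ℝ ℂ ℂ
  ((-(width p / (2 * radius p))) • conjForm).prod
    ((2 * radius p / width p ^ 2) • conjFst
      + ((starRingEnd ℂ) p.1 * p.2 / (radius p : ℂ)) • conjForm)

/-- The three complex structures `I, J, K = I J`. -/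
def hypercomplex : Fin 3 → Coord → Coord →L[ℝ] Coord :=
  ![structI, structJ, fun p => structI p ∘L structJ p]

/-- `(g, I₁, I₂, I₃)`, given by the same expressions in both charts, is a hyperkähler structure:
`g` is a Riemannian metric, the `I_j` are `g`-orthogonal almost complex structures with the
quaternionic relations, everything agrees on the overlap of the charts, and the `I_j` are parallel
for the Levi-Civita connection `Γ` (the torsion free connection with `∇g = 0`). -/
structure IsHyperkahler (g : Coord → Coord → Coord → ℝ)
    (S : Fin 3 → Coord → Coord →L[ℝ] Coord) : Prop where
  smooth_metric : ∀ u v, ContDiff ℝ ∞ (fun p => g p u v)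
  bilinear : ∀ p, ∃ b : Coord →ₗ[ℝ] Coord →ₗ[ℝ] ℝ, ∀ u v, g p u v = b u v
  symmetric : ∀ p u v, g p u v = g p v u
  positive : ∀ p u, u ≠ 0 → 0 < g p u u
  metric_transition : ∀ p : Coord, p.1 ≠ 0 → ∀ u v,
    g (transition p) (fderiv ℝ transition p u) (fderiv ℝ transition p v) = g p u v
  smooth_structure : ∀ j, ContDiff ℝ ∞ (S j)
  square : ∀ j p u, S j p (S j p u) = -u
  product : ∀ p u, S 0 p (S 1 p u) = S 2 p u ∧ S 1 p (S 0 p u) = -S 2 p u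
  orthogonal : ∀ j p u v, g p (S j p u) (S j p v) = g p u v
  structure_transition : ∀ j, ∀ p : Coord, p.1 ≠ 0 → ∀ u,
    S j (transition p) (fderiv ℝ transition p u) = fderiv ℝ transition p (S j p u)
  parallel : ∀ p, ∃ Γ : Coord →ₗ[ℝ] Coord →ₗ[ℝ] Coord,
    (∀ u v, Γ u v = Γ v u) ∧
    (∀ u v w, fderiv ℝ (fun q => g q v w) p u = g p (Γ u v) w + g p v (Γ u w)) ∧
    ∀ j u v, fderiv ℝ (S j) p u v + Γ u (S j p v) - S j p (Γ u v) = 0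

/-- The quaternionic structure: the rank 3 bundle of endomorphisms spanned by `I, J, K`. -/
def quaternionicStructure (p : Coord) : Submodule ℝ (Coord →L[ℝ] Coord) :=
  Submodule.span ℝ (Set.range fun j => hypercomplex j p)

/-! ### Vector fields and Lie derivatives -/

/-- The Lie derivative `(L_X A)(Y) = [X, A Y] - A [X, Y]` of a field of endomorphisms. -/
def lieDerivEnd (X : Coord → Coord) (A : Coord → Coord →L[ℝ] Coord) (p : Coord) :
    Coord →L[ℝ] Coord :=
  fderiv ℝ A p (X p) - fderiv ℝ X p ∘L A p + A p ∘L fderiv ℝ X p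

/-- The Lie derivative `L_X g` of the metric, on tangent vectors `u, v` at `p`. -/
def lieDerivMetric (X : Coord → Coord) (p u v : Coord) : ℝ :=
  fderiv ℝ (fun q => metric q u v) p (X p)
    + metric p (fderiv ℝ X p u) v + metric p u (fderiv ℝ X p v)

/-- Smooth vector fields on an open subset `U` of the manifold: pairs of smooth vector fields on the
parts of `U` in the two charts, related by the transition map. Their values outside of `U`, which
have no meaning, are normalized to be zero. -/
def vectorFields (U : TopologicalSpace.Opens Space) : Submodule ℝ (Bool → Coord → Coord) where
  carrier := {X |
    (∀ i, ContDiffOn ℝ ∞ (X i) (chart i ⁻¹' (U : Set Space))) ∧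
    (∀ i (p : Coord), p.1 ≠ 0 → X (!i) (transition p) = fderiv ℝ transition p (X i p)) ∧
    ∀ i p, chart i p ∉ U → X i p = 0}
  add_mem' := by
    rintro X Y ⟨h1, h2, h3⟩ ⟨k1, k2, k3⟩
    refine ⟨fun i => (h1 i).add (k1 i), fun i p hp => ?_, fun i p hp => ?_⟩
    · simp [h2 i p hp, k2 i p hp]
    · simp [h3 i p hp, k3 i p hp]
  zero_mem' := ⟨fun _ => contDiffOn_const, fun _ _ _ => by simp, fun _ _ _ => rfl⟩
  smul_mem' := by
    rintro c X ⟨h1, h2, h3⟩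
    refine ⟨fun i => (h1 i).const_smul c, fun i p hp => ?_, fun i p hp => ?_⟩
    · simp [h2 i p hp]
    · simp [h3 i p hp]

theorem differentiableAt_of_mem {U : TopologicalSpace.Opens Space} {X : Bool → Coord → Coord}
    (hX : X ∈ vectorFields U) {i : Bool} {p : Coord} (hp : chart i p ∈ U) :
    DifferentiableAt ℝ (X i) p :=
  ((hX.1 i).differentiableOn (by simp)).differentiableAt
    ((isOpen_chart_preimage U i).mem_nhds hp)

theorem lieDerivEnd_add {X Y : Coord → Coord} {A : Coord → Coord →L[ℝ] Coord} {p : Coord}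
    (hX : DifferentiableAt ℝ X p) (hY : DifferentiableAt ℝ Y p) :
    lieDerivEnd (X + Y) A p = lieDerivEnd X A p + lieDerivEnd Y A p := by
  simp only [lieDerivEnd, fderiv_add hX hY, Pi.add_apply, map_add,
    ContinuousLinearMap.add_comp, ContinuousLinearMap.comp_add]
  abel

theorem lieDerivEnd_smul {X : Coord → Coord} {A : Coord → Coord →L[ℝ] Coord} {p : Coord} (c : ℝ)
    (hX : DifferentiableAt ℝ X p) : lieDerivEnd (c • X) A p = c • lieDerivEnd X A p := by
  simp only [lieDerivEnd, fderiv_const_smul hX, Pi.smul_apply, map_smul,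
    ContinuousLinearMap.smul_comp, ContinuousLinearMap.comp_smul, smul_add, smul_sub]

theorem metric_add_left (p u u' v : Coord) :
    metric p (u + u') v = metric p u v + metric p u' v := by
  simp only [metric, map_add, Prod.fst_add, add_mul, Complex.add_re]
  ring

theorem metric_add_right (p u v v' : Coord) :
    metric p u (v + v') = metric p u v + metric p u v' := by
  simp only [metric, map_add, Prod.fst_add, mul_add, Complex.add_re]
  ring

theorem metric_smul_left (p u v : Coord) (c : ℝ) :
    metric p (c • u) v = c * metric p u v := by
  simp only [metric, map_smul, Prod.smul_fst, smul_mul_assoc, Complex.smul_re, smul_eq_mul]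
  ring

theorem metric_smul_right (p u v : Coord) (c : ℝ) :
    metric p u (c • v) = c * metric p u v := by
  have h (z : ℂ) : (starRingEnd ℂ) (c • z) = c • (starRingEnd ℂ) z := by simp
  simp only [metric, map_smul, Prod.smul_fst, h, mul_smul_comm, Complex.smul_re, smul_eq_mul]
  ring

theorem lieDerivMetric_add {X Y : Coord → Coord} {p : Coord}
    (hX : DifferentiableAt ℝ X p) (hY : DifferentiableAt ℝ Y p) (u v : Coord) :
    lieDerivMetric (X + Y) p u v = lieDerivMetric X p u v + lieDerivMetric Y p u v := by
  simp only [lieDerivMetric, fderiv_add hX hY, Pi.add_apply, map_add,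
    add_apply, metric_add_left, metric_add_right]
  ring

theorem lieDerivMetric_smul {X : Coord → Coord} {p : Coord} (c : ℝ)
    (hX : DifferentiableAt ℝ X p) (u v : Coord) :
    lieDerivMetric (c • X) p u v = c * lieDerivMetric X p u v := by
  simp only [lieDerivMetric, fderiv_const_smul hX, Pi.smul_apply, map_smul,
    smul_apply, metric_smul_left, metric_smul_right, smul_eq_mul]
  ring

/-- The infinitesimal quaternionic symmetries on an open subset `U` of the manifold: the vector
fields on `U` whose Lie derivative maps local sections of the quaternionic structure to local
sections. -/
def symmetryAlgebra (U : TopologicalSpace.Opens Space) :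
    Submodule ℝ (Bool → Coord → Coord) where
  carrier := {X | X ∈ vectorFields U ∧
    ∀ (i : Bool) (V : Set Coord), IsOpen V → V ⊆ chart i ⁻¹' (U : Set Space) →
      ∀ A : Coord → Coord →L[ℝ] Coord, ContDiffOn ℝ ∞ A V →
        (∀ p ∈ V, A p ∈ quaternionicStructure p) →
        ∀ p ∈ V, lieDerivEnd (X i) A p ∈ quaternionicStructure p}
  add_mem' := by
    rintro X Y ⟨h1, h2⟩ ⟨k1, k2⟩
    refine ⟨add_mem h1 k1, fun i V hV hVU A hA hAQ p hp => ?_⟩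
    have := lieDerivEnd_add (A := A) (differentiableAt_of_mem h1 (hVU hp))
      (differentiableAt_of_mem k1 (hVU hp))
    rw [Pi.add_apply, this]
    exact add_mem (h2 i V hV hVU A hA hAQ p hp) (k2 i V hV hVU A hA hAQ p hp)
  zero_mem' := by
    refine ⟨zero_mem _, fun i V _ _ A _ _ p _ => ?_⟩
    have : lieDerivEnd ((0 : Bool → Coord → Coord) i) A p = 0 := by
      simp [lieDerivEnd]
    rw [this]
    exact zero_mem _
  smul_mem' := by
    rintro c X ⟨h1, h2⟩
    refine ⟨Submodule.smul_mem _ c h1, fun i V hV hVU A hA hAQ p hp => ?_⟩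
    rw [Pi.smul_apply, lieDerivEnd_smul c (differentiableAt_of_mem h1 (hVU hp))]
    exact Submodule.smul_mem _ c (h2 i V hV hVU A hA hAQ p hp)

/-- The infinitesimal isometries (Killing fields) on an open subset `U` of the manifold. -/
def isometryAlgebra (U : TopologicalSpace.Opens Space) :
    Submodule ℝ (Bool → Coord → Coord) where
  carrier := {X | X ∈ vectorFields U ∧
    ∀ i p, chart i p ∈ U → ∀ u v, lieDerivMetric (X i) p u v = 0}
  add_mem' := by
    rintro X Y ⟨h1, h2⟩ ⟨k1, k2⟩
    refine ⟨add_mem h1 k1, fun i p hp u v => ?_⟩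
    rw [Pi.add_apply, lieDerivMetric_add (differentiableAt_of_mem h1 hp)
      (differentiableAt_of_mem k1 hp), h2 i p hp, k2 i p hp, add_zero]
  zero_mem' := by
    refine ⟨zero_mem _, fun i p _ u v => ?_⟩
    simp [lieDerivMetric, metric]
  smul_mem' := by
    rintro c X ⟨h1, h2⟩
    refine ⟨Submodule.smul_mem _ c h1, fun i p hp u v => ?_⟩
    rw [Pi.smul_apply, lieDerivMetric_smul c (differentiableAt_of_mem h1 hp), h2 i p hp,
      mul_zero]

/-! ### The action of `𝔲(2)` -/

section

attribute [local instance] LieRing.ofAssociativeRing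

/-- The Lie algebra `𝔲(2)` of skew-Hermitian matrices. -/
def u2 : LieSubalgebra ℝ (Matrix (Fin 2) (Fin 2) ℂ) where
  carrier := {A | A.conjTranspose = -A}
  add_mem' := by
    intro A B hA hB
    simp only [Set.mem_ofPred_eq] at *
    rw [Matrix.conjTranspose_add, hA, hB, neg_add]
  zero_mem' := by simp
  smul_mem' := by
    intro c A hA
    simp only [Set.mem_ofPred_eq] at *
    rw [Matrix.conjTranspose_smul, hA, star_trivial, smul_neg]
  lie_mem' := by
    intro A B hA hB
    change A.conjTranspose = -A at hA
    change B.conjTranspose = -B at hB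
    change (⁅A, B⁆).conjTranspose = -⁅A, B⁆
    rw [Ring.lie_def, Matrix.conjTranspose_sub, Matrix.conjTranspose_mul,
      Matrix.conjTranspose_mul, hA, hB]
    simp

end

/-- The velocity field of the one-parameter group `z ↦ exp (tA) z` in the two charts. -/
def velocity (i : Bool) (A : Matrix (Fin 2) (Fin 2) ℂ) (p : Coord) : Coord :=
  match i with
  | false => (A 1 0 + (A 1 1 - A 0 0) * p.1 - A 0 1 * p.1 ^ 2, 2 * p.2 * (A 0 0 + A 0 1 * p.1))
  | true => (-A 0 1 + (A 0 0 - A 1 1) * p.1 + A 1 0 * p.1 ^ 2, 2 * p.2 * (A 1 1 - A 1 0 * p.1))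

open Classical in
/-- The restriction to `U` of the vector field on the manifold induced by the matrix `A`. -/
def fundamentalField (U : TopologicalSpace.Opens Space) (A : Matrix (Fin 2) (Fin 2) ℂ) :
    Bool → Coord → Coord :=
  fun i p => if chart i p ∈ U then velocity i A p else 0

/-! ### The local coordinates `(ρ, φ, ψ, θ)` -/

/-- The range `ρ > 1`, `0 < φ < π`, `0 < ψ < π`, `θ ∈ ℝ` of the local coordinates. -/
def polarDomain : Set (Fin 4 → ℝ) :=
  {q | 1 < q 0 ∧ q 1 ∈ Set.Ioo 0 Real.pi ∧ q 2 ∈ Set.Ioo 0 Real.pi}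

/-- The local coordinates, expressed in the chart `true`: the point `±(z₁, z₂)` with
`z₁ = (ρ² - 1)^(1/4) (cos φ + i sin φ cos ψ)` and `z₂ = (ρ² - 1)^(1/4) sin φ sin ψ e^{iθ}`. -/
def polarMap (q : Fin 4 → ℝ) : Coord :=
  let a : ℂ := (Real.cos (q 1) : ℂ) + Complex.I * (Real.sin (q 1) * Real.cos (q 2) : ℝ)
  let b : ℂ := (Real.sin (q 1) * Real.sin (q 2) : ℝ) * Complex.exp (Complex.I * (q 3 : ℂ))
  (-a / b, (√((q 0) ^ 2 - 1) : ℂ) * b ^ 2)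

/-- The Eguchi--Hanson metric in the local coordinates; `sym i j` is `dqᵢ ⊗ dqⱼ + dqⱼ ⊗ dqᵢ`. -/
def polarMetric (q a b : Fin 4 → ℝ) : ℝ :=
  let ρ := q 0
  let cφ := Real.cos (q 1)
  let sφ := Real.sin (q 1)
  let cψ := Real.cos (q 2)
  let sψ := Real.sin (q 2)
  let sym (i j : Fin 4) : ℝ := a i * b j + a j * b i
  ρ / (4 * (ρ ^ 2 - 1)) * (a 0 * b 0)
    + 1 / ρ * ((ρ ^ 2 - cψ ^ 2) * (a 1 * b 1)
      + cψ * cφ * sψ * sφ * sym 1 2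
      - sψ ^ 2 * sφ ^ 2 * cψ * sym 1 3
      + sφ ^ 2 * (cψ ^ 2 * cφ ^ 2 + ρ ^ 2 - cφ ^ 2) * (a 2 * b 2)
      + sφ ^ 3 * sψ ^ 3 * cφ * sym 2 3
      - sψ ^ 2 * sφ ^ 2 * (cψ ^ 2 * cφ ^ 2 - ρ ^ 2 + 1 - cψ ^ 2 - cφ ^ 2) * (a 3 * b 3))

/-- The generators `v₁, v₂, v₃, v₄` of the isometry algebra in the local coordinates. -/
def polarField (k : Fin 4) (q : Fin 4 → ℝ) : Fin 4 → ℝ :=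
  let cφ := Real.cos (q 1)
  let sφ := Real.sin (q 1)
  let cψ := Real.cos (q 2)
  let sψ := Real.sin (q 2)
  let cθ := Real.cos (q 3)
  let sθ := Real.sin (q 3)
  let d := cψ ^ 2 * cφ ^ 2 - cψ ^ 2 - cφ ^ 2 + 1
  ![![0, cψ, -(sψ * cφ / sφ), 1],
    ![0, sψ * cθ, sφ * sψ ^ 2 * (cθ * cψ * cφ + sφ * sθ) / d,
      (sφ * cθ * cψ - sθ * cφ) / (sφ * sψ)],
    ![0, sψ * sθ, -(sφ * sψ ^ 2 * (sφ * cθ - sθ * cφ * cψ) / d),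
      (sφ * sθ * cψ + cθ * cφ) / (sφ * sψ)],
    ![0, cψ, sψ * sφ * cφ / (cφ ^ 2 - 1), -(d / (sφ ^ 2 * sψ ^ 2))]] k

/-- The elements of `𝔲(2)` that correspond to `v₁, v₂, v₃, v₄`. -/
def polarMatrix : Fin 4 → Matrix (Fin 2) (Fin 2) ℂ :=
  ![!![Complex.I, 0; 0, Complex.I], !![0, -1; 1, 0], !![0, Complex.I; Complex.I, 0],
    !![Complex.I, 0; 0, -Complex.I]]

end EguchiHanson

end

/-!
The metric is the real part of a Hermitian form `h`, and `J` is determined by `h` and the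
holomorphic symplectic form `ω = ½ dζ ∧ dw` through `h(u, v) = ω(u, J v)`. All computations are
made in one chart with Wirtinger derivatives (`HasWirtinger`); since the transition map is
holomorphic and preserves `h` and `ω`, it preserves the whole structure. The structure is parallel
because the explicit complex-bilinear Christoffel symbols `christoffel` satisfy `∂h = h(Γ·, ·)`
and are traceless, so that they preserve `ω` and hence `J` (`isHyperkahler`).

The core is the determination of the symmetries. Being a quaternionic symmetry and being a Killing
field both imply two pointwise conditions (`IsConformalAt`): the antilinear part of `dX` is a
multiple `c J` of `J`, and the `(1,1)`-part of `L_X g` is a multiple of `h`. Away from the zero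
section `J = ∂̄Ψ` for an explicit vector field `Ψ` (`potential`), so `∂̄∂̄ = 0` forces `c` to be
holomorphic and `X = c Ψ + Y` with `Y` holomorphic (`exists_holomorphic_decomposition`). The
component of the second condition that pairs the Euler field with its orthogonal complement is a
relation between powers of `ρ` and of `ζ̄` with holomorphic or antiholomorphic coefficients
(`mixed_equation`). Functions that are holomorphic in `w` are linearly independent over powers of
`ρ`, and those that are holomorphic in `ζ` over powers of `ζ̄` (`coeff_eq_zero_of_sum_eq_zero`);
this yields `c = 0` (`eq_zero_of_mixed_equation`) and then shows that `Y` is induced by an element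
of `𝔲(2)` up to a complex multiple of the identity matrix (`exists_coefficients`). The diagonal
components of the second condition exclude the real multiples (`re_eq_zero_of_isConformalAt`).

Conversely a field induced by `𝔲(2)` is holomorphic and preserves `h` (`lieHermitian_velocity`),
so it is a Killing field, and `L_X I = 0`, while `L_X J` is a multiple of `J` because `L_X ω` is a
multiple of `ω` (`lieDerivEnd_mem`). Across the zero section the local description extends by
density. A matrix is determined by its field on any nonempty open set, so the local matrices are
constant on a connected open subset of the manifold (`exists_fundamentalField_eq`).
-/

noncomputable section

namespace EguchiHanson

/-! ### Wirtinger calculus on `ℂ²` -/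

/-- The real-linear form `a dζ + b dζ̄ + c dw + d dw̄` on `ℂ²`. -/
def wirtingerForm (a b c d : ℂ) : Coord →L[ℝ] ℂ :=
  a • ContinuousLinearMap.fst ℝ ℂ ℂ
    + b • ((Complex.conjCLE : ℂ →L[ℝ] ℂ) ∘L ContinuousLinearMap.fst ℝ ℂ ℂ)
    + c • ContinuousLinearMap.snd ℝ ℂ ℂ
    + d • ((Complex.conjCLE : ℂ →L[ℝ] ℂ) ∘L ContinuousLinearMap.snd ℝ ℂ ℂ)

theorem wirtingerForm_apply (a b c d : ℂ) (u : Coord) :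
    wirtingerForm a b c d u = a * u.1 + b * (starRingEnd ℂ) u.1 + c * u.2
      + d * (starRingEnd ℂ) u.2 := by
  simp [wirtingerForm]

/-- `f` is real-differentiable at `p` with Wirtinger derivatives
`∂f/∂ζ = a`, `∂f/∂ζ̄ = b`, `∂f/∂w = c`, `∂f/∂w̄ = d`. -/
def HasWirtinger (f : Coord → ℂ) (a b c d : ℂ) (p : Coord) : Prop :=
  HasFDerivAt f (wirtingerForm a b c d) p

namespace HasWirtinger

variable {f g : Coord → ℂ} {a b c d a' b' c' d' : ℂ} {p : Coord}

theorem fderiv_apply (h : HasWirtinger f a b c d p) (u : Coord) :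
    fderiv ℝ f p u = a * u.1 + b * (starRingEnd ℂ) u.1 + c * u.2
      + d * (starRingEnd ℂ) u.2 := by
  rw [HasFDerivAt.fderiv h, wirtingerForm_apply]

theorem congr_values (h : HasWirtinger f a b c d p) (ha : a = a') (hb : b = b') (hc : c = c')
    (hd : d = d') : HasWirtinger f a' b' c' d' p := by
  subst ha hb hc hd; exact h

theorem const (z : ℂ) (p : Coord) : HasWirtinger (fun _ => z) 0 0 0 0 p := by
  have : wirtingerForm 0 0 0 0 = 0 := by ext <;> simp [wirtingerForm_apply]
  rw [HasWirtinger, this]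
  exact hasFDerivAt_const z p

theorem fst (p : Coord) : HasWirtinger (fun q => q.1) 1 0 0 0 p := by
  have : wirtingerForm 1 0 0 0 = ContinuousLinearMap.fst ℝ ℂ ℂ := by
    ext <;> simp [wirtingerForm_apply]
  rw [HasWirtinger, this]
  exact hasFDerivAt_fst

theorem snd (p : Coord) : HasWirtinger (fun q => q.2) 0 0 1 0 p := by
  have : wirtingerForm 0 0 1 0 = ContinuousLinearMap.snd ℝ ℂ ℂ := by
    ext <;> simp [wirtingerForm_apply]
  rw [HasWirtinger, this]
  exact hasFDerivAt_snd

theorem add (hf : HasWirtinger f a b c d p) (hg : HasWirtinger g a' b' c' d' p) :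
    HasWirtinger (fun q => f q + g q) (a + a') (b + b') (c + c') (d + d') p := by
  have : wirtingerForm (a + a') (b + b') (c + c') (d + d')
      = wirtingerForm a b c d + wirtingerForm a' b' c' d' := by
    refine ContinuousLinearMap.ext fun u => ?_
    simp only [wirtingerForm_apply, add_apply]; ring
  rw [HasWirtinger, this]
  exact HasFDerivAt.add hf hg

theorem neg (hf : HasWirtinger f a b c d p) :
    HasWirtinger (fun q => -f q) (-a) (-b) (-c) (-d) p := by
  have : wirtingerForm (-a) (-b) (-c) (-d) = -wirtingerForm a b c d := by
    refine ContinuousLinearMap.ext fun u => ?_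
    simp only [wirtingerForm_apply, neg_apply]; ring
  rw [HasWirtinger, this]
  exact HasFDerivAt.neg hf

theorem sub (hf : HasWirtinger f a b c d p) (hg : HasWirtinger g a' b' c' d' p) :
    HasWirtinger (fun q => f q - g q) (a - a') (b - b') (c - c') (d - d') p := by
  simpa only [sub_eq_add_neg] using hf.add hg.neg

theorem mul (hf : HasWirtinger f a b c d p) (hg : HasWirtinger g a' b' c' d' p) :
    HasWirtinger (fun q => f q * g q) (a * g p + f p * a') (b * g p + f p * b')
      (c * g p + f p * c') (d * g p + f p * d') p := by
  have : wirtingerForm (a * g p + f p * a') (b * g p + f p * b')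
      (c * g p + f p * c') (d * g p + f p * d')
      = f p • wirtingerForm a' b' c' d' + g p • wirtingerForm a b c d := by
    refine ContinuousLinearMap.ext fun u => ?_
    simp only [wirtingerForm_apply, add_apply, smul_apply, smul_eq_mul]; ring
  rw [HasWirtinger, this]
  exact HasFDerivAt.mul hf hg

theorem const_mul (z : ℂ) (hf : HasWirtinger f a b c d p) :
    HasWirtinger (fun q => z * f q) (z * a) (z * b) (z * c) (z * d) p :=
  ((const z p).mul hf).congr_values (by ring) (by ring) (by ring) (by ring)

theorem inv (hf : HasWirtinger f a b c d p) (h0 : f p ≠ 0) :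
    HasWirtinger (fun q => (f q)⁻¹) (-a / f p ^ 2) (-b / f p ^ 2) (-c / f p ^ 2)
      (-d / f p ^ 2) p := by
  have : wirtingerForm (-a / f p ^ 2) (-b / f p ^ 2) (-c / f p ^ 2) (-d / f p ^ 2)
      = (-(f p ^ 2)⁻¹) • wirtingerForm a b c d := by
    refine ContinuousLinearMap.ext fun u => ?_
    simp only [wirtingerForm_apply, smul_apply, smul_eq_mul]; ring
  rw [HasWirtinger, this]
  exact (hasDerivAt_inv h0).comp_hasFDerivAt_of_eq p hf rfl

theorem div (hf : HasWirtinger f a b c d p) (hg : HasWirtinger g a' b' c' d' p) (h0 : g p ≠ 0) :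
    HasWirtinger (fun q => f q / g q) ((a * g p - f p * a') / g p ^ 2)
      ((b * g p - f p * b') / g p ^ 2) ((c * g p - f p * c') / g p ^ 2)
      ((d * g p - f p * d') / g p ^ 2) p := by
  simp only [div_eq_mul_inv (f _)]
  refine (hf.mul (hg.inv h0)).congr_values ?_ ?_ ?_ ?_ <;> field_simp <;> ring

theorem conj (hf : HasWirtinger f a b c d p) :
    HasWirtinger (fun q => (starRingEnd ℂ) (f q)) ((starRingEnd ℂ) b) ((starRingEnd ℂ) a)
      ((starRingEnd ℂ) d) ((starRingEnd ℂ) c) p := by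
  have : wirtingerForm ((starRingEnd ℂ) b) ((starRingEnd ℂ) a)
      ((starRingEnd ℂ) d) ((starRingEnd ℂ) c)
      = (Complex.conjCLE : ℂ →L[ℝ] ℂ) ∘L wirtingerForm a b c d := by
    refine ContinuousLinearMap.ext fun u => ?_
    simp only [wirtingerForm_apply, ContinuousLinearMap.comp_apply,
      ContinuousLinearEquiv.coe_coe, Complex.conjCLE_apply, map_add, map_mul, Complex.conj_conj]
    ring
  rw [HasWirtinger, this]
  exact (Complex.conjCLE : ℂ →L[ℝ] ℂ).hasFDerivAt.comp p hf

theorem differentiableAt (hf : HasWirtinger f a b c d p) : DifferentiableAt ℝ f p :=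
  HasFDerivAt.differentiableAt hf

end HasWirtinger

/-- The Wirtinger derivative of `f` along the constant vector `v`: the complex-linear part
`½ (D_v - i D_{iv}) f` for `s = 1`, the antilinear part `½ (D_v + i D_{iv}) f` for `s = -1`. -/
def wirtinger (v : Coord) (s : ℂ) (f : Coord → ℂ) (p : Coord) : ℂ :=
  (fderiv ℝ f p v - s * Complex.I * fderiv ℝ f p (Complex.I • v)) / 2

/-- `∂f/∂ζ`. -/
def dz : (Coord → ℂ) → Coord → ℂ := wirtinger (1, 0) 1
/-- `∂f/∂ζ̄`. -/
def dzb : (Coord → ℂ) → Coord → ℂ := wirtinger (1, 0) (-1)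
/-- `∂f/∂w`. -/
def dw : (Coord → ℂ) → Coord → ℂ := wirtinger (0, 1) 1
/-- `∂f/∂w̄`. -/
def dwb : (Coord → ℂ) → Coord → ℂ := wirtinger (0, 1) (-1)

namespace HasWirtinger

variable {f : Coord → ℂ} {a b c d : ℂ} {p : Coord}

theorem dz_eq (h : HasWirtinger f a b c d p) : dz f p = a := by
  simp only [dz, wirtinger, h.fderiv_apply, Prod.smul_mk, smul_eq_mul, Complex.conj_I,
    map_one, map_zero, mul_one, mul_zero, add_zero, one_mul]
  linear_combination (-(a - b) / 2) * Complex.I_mul_I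

theorem dzb_eq (h : HasWirtinger f a b c d p) : dzb f p = b := by
  simp only [dzb, wirtinger, h.fderiv_apply, Prod.smul_mk, smul_eq_mul, Complex.conj_I,
    map_one, map_zero, mul_one, mul_zero, add_zero]
  linear_combination ((a - b) / 2) * Complex.I_mul_I

theorem dw_eq (h : HasWirtinger f a b c d p) : dw f p = c := by
  simp only [dw, wirtinger, h.fderiv_apply, Prod.smul_mk, smul_eq_mul, Complex.conj_I,
    map_one, map_zero, mul_one, mul_zero, add_zero, one_mul]
  linear_combination (-(c - d) / 2) * Complex.I_mul_I

theorem dwb_eq (h : HasWirtinger f a b c d p) : dwb f p = d := by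
  simp only [dwb, wirtinger, h.fderiv_apply, Prod.smul_mk, smul_eq_mul, Complex.conj_I,
    map_one, map_zero, mul_one, mul_zero, add_zero]
  linear_combination ((c - d) / 2) * Complex.I_mul_I

end HasWirtinger

theorem hasWirtinger_of_differentiableAt {f : Coord → ℂ} {p : Coord}
    (hf : DifferentiableAt ℝ f p) : HasWirtinger f (dz f p) (dzb f p) (dw f p) (dwb f p) p := by
  have : fderiv ℝ f p = wirtingerForm (dz f p) (dzb f p) (dw f p) (dwb f p) := by
    refine ContinuousLinearMap.ext fun u => ?_
    have e : u = u.1.re • ((1 : ℂ), (0 : ℂ)) + u.1.im • (Complex.I • ((1 : ℂ), (0 : ℂ)))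
        + u.2.re • ((0 : ℂ), (1 : ℂ)) + u.2.im • (Complex.I • ((0 : ℂ), (1 : ℂ))) := by
      ext <;> simp
    rw [wirtingerForm_apply]
    conv_lhs => rw [e]
    simp only [map_add, map_smul, dz, dzb, dw, dwb, wirtinger, Complex.real_smul]
    have h1 : (u.1.re : ℂ) = (u.1 + (starRingEnd ℂ) u.1) / 2 := by
      rw [Complex.re_eq_add_conj]
    have h2 : (u.1.im : ℂ) = (u.1 - (starRingEnd ℂ) u.1) / (2 * Complex.I) := by
      rw [Complex.im_eq_sub_conj]
    have h3 : (u.2.re : ℂ) = (u.2 + (starRingEnd ℂ) u.2) / 2 := by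
      rw [Complex.re_eq_add_conj]
    have h4 : (u.2.im : ℂ) = (u.2 - (starRingEnd ℂ) u.2) / (2 * Complex.I) := by
      rw [Complex.im_eq_sub_conj]
    rw [h1, h2, h3, h4]
    have hI : Complex.I⁻¹ = -Complex.I := Complex.inv_I
    simp only [div_eq_mul_inv, mul_inv, hI]
    ring
  rw [HasWirtinger, ← this]
  exact hf.hasFDerivAt

theorem HasWirtinger.eq_of_eventuallyEq {f g : Coord → ℂ} {a b c d a' b' c' d' : ℂ} {p : Coord}
    (hf : HasWirtinger f a b c d p) (hg : HasWirtinger g a' b' c' d' p)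
    (hfg : f =ᶠ[nhds p] g) : a = a' ∧ b = b' ∧ c = c' ∧ d = d' := by
  have h : HasWirtinger g a b c d p := HasFDerivAt.congr_of_eventuallyEq hf hfg.symm
  exact ⟨h.dz_eq.symm.trans hg.dz_eq, h.dzb_eq.symm.trans hg.dzb_eq,
    h.dw_eq.symm.trans hg.dw_eq, h.dwb_eq.symm.trans hg.dwb_eq⟩

/-- Wirtinger derivatives of a `C²` function commute. -/
theorem wirtinger_comm {f : Coord → ℂ} {p : Coord} (hf : ContDiffAt ℝ 2 f p) (v v' : Coord)
    (s s' : ℂ) : wirtinger v s (wirtinger v' s' f) p = wirtinger v' s' (wirtinger v s f) p := by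
  have hd : DifferentiableAt ℝ (fderiv ℝ f) p :=
    (hf.fderiv_right (m := 1) (by norm_num)).differentiableAt (by norm_num)
  have hs : IsSymmSndFDerivAt ℝ f p := hf.isSymmSndFDerivAt (by simp)
  have key (v' : Coord) (s' : ℂ) (u : Coord) : fderiv ℝ (wirtinger v' s' f) p u
      = (fderiv ℝ (fderiv ℝ f) p u v'
        - s' * Complex.I * fderiv ℝ (fderiv ℝ f) p u (Complex.I • v')) / 2 := by
    have h1 (x : Coord) : HasFDerivAt (fun q => fderiv ℝ f q x)
        ((fderiv ℝ (fderiv ℝ f) p).flip x) p := by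
      have := hd.hasFDerivAt.clm_apply (hasFDerivAt_const x p)
      simpa using this
    have h2 : HasFDerivAt (wirtinger v' s' f) (((2 : ℂ)⁻¹) • ((fderiv ℝ (fderiv ℝ f) p).flip v'
        - (s' * Complex.I) • (fderiv ℝ (fderiv ℝ f) p).flip (Complex.I • v'))) p := by
      have := (((h1 v').sub ((h1 (Complex.I • v')).const_mul (s' * Complex.I))).const_mul
        ((2 : ℂ)⁻¹))
      refine this.congr_of_eventuallyEq (Filter.Eventually.of_forall fun q => ?_)
      simp only [wirtinger]; simp; ring
    rw [h2.fderiv]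
    simp only [smul_apply, sub_apply, ContinuousLinearMap.flip_apply, smul_eq_mul]
    ring
  change (fderiv ℝ (wirtinger v' s' f) p v
      - s * Complex.I * fderiv ℝ (wirtinger v' s' f) p (Complex.I • v)) / 2
    = (fderiv ℝ (wirtinger v s f) p v'
      - s' * Complex.I * fderiv ℝ (wirtinger v s f) p (Complex.I • v')) / 2
  rw [key, key, key, key, hs.eq v v', hs.eq (Complex.I • v) v', hs.eq v (Complex.I • v'),
    hs.eq (Complex.I • v) (Complex.I • v')]
  ring

theorem wirtinger_congr {f g : Coord → ℂ} {p : Coord} (h : f =ᶠ[nhds p] g) (v : Coord) (s : ℂ) :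
    wirtinger v s f p = wirtinger v s g p := by
  simp only [wirtinger, h.fderiv_eq]

theorem wirtinger_eq_zero {f : Coord → ℂ} {V : Set Coord} (hV : IsOpen V)
    (h : ∀ q ∈ V, f q = 0) {p : Coord} (hp : p ∈ V) (v : Coord) (s : ℂ) :
    wirtinger v s f p = 0 := by
  have : f =ᶠ[nhds p] fun _ => 0 := by
    filter_upwards [hV.mem_nhds hp] with q hq using h q hq
  rw [wirtinger_congr this]
  simp [wirtinger]

theorem wirtinger_add {f g : Coord → ℂ} {p : Coord} (hf : DifferentiableAt ℝ f p)
    (hg : DifferentiableAt ℝ g p) (v : Coord) (s : ℂ) :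
    wirtinger v s (fun q => f q + g q) p = wirtinger v s f p + wirtinger v s g p := by
  simp only [wirtinger, fderiv_fun_add hf hg, add_apply]
  ring

theorem wirtinger_mul {f g : Coord → ℂ} {p : Coord} (hf : DifferentiableAt ℝ f p)
    (hg : DifferentiableAt ℝ g p) (v : Coord) (s : ℂ) :
    wirtinger v s (fun q => f q * g q) p = wirtinger v s f p * g p + f p * wirtinger v s g p := by
  simp only [wirtinger, fderiv_fun_mul hf hg, add_apply, smul_apply, smul_eq_mul]
  ring

theorem wirtinger_sum {n : ℕ} {f : ℕ → Coord → ℂ} {p : Coord}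
    (hf : ∀ i, DifferentiableAt ℝ (f i) p) (v : Coord) (s : ℂ) :
    wirtinger v s (fun q => ∑ i ∈ Finset.range n, f i q) p
      = ∑ i ∈ Finset.range n, wirtinger v s (f i) p := by
  induction n with
  | zero => simp [wirtinger]
  | succ n ih =>
    simp only [Finset.sum_range_succ]
    rw [wirtinger_add (DifferentiableAt.fun_sum fun i _ => hf i) (hf n), ih]

theorem wirtinger_pow {f : Coord → ℂ} {p : Coord} (hf : DifferentiableAt ℝ f p)
    (n : ℕ) (v : Coord) (s : ℂ) :
    wirtinger v s (fun q => f q ^ n) p = n * f p ^ (n - 1) * wirtinger v s f p := by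
  simp only [wirtinger, fderiv_fun_pow n hf, smul_apply, smul_eq_mul, nsmul_eq_mul]
  ring

/-- If a Wirtinger derivation kills the coefficients `a i` but not `r`, then a polynomial relation
`∑ aᵢ rⁱ = 0` on an open set is trivial. -/
theorem coeff_eq_zero_of_sum_eq_zero {V : Set Coord} (hV : IsOpen V) {v : Coord} {s : ℂ}
    {r : Coord → ℂ} (hr : ∀ p ∈ V, DifferentiableAt ℝ r p)
    (hr0 : ∀ p ∈ V, wirtinger v s r p ≠ 0) (n : ℕ) (a : ℕ → Coord → ℂ)
    (ha : ∀ i, ∀ p ∈ V, DifferentiableAt ℝ (a i) p)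
    (ha0 : ∀ i, ∀ p ∈ V, wirtinger v s (a i) p = 0)
    (h : ∀ p ∈ V, ∑ i ∈ Finset.range n, a i p * r p ^ i = 0) :
    ∀ i < n, ∀ p ∈ V, a i p = 0 := by
  induction n generalizing a with
  | zero => intro i hi; omega
  | succ n ih =>
    -- the derivation lowers the degree of the relation
    have hsucc : ∀ i < n, ∀ p ∈ V, a (i + 1) p = 0 := by
      have h1 := ih (fun i q => ((i : ℂ) + 1) * a (i + 1) q)
        (fun i p hp => (ha (i + 1) p hp).const_mul _) ?_ ?_
      · intro i hi p hp
        have h2 := h1 i hi p hp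
        have h3 : (i : ℂ) + 1 ≠ 0 := Nat.cast_add_one_ne_zero i
        simpa [h3] using h2
      · intro i p hp
        rw [wirtinger_mul (differentiableAt_const _) (ha _ p hp), ha0 _ p hp]
        simp [wirtinger]
      · intro p hp
        have h2 := wirtinger_eq_zero hV h hp v s
        rw [wirtinger_sum (f := fun i q => a i q * r q ^ i)
          (fun i => (ha i p hp).fun_mul ((hr p hp).fun_pow i)),
          Finset.sum_range_succ'] at h2
        have h3 (i : ℕ) : wirtinger v s (fun q => a i q * r q ^ i) p
            = a i p * (i * r p ^ (i - 1) * wirtinger v s r p) := by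
          rw [wirtinger_mul (ha i p hp) ((hr p hp).fun_pow i), ha0 i p hp,
            wirtinger_pow (hr p hp)]
          ring
        simp only [h3, Nat.cast_zero, zero_mul, mul_zero, add_zero, Nat.add_sub_cancel] at h2
        refine (mul_eq_zero.mp ?_).resolve_right (hr0 p hp)
        rw [← h2, Finset.sum_mul]
        refine Finset.sum_congr rfl fun i _ => ?_
        push_cast; ring
    intro i hi p hp
    rcases i with _ | i
    · have h1 := h p hp
      rw [Finset.sum_range_succ'] at h1
      rw [Finset.sum_eq_zero fun i hi => by
        rw [hsucc i (Finset.mem_range.mp hi) p hp, zero_mul]] at h1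
      simpa using h1
    · exact hsucc i (by omega) p hp

theorem contDiffOn_wirtinger {V : Set Coord} (hV : IsOpen V) {f : Coord → ℂ}
    (hf : ContDiffOn ℝ ∞ f V) (v : Coord) (s : ℂ) : ContDiffOn ℝ ∞ (wirtinger v s f) V := by
  have h1 : ContDiffOn ℝ ∞ (fderiv ℝ f) V := hf.fderiv_of_isOpen hV (by simp)
  have h2 (x : Coord) : ContDiffOn ℝ ∞ (fun p => fderiv ℝ f p x) V :=
    h1.clm_apply contDiffOn_const
  have h3 : ContDiffOn ℝ ∞ (fun p =>
      (fderiv ℝ f p v - s * Complex.I * fderiv ℝ f p (Complex.I • v)) * (2 : ℂ)⁻¹) V :=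
    ((h2 v).sub (contDiffOn_const.mul (h2 (Complex.I • v)))).mul contDiffOn_const
  exact h3.congr fun p _ => by simp only [wirtinger, div_eq_mul_inv]

/-- Smooth functions on `V` that satisfy the Cauchy--Riemann equations. -/
structure HolomorphicOn (f : Coord → ℂ) (V : Set Coord) : Prop where
  smooth : ContDiffOn ℝ ∞ f V
  dzb_eq : ∀ p ∈ V, dzb f p = 0
  dwb_eq : ∀ p ∈ V, dwb f p = 0

namespace HolomorphicOn

variable {f g : Coord → ℂ} {V : Set Coord} {p : Coord}

theorem differentiableAt (hf : HolomorphicOn f V) (hV : IsOpen V) (hp : p ∈ V) :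
    DifferentiableAt ℝ f p :=
  (hf.smooth.differentiableOn (by simp)).differentiableAt (hV.mem_nhds hp)

theorem hasWirtinger (hf : HolomorphicOn f V) (hV : IsOpen V) (hp : p ∈ V) :
    HasWirtinger f (dz f p) 0 (dw f p) 0 p :=
  (hasWirtinger_of_differentiableAt (hf.differentiableAt hV hp)).congr_values rfl
    (hf.dzb_eq p hp) rfl (hf.dwb_eq p hp)

theorem of_hasWirtinger (hf : ContDiffOn ℝ ∞ f V)
    (h : ∀ p ∈ V, ∃ a b, HasWirtinger f a 0 b 0 p) : HolomorphicOn f V := by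
  refine ⟨hf, fun p hp => ?_, fun p hp => ?_⟩
  · obtain ⟨a, b, h1⟩ := h p hp; exact h1.dzb_eq
  · obtain ⟨a, b, h1⟩ := h p hp; exact h1.dwb_eq

theorem const (z : ℂ) (V : Set Coord) : HolomorphicOn (fun _ => z) V :=
  of_hasWirtinger contDiffOn_const fun p _ => ⟨0, 0, HasWirtinger.const z p⟩

theorem fst (V : Set Coord) : HolomorphicOn (fun q => q.1) V :=
  of_hasWirtinger contDiff_fst.contDiffOn fun p _ => ⟨1, 0, HasWirtinger.fst p⟩

theorem snd (V : Set Coord) : HolomorphicOn (fun q => q.2) V :=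
  of_hasWirtinger contDiff_snd.contDiffOn fun p _ => ⟨0, 1, HasWirtinger.snd p⟩

theorem add (hf : HolomorphicOn f V) (hg : HolomorphicOn g V) (hV : IsOpen V) :
    HolomorphicOn (fun q => f q + g q) V :=
  of_hasWirtinger (hf.smooth.add hg.smooth) fun _ hp => ⟨_, _,
    ((hf.hasWirtinger hV hp).add (hg.hasWirtinger hV hp)).congr_values rfl (by simp) rfl (by simp)⟩

theorem sub (hf : HolomorphicOn f V) (hg : HolomorphicOn g V) (hV : IsOpen V) :
    HolomorphicOn (fun q => f q - g q) V :=
  of_hasWirtinger (hf.smooth.sub hg.smooth) fun _ hp => ⟨_, _,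
    ((hf.hasWirtinger hV hp).sub (hg.hasWirtinger hV hp)).congr_values rfl (by simp) rfl (by simp)⟩

theorem mul (hf : HolomorphicOn f V) (hg : HolomorphicOn g V) (hV : IsOpen V) :
    HolomorphicOn (fun q => f q * g q) V :=
  of_hasWirtinger (hf.smooth.mul hg.smooth) fun _ hp => ⟨_, _,
    ((hf.hasWirtinger hV hp).mul (hg.hasWirtinger hV hp)).congr_values rfl (by simp) rfl (by simp)⟩

theorem div (hf : HolomorphicOn f V) (hg : HolomorphicOn g V) (hV : IsOpen V)
    (h0 : ∀ q ∈ V, g q ≠ 0) : HolomorphicOn (fun q => f q / g q) V :=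
  of_hasWirtinger ((hf.smooth.mul (hg.smooth.inv h0)).congr fun _ _ => div_eq_mul_inv _ _)
    fun q hq => ⟨_, _,
    ((hf.hasWirtinger hV hq).div (hg.hasWirtinger hV hq) (h0 q hq)).congr_values
      rfl (by simp) rfl (by simp)⟩

theorem wirtinger_one (hf : HolomorphicOn f V) (hV : IsOpen V) (v : Coord) :
    HolomorphicOn (wirtinger v 1 f) V := by
  have h2 : ∀ p ∈ V, ContDiffAt ℝ 2 f p := fun p hp =>
    ((hf.smooth.contDiffAt (hV.mem_nhds hp)).of_le (by norm_cast))
  refine ⟨contDiffOn_wirtinger hV hf.smooth v 1, fun p hp => ?_, fun p hp => ?_⟩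
  · rw [dzb, wirtinger_comm (h2 p hp)]
    exact wirtinger_eq_zero hV hf.dzb_eq hp v 1
  · rw [dwb, wirtinger_comm (h2 p hp)]
    exact wirtinger_eq_zero hV hf.dwb_eq hp v 1

protected theorem dz (hf : HolomorphicOn f V) (hV : IsOpen V) : HolomorphicOn (dz f) V :=
  hf.wirtinger_one hV (1, 0)

protected theorem dw (hf : HolomorphicOn f V) (hV : IsOpen V) : HolomorphicOn (dw f) V :=
  hf.wirtinger_one hV (0, 1)

theorem eq_const (hf : HolomorphicOn f V) (hV : IsOpen V) (hV' : IsPreconnected V)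
    (h1 : ∀ p ∈ V, dz f p = 0) (h2 : ∀ p ∈ V, dw f p = 0) : ∃ z, ∀ p ∈ V, f p = z := by
  refine hV.exists_is_const_of_fderiv_eq_zero (𝕜 := ℝ) hV'
    (hf.smooth.differentiableOn (by simp)) fun p hp => ?_
  refine ContinuousLinearMap.ext fun u => ?_
  rw [(hf.hasWirtinger hV hp).fderiv_apply, h1 p hp, h2 p hp]
  simp

end HolomorphicOn

open scoped ComplexConjugate

/-! ### The metric, the symplectic form and the structure `J` -/

theorem width_eq (p : Coord) : (width p : ℂ) = 1 + p.1 * conj p.1 := by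
  rw [Complex.mul_conj, Complex.normSq_eq_norm_sq, width]; push_cast; rfl

theorem width_pos (p : Coord) : 0 < width p := by
  rw [width]; positivity

theorem width_ne_zero (p : Coord) : (width p : ℂ) ≠ 0 :=
  Complex.ofReal_ne_zero.mpr (width_pos p).ne'

theorem radius_pos (p : Coord) : 0 < radius p := by
  rw [radius]; positivity

theorem radius_ne_zero (p : Coord) : (radius p : ℂ) ≠ 0 :=
  Complex.ofReal_ne_zero.mpr (radius_pos p).ne'

theorem radius_sq (p : Coord) : radius p ^ 2 = 1 + ‖p.2‖ ^ 2 * width p ^ 2 := by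
  rw [radius, Real.sq_sqrt (by positivity)]

theorem radius_sq_eq (p : Coord) :
    (radius p : ℂ) ^ 2 = 1 + p.2 * conj p.2 * (width p : ℂ) ^ 2 := by
  rw [Complex.mul_conj, Complex.normSq_eq_norm_sq]
  exact_mod_cast radius_sq p

theorem hasWirtinger_width (p : Coord) :
    HasWirtinger (fun q => (width q : ℂ)) (conj p.1) p.1 0 0 p := by
  simp only [width_eq]
  refine ((HasWirtinger.const 1 p).add ((HasWirtinger.fst p).mul
    (HasWirtinger.fst p).conj)).congr_values ?_ ?_ ?_ ?_ <;> simp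

theorem HasWirtinger.sqrt {g : Coord → ℝ} {a b c d : ℂ} {p : Coord}
    (h : HasWirtinger (fun q => (g q : ℂ)) a b c d p) (h0 : 0 < g p) :
    HasWirtinger (fun q => ((√(g q) : ℝ) : ℂ)) (a / (2 * √(g p))) (b / (2 * √(g p)))
      (c / (2 * √(g p))) (d / (2 * √(g p))) p := by
  have h1 : HasFDerivAt g (Complex.reCLM ∘L wirtingerForm a b c d) p := by
    simpa [Function.comp_def] using Complex.reCLM.hasFDerivAt.comp p h
  have h2 : HasFDerivAt (fun q => (g q : ℂ))
      (Complex.ofRealCLM ∘L (Complex.reCLM ∘L wirtingerForm a b c d)) p := by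
    simpa [Function.comp_def] using Complex.ofRealCLM.hasFDerivAt.comp p h1
  have h3 := h2.unique h
  have h4 := Complex.ofRealCLM.hasFDerivAt.comp p (h1.sqrt h0.ne')
  refine (HasFDerivAt.congr_fderiv h4 (ContinuousLinearMap.ext fun u => ?_))
  have h5 : (((wirtingerForm a b c d u).re : ℝ) : ℂ) = wirtingerForm a b c d u :=
    congrArg (fun L : Coord →L[ℝ] ℂ => L u) h3
  simp only [ContinuousLinearMap.comp_apply, smul_apply, Complex.ofRealCLM_apply,
    Complex.reCLM_apply, smul_eq_mul, Complex.ofReal_mul, h5]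
  simp only [wirtingerForm_apply]
  push_cast
  ring

theorem hasWirtinger_radius (p : Coord) :
    HasWirtinger (fun q => (radius q : ℂ))
      (p.2 * conj p.2 * width p * conj p.1 / radius p) (p.2 * conj p.2 * width p * p.1 / radius p)
      (conj p.2 * width p ^ 2 / (2 * radius p)) (p.2 * width p ^ 2 / (2 * radius p)) p := by
  have e (q : Coord) : 1 + (q.2 * conj q.2) * ((width q : ℂ) * (width q : ℂ))
      = ((1 + ‖q.2‖ ^ 2 * width q ^ 2 : ℝ) : ℂ) := by
    rw [← radius_sq]; push_cast; rw [radius_sq_eq]; ring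
  have h := (HasWirtinger.const 1 p).add (((HasWirtinger.snd p).mul (HasWirtinger.snd p).conj).mul
    ((hasWirtinger_width p).mul (hasWirtinger_width p)))
  rw [funext e] at h
  have hr := radius_ne_zero p
  refine (h.sqrt (by positivity)).congr_values ?_ ?_ ?_ ?_ <;>
  · rw [← radius]
    simp only [map_zero, map_one]
    field_simp
    ring

theorem fibreForm_apply (p u : Coord) :
    fibreForm p u = width p * u.2 + 2 * conj p.1 * p.2 * u.1 := by
  simp [fibreForm]

theorem hasWirtinger_fibreForm (p v : Coord) :
    HasWirtinger (fun q => fibreForm q v) (conj p.1 * v.2) (p.1 * v.2 + 2 * p.2 * v.1)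
      (2 * conj p.1 * v.1) 0 p := by
  simp only [fibreForm_apply]
  refine (((hasWirtinger_width p).mul (HasWirtinger.const v.2 p)).add
    ((((HasWirtinger.const 2 p).mul (HasWirtinger.fst p).conj).mul (HasWirtinger.snd p)).mul
      (HasWirtinger.const v.1 p))).congr_values ?_ ?_ ?_ ?_ <;> simp

/-- The Hermitian form of the Kähler structure `(g, I)`, complex-linear in `u` and antilinear in
`v`; the metric is its real part. -/
def hermitian (p u v : Coord) : ℂ :=
  radius p / width p ^ 2 * (u.1 * conj v.1)
    + 1 / (4 * radius p) * (fibreForm p u * conj (fibreForm p v))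

theorem metric_eq_re (p u v : Coord) : metric p u v = (hermitian p u v).re := by
  have h1 : ((radius p : ℂ) / width p ^ 2) = ((radius p / width p ^ 2 : ℝ) : ℂ) := by push_cast; rfl
  have h2 : (1 / (4 * (radius p : ℂ))) = ((1 / (4 * radius p) : ℝ) : ℂ) := by push_cast; rfl
  rw [hermitian, h1, h2, Complex.add_re, Complex.re_ofReal_mul, Complex.re_ofReal_mul, metric]

theorem hermitian_conj (p u v : Coord) : conj (hermitian p u v) = hermitian p v u := by
  simp only [hermitian, map_add, map_mul, map_div₀, map_pow, Complex.conj_ofReal, Complex.conj_conj,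
    map_one, map_ofNat]
  ring

theorem hermitian_add_left (p u u' v : Coord) :
    hermitian p (u + u') v = hermitian p u v + hermitian p u' v := by
  simp only [hermitian, map_add, Prod.fst_add]; ring

theorem hermitian_smul_left (p u v : Coord) (c : ℂ) :
    hermitian p (c • u) v = c * hermitian p u v := by
  simp only [hermitian, fibreForm_apply, Prod.smul_fst, Prod.smul_snd, smul_eq_mul]; ring

theorem hermitian_add_right (p u v v' : Coord) :
    hermitian p u (v + v') = hermitian p u v + hermitian p u v' := by
  simp only [hermitian, map_add, Prod.fst_add]; ring

theorem hermitian_smul_right (p u v : Coord) (c : ℂ) :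
    hermitian p u (c • v) = conj c * hermitian p u v := by
  simp only [hermitian, fibreForm_apply, Prod.smul_fst, Prod.smul_snd, smul_eq_mul, map_add,
    map_mul]; ring

theorem hermitian_self_pos (p u : Coord) (hu : u ≠ 0) : 0 < (hermitian p u u).re := by
  rw [← metric_eq_re, metric, Complex.mul_conj, Complex.mul_conj, Complex.ofReal_re,
    Complex.ofReal_re]
  have hr := radius_pos p
  have hw := width_pos p
  by_cases h1 : u.1 = 0
  · have h2 : u.2 ≠ 0 := fun h2 => hu (Prod.ext h1 h2)
    have h3 : fibreForm p u ≠ 0 := by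
      rw [fibreForm_apply, h1, mul_zero, add_zero]
      exact mul_ne_zero (width_ne_zero p) h2
    have h4 := Complex.normSq_pos.mpr h3
    have h5 := Complex.normSq_nonneg u.1
    positivity
  · have h4 := Complex.normSq_pos.mpr h1
    have h5 := Complex.normSq_nonneg (fibreForm p u)
    positivity

theorem eq_zero_of_hermitian_self {p u : Coord} (h : hermitian p u u = 0) : u = 0 := by
  by_contra hu
  have := hermitian_self_pos p u hu
  rw [h] at this
  exact lt_irrefl _ this

/-- The holomorphic symplectic form `½ dζ ∧ dw`. -/
def symplectic (u v : Coord) : ℂ := (u.1 * v.2 - u.2 * v.1) / 2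

theorem eq_of_symplectic_eq {v v' : Coord} (h : ∀ u, symplectic u v = symplectic u v') :
    v = v' := by
  have h1 := h (1, 0)
  have h2 := h (0, 1)
  simp only [symplectic] at h1 h2
  exact Prod.ext (by linear_combination (-2) * h2) (by linear_combination 2 * h1)

theorem structI_apply (p u : Coord) : structI p u = Complex.I • u := by
  simp [structI]

theorem structJ_apply (p u : Coord) : structJ p u
    = (-(width p / (2 * radius p)) * conj (fibreForm p u),
      2 * radius p / width p ^ 2 * conj u.1
        + conj p.1 * p.2 / radius p * conj (fibreForm p u)) := by
  simp [structJ]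

theorem structJ_smul (p u : Coord) (c : ℂ) : structJ p (c • u) = conj c • structJ p u := by
  simp only [structJ_apply, fibreForm_apply, Prod.smul_fst, Prod.smul_snd, smul_eq_mul,
    Prod.smul_mk, map_add, map_mul]
  ext <;> simp only <;> ring

/-- The relation `h(u, v) = ω(u, J v)` determines `J`, since `ω` is nondegenerate. -/
theorem hermitian_eq_symplectic (p u v : Coord) :
    hermitian p u v = symplectic u (structJ p v) := by
  have hr := radius_ne_zero p
  have hw := width_ne_zero p
  simp only [symplectic, structJ_apply, hermitian, fibreForm_apply p u]
  field_simp
  ring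

theorem structJ_structJ (p u : Coord) : structJ p (structJ p u) = -u := by
  have hr := radius_ne_zero p
  have hw := width_ne_zero p
  have h2 := radius_sq_eq p
  have h1 : fibreForm p (structJ p u) = 2 * radius p / width p * conj u.1 := by
    rw [fibreForm_apply]
    simp only [structJ_apply]
    field_simp
    ring
  rw [structJ_apply p (structJ p u), h1]
  simp only [structJ_apply p u, map_mul, map_div₀, map_ofNat, Complex.conj_ofReal,
    Complex.conj_conj, map_neg]
  ext
  · simp only [Prod.fst_neg]; field_simp
  · simp only [Prod.snd_neg, fibreForm_apply]; field_simp; ring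

theorem symplectic_swap (u v : Coord) : symplectic u v = -symplectic v u := by
  simp only [symplectic]; ring

theorem hermitian_structJ_structJ (p u v : Coord) :
    hermitian p (structJ p u) (structJ p v) = hermitian p v u := by
  rw [hermitian_eq_symplectic, structJ_structJ, hermitian_eq_symplectic, symplectic_swap v]
  simp only [symplectic, Prod.fst_neg, Prod.snd_neg]; ring

theorem hermitian_structJ_left (p u v : Coord) :
    hermitian p (structJ p u) v = conj (symplectic u v) := by
  rw [← hermitian_conj, hermitian_eq_symplectic, structJ_structJ]
  congr 1
  simp only [symplectic, Prod.fst_neg, Prod.snd_neg]; ring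

/-! ### Smoothness -/

theorem contDiff_width : ContDiff ℝ ∞ (fun p => (width p : ℂ)) := by
  simp only [width_eq]
  have : ContDiff ℝ ∞ (fun p : Coord => conj p.1) :=
    Complex.conjCLE.contDiff.comp contDiff_fst
  exact contDiff_const.add (contDiff_fst.mul this)

theorem contDiff_radius_real : ContDiff ℝ ∞ radius := by
  have h : ContDiff ℝ ∞ (fun p : Coord => 1 + ‖p.2‖ ^ 2 * (1 + ‖p.1‖ ^ 2) ^ 2) :=
    contDiff_const.add ((contDiff_snd.norm_sq ℝ).mul
      ((contDiff_const.add (contDiff_fst.norm_sq ℝ)).pow 2))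
  exact h.sqrt fun p => by positivity

theorem contDiff_radius : ContDiff ℝ ∞ (fun p => (radius p : ℂ)) :=
  Complex.ofRealCLM.contDiff.comp contDiff_radius_real

theorem contDiff_conj_fst : ContDiff ℝ ∞ (fun p : Coord => conj p.1) :=
  Complex.conjCLE.contDiff.comp contDiff_fst

theorem contDiff_fibreForm (v : Coord) : ContDiff ℝ ∞ (fun p => fibreForm p v) := by
  simp only [fibreForm_apply]
  exact (contDiff_width.mul contDiff_const).add
    (((contDiff_const.mul contDiff_conj_fst).mul contDiff_snd).mul contDiff_const)

theorem contDiff_conj_fibreForm (v : Coord) : ContDiff ℝ ∞ (fun p => conj (fibreForm p v)) :=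
  Complex.conjCLE.contDiff.comp (contDiff_fibreForm v)

theorem ContDiff.div_of_ne_zero {f g : Coord → ℂ} (hf : ContDiff ℝ ∞ f) (hg : ContDiff ℝ ∞ g)
    (h0 : ∀ p, g p ≠ 0) : ContDiff ℝ ∞ (fun p => f p / g p) := by
  simp only [div_eq_mul_inv]
  exact hf.mul (hg.inv h0)

theorem contDiff_hermitian (u v : Coord) : ContDiff ℝ ∞ (fun p => hermitian p u v) := by
  have hr := radius_ne_zero
  have hw := width_ne_zero
  refine ((ContDiff.div_of_ne_zero contDiff_radius (contDiff_width.pow 2)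
    fun p => pow_ne_zero 2 (hw p)).mul contDiff_const).add
    ((ContDiff.div_of_ne_zero contDiff_const (contDiff_const.mul contDiff_radius)
      fun p => mul_ne_zero (by norm_num) (hr p)).mul
      ((contDiff_fibreForm u).mul (contDiff_conj_fibreForm v)))

theorem contDiff_structJ_apply (v : Coord) : ContDiff ℝ ∞ (fun p => structJ p v) := by
  have hr := radius_ne_zero
  have hw := width_ne_zero
  simp only [structJ_apply]
  refine ContDiff.prodMk ((ContDiff.div_of_ne_zero contDiff_width
    (contDiff_const.mul contDiff_radius) fun p => mul_ne_zero (by norm_num) (hr p)).neg.mul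
      (contDiff_conj_fibreForm v)) ?_
  exact ((ContDiff.div_of_ne_zero (contDiff_const.mul contDiff_radius) (contDiff_width.pow 2)
    fun p => pow_ne_zero 2 (hw p)).mul contDiff_const).add
    ((ContDiff.div_of_ne_zero (contDiff_conj_fst.mul contDiff_snd) contDiff_radius hr).mul
      (contDiff_conj_fibreForm v))

theorem contDiff_structJ : ContDiff ℝ ∞ structJ :=
  contDiff_clm_apply_iff.mpr contDiff_structJ_apply

/-- The derivative of the Hermitian form, applied to constant vectors. -/
theorem hasWirtinger_hermitian (p u v : Coord) : HasWirtinger (fun q => hermitian q u v)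
    ((p.2 * conj p.2 * width p ^ 2 - 2 * radius p ^ 2) * conj p.1 / (radius p * width p ^ 3)
        * (u.1 * conj v.1)
      - p.2 * conj p.2 * width p * conj p.1 / (4 * radius p ^ 3)
        * (fibreForm p u * conj (fibreForm p v))
      + 1 / (4 * radius p) * (conj p.1 * u.2 * conj (fibreForm p v)
        + fibreForm p u * (conj p.1 * conj v.2 + 2 * conj p.2 * conj v.1)))
    ((p.2 * conj p.2 * width p ^ 2 - 2 * radius p ^ 2) * p.1 / (radius p * width p ^ 3)
        * (u.1 * conj v.1)
      - p.2 * conj p.2 * width p * p.1 / (4 * radius p ^ 3)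
        * (fibreForm p u * conj (fibreForm p v))
      + 1 / (4 * radius p) * ((p.1 * u.2 + 2 * p.2 * u.1) * conj (fibreForm p v)
        + fibreForm p u * (p.1 * conj v.2)))
    (conj p.2 / (2 * radius p) * (u.1 * conj v.1)
      - conj p.2 * width p ^ 2 / (8 * radius p ^ 3) * (fibreForm p u * conj (fibreForm p v))
      + 1 / (4 * radius p) * (2 * conj p.1 * u.1 * conj (fibreForm p v)))
    (p.2 / (2 * radius p) * (u.1 * conj v.1)
      - p.2 * width p ^ 2 / (8 * radius p ^ 3) * (fibreForm p u * conj (fibreForm p v))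
      + 1 / (4 * radius p) * (fibreForm p u * (2 * p.1 * conj v.1))) p := by
  have hr := radius_ne_zero p
  have hw := width_ne_zero p
  have hR := hasWirtinger_radius p
  have hW := hasWirtinger_width p
  have h1 := (hR.div (hW.mul hW) (mul_ne_zero hw hw)).mul (HasWirtinger.const (u.1 * conj v.1) p)
  have h2 := ((HasWirtinger.const 1 p).div ((HasWirtinger.const 4 p).mul hR)
    (mul_ne_zero (by norm_num) hr)).mul
      ((hasWirtinger_fibreForm p u).mul (hasWirtinger_fibreForm p v).conj)
  have e : (fun q => hermitian q u v) = fun q =>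
      (radius q : ℂ) / ((width q : ℂ) * (width q : ℂ)) * (u.1 * conj v.1)
      + 1 / (4 * (radius q : ℂ)) * (fibreForm q u * conj (fibreForm q v)) := by
    funext q; rw [hermitian, sq]
  rw [e]
  refine (h1.add h2).congr_values ?_ ?_ ?_ ?_
  all_goals
    simp only [map_zero, map_add, map_mul, map_ofNat, Complex.conj_conj]
    field_simp
    ring

/-! ### The hyperkähler structure -/

/-- The Christoffel symbols of the Levi-Civita connection in a chart. Since `g` is Kähler they are
complex-bilinear, with `h(Γ(u, v), w) = ∂_u h(v, w)` for the Hermitian form `h`. -/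
def christoffel (p u v : Coord) : Coord :=
  let a : ℂ := conj p.2 * width p / (2 * radius p ^ 2)
  let x : ℂ := a * (fibreForm p u * v.1 + fibreForm p v * u.1) - 2 * conj p.1 * u.1 * v.1 / width p
  (x, (-(a * fibreForm p u * fibreForm p v) + 2 * conj p.1 * (u.1 * v.2 + u.2 * v.1)
    + 2 * conj p.1 ^ 2 * p.2 * u.1 * v.1 / width p - 2 * conj p.1 * p.2 * x) / width p)

theorem christoffel_symm (p u v : Coord) : christoffel p u v = christoffel p v u := by
  simp only [christoffel]
  ext <;> simp only <;> ring

theorem christoffel_add_left (p u u' v : Coord) :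
    christoffel p (u + u') v = christoffel p u v + christoffel p u' v := by
  simp only [christoffel, map_add, Prod.fst_add, Prod.snd_add, Prod.mk_add_mk]
  ext <;> simp only <;> ring

theorem christoffel_smul_left (p u v : Coord) (c : ℂ) :
    christoffel p (c • u) v = c • christoffel p u v := by
  simp only [christoffel, fibreForm_apply, Prod.smul_fst, Prod.smul_snd, Prod.smul_mk, smul_eq_mul]
  ext <;> simp only <;> ring

theorem christoffel_smul_right (p u v : Coord) (c : ℂ) :
    christoffel p u (c • v) = c • christoffel p u v := by
  rw [christoffel_symm, christoffel_smul_left, christoffel_symm]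

theorem fibreForm_christoffel (p u v : Coord) : fibreForm p (christoffel p u v)
    = -(conj p.2 * width p / (2 * radius p ^ 2) * fibreForm p u * fibreForm p v)
      + 2 * conj p.1 * (u.1 * v.2 + u.2 * v.1)
      + 2 * conj p.1 ^ 2 * p.2 * u.1 * v.1 / width p := by
  have hw := width_ne_zero p
  rw [fibreForm_apply p (christoffel p u v)]
  simp only [christoffel]
  field_simp
  ring

/-- The connection preserves the Hermitian form. -/
theorem fderiv_hermitian_eq_christoffel (p u v w : Coord) :
    fderiv ℝ (fun q => hermitian q v w) p u
      = hermitian p (christoffel p u v) w + hermitian p v (christoffel p u w) := by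
  have hr := radius_ne_zero p
  have hw := width_ne_zero p
  have hW := width_eq p
  rw [(hasWirtinger_hermitian p v w).fderiv_apply]
  simp only [hermitian, fibreForm_christoffel]
  simp only [christoffel, map_add, map_sub, map_neg, map_mul, map_div₀, map_pow, map_ofNat,
    Complex.conj_ofReal, Complex.conj_conj, fibreForm_apply]
  field_simp
  rw [hW]
  ring

/-- The connection preserves the symplectic form. -/
theorem symplectic_christoffel (p u v w : Coord) :
    symplectic (christoffel p u v) w + symplectic v (christoffel p u w) = 0 := by
  have hr := radius_ne_zero p
  have hw := width_ne_zero p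
  simp only [symplectic, christoffel, fibreForm_apply]
  field_simp
  ring

theorem fderiv_hermitian_eq_symplectic (p x u v : Coord) :
    fderiv ℝ (fun q => hermitian q u v) p x = symplectic u (fderiv ℝ structJ p x v) := by
  have hd : DifferentiableAt ℝ structJ p := contDiff_structJ.differentiable (by simp) p
  have h1 : HasFDerivAt (fun q => structJ q v) ((fderiv ℝ structJ p).flip v) p := by
    simpa using hd.hasFDerivAt.clm_apply (hasFDerivAt_const v p)
  let L : Coord →L[ℝ] ℂ := (2 : ℂ)⁻¹ •
    (u.1 • ContinuousLinearMap.snd ℝ ℂ ℂ - u.2 • ContinuousLinearMap.fst ℝ ℂ ℂ)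
  have hL (y : Coord) : symplectic u y = L y := by
    simp [L, symplectic]; ring
  have h2 : HasFDerivAt (fun q => hermitian q u v) (L ∘L (fderiv ℝ structJ p).flip v) p := by
    simp only [hermitian_eq_symplectic, hL]
    exact L.hasFDerivAt.comp p h1
  rw [h2.fderiv, hL]
  rfl

theorem fderiv_metric (p x u v : Coord) :
    fderiv ℝ (fun q => metric q u v) p x = (fderiv ℝ (fun q => hermitian q u v) p x).re := by
  have hd : DifferentiableAt ℝ (fun q => hermitian q u v) p :=
    (contDiff_hermitian u v).differentiable (by simp) p
  have h1 : HasFDerivAt (fun q => metric q u v) _ p :=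
    (Complex.reCLM.hasFDerivAt.comp p hd.hasFDerivAt).congr_of_eventuallyEq
      (Filter.Eventually.of_forall fun q => metric_eq_re q u v)
  rw [h1.fderiv]
  simp

theorem fderiv_structJ_apply (p u v : Coord) : fderiv ℝ structJ p u v
    = structJ p (christoffel p u v) - christoffel p u (structJ p v) := by
  refine eq_of_symplectic_eq fun x => ?_
  rw [← fderiv_hermitian_eq_symplectic, fderiv_hermitian_eq_christoffel, hermitian_eq_symplectic,
    hermitian_eq_symplectic]
  have h := symplectic_christoffel p u x (structJ p v)
  simp only [symplectic, Prod.fst_sub, Prod.snd_sub] at h ⊢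
  linear_combination h

theorem hypercomplex_zero : hypercomplex 0 = structI := rfl

theorem hypercomplex_one : hypercomplex 1 = structJ := rfl

theorem hypercomplex_two : hypercomplex 2 = fun p => structI p ∘L structJ p := rfl

theorem hypercomplex_two_apply (p u : Coord) :
    hypercomplex 2 p u = Complex.I • structJ p u := by
  rw [hypercomplex_two, ContinuousLinearMap.comp_apply, structI_apply]

theorem fderiv_structI (p : Coord) : fderiv ℝ structI p = 0 := by
  have : structI = fun _ => Complex.I • ContinuousLinearMap.id ℝ Coord := rfl
  rw [this, fderiv_const_apply]

theorem contDiff_hypercomplex (j : Fin 3) : ContDiff ℝ ∞ (hypercomplex j) := by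
  fin_cases j
  · exact contDiff_const
  · exact contDiff_structJ
  · exact contDiff_const.clm_comp contDiff_structJ

theorem fderiv_hypercomplex_two (p u v : Coord) :
    fderiv ℝ (hypercomplex 2) p u v = Complex.I • fderiv ℝ structJ p u v := by
  have hd : DifferentiableAt ℝ structJ p := contDiff_structJ.differentiable (by simp) p
  have h : HasFDerivAt (hypercomplex 2) _ p :=
    (hasFDerivAt_const (Complex.I • ContinuousLinearMap.id ℝ Coord) p).clm_comp hd.hasFDerivAt
  rw [h.fderiv]
  simp

theorem HasWirtinger.hasFDerivAt_prod {X : Coord → Coord} {a b c d a' b' c' d' : ℂ} {p : Coord}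
    (h1 : HasWirtinger (fun q => (X q).1) a b c d p)
    (h2 : HasWirtinger (fun q => (X q).2) a' b' c' d' p) :
    HasFDerivAt X ((wirtingerForm a b c d).prod (wirtingerForm a' b' c' d')) p :=
  HasFDerivAt.prodMk h1 h2

theorem HasWirtinger.fderiv_prod_apply {X : Coord → Coord} {a b c d a' b' c' d' : ℂ} {p : Coord}
    (h1 : HasWirtinger (fun q => (X q).1) a b c d p)
    (h2 : HasWirtinger (fun q => (X q).2) a' b' c' d' p) (u : Coord) :
    fderiv ℝ X p u = (a * u.1 + b * conj u.1 + c * u.2 + d * conj u.2,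
      a' * u.1 + b' * conj u.1 + c' * u.2 + d' * conj u.2) := by
  rw [(h1.hasFDerivAt_prod h2).fderiv, ContinuousLinearMap.prod_apply, wirtingerForm_apply,
    wirtingerForm_apply]

theorem fderiv_transition {p : Coord} (hp : p.1 ≠ 0) (u : Coord) :
    fderiv ℝ transition p u = (u.1 / p.1 ^ 2, p.1 ^ 2 * u.2 + 2 * p.1 * p.2 * u.1) := by
  have h1 := ((HasWirtinger.fst p).inv hp).neg
  have h2 := ((HasWirtinger.fst p).mul (HasWirtinger.fst p)).mul (HasWirtinger.snd p)
  have e : transition = fun q => (-q.1⁻¹, q.1 * q.1 * q.2) := by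
    funext q; rw [transition, sq]
  rw [e, HasWirtinger.fderiv_prod_apply h1 h2]
  ext <;> simp only [] <;> field_simp <;> ring

theorem width_transition {p : Coord} (hp : p.1 ≠ 0) :
    width (transition p) = width p / ‖p.1‖ ^ 2 := by
  have : ‖p.1‖ ≠ 0 := norm_ne_zero_iff.mpr hp
  simp only [width, transition, norm_neg, norm_inv]
  field_simp
  ring

theorem radius_transition {p : Coord} (hp : p.1 ≠ 0) : radius (transition p) = radius p := by
  have : ‖p.1‖ ≠ 0 := norm_ne_zero_iff.mpr hp
  rw [radius, width_transition hp, radius]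
  simp only [transition, norm_mul, norm_pow]
  congr 2
  field_simp

theorem fibreForm_transition {p : Coord} (hp : p.1 ≠ 0) (u : Coord) :
    fibreForm (transition p) (fderiv ℝ transition p u) = p.1 / conj p.1 * fibreForm p u := by
  have h2 : conj p.1 ≠ 0 := (map_ne_zero _).mpr hp
  rw [fibreForm_apply, fderiv_transition hp, fibreForm_apply, width_transition hp]
  have h3 : ((‖p.1‖ ^ 2 : ℝ) : ℂ) = p.1 * conj p.1 := by
    rw [Complex.mul_conj, Complex.normSq_eq_norm_sq]
  push_cast at h3 ⊢
  rw [h3, width_eq]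
  simp only [transition, map_neg, map_inv₀]
  field_simp
  ring

theorem hermitian_transition {p : Coord} (hp : p.1 ≠ 0) (u v : Coord) :
    hermitian (transition p) (fderiv ℝ transition p u) (fderiv ℝ transition p v)
      = hermitian p u v := by
  have h2 : conj p.1 ≠ 0 := (map_ne_zero _).mpr hp
  have h3 : ((‖p.1‖ ^ 2 : ℝ) : ℂ) = p.1 * conj p.1 := by
    rw [Complex.mul_conj, Complex.normSq_eq_norm_sq]
  have hr := radius_ne_zero p
  have hw := width_ne_zero p
  rw [hermitian, fibreForm_transition hp, fibreForm_transition hp, radius_transition hp,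
    width_transition hp, hermitian, fderiv_transition hp, fderiv_transition hp]
  simp only [map_mul, map_div₀, Complex.conj_conj, map_pow]
  push_cast at h3 ⊢
  rw [h3]
  field_simp

theorem symplectic_transition {p : Coord} (hp : p.1 ≠ 0) (u v : Coord) :
    symplectic (fderiv ℝ transition p u) (fderiv ℝ transition p v) = symplectic u v := by
  simp only [fderiv_transition hp, symplectic]
  field_simp
  ring

theorem structJ_transition {p : Coord} (hp : p.1 ≠ 0) (u : Coord) :
    structJ (transition p) (fderiv ℝ transition p u) = fderiv ℝ transition p (structJ p u) := by
  refine eq_of_symplectic_eq fun v => ?_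
  -- `dT` is onto, so that `v` may be taken in its image
  obtain ⟨x, rfl⟩ : ∃ x, fderiv ℝ transition p x = v := by
    refine ⟨(p.1 ^ 2 * v.1, (v.2 - 2 * p.1 * p.2 * (p.1 ^ 2 * v.1)) / p.1 ^ 2), ?_⟩
    rw [fderiv_transition hp]
    ext <;> simp only [] <;> field_simp
    ring
  rw [← hermitian_eq_symplectic, hermitian_transition hp, symplectic_transition hp,
    hermitian_eq_symplectic]

theorem fderiv_transition_I_smul {p : Coord} (hp : p.1 ≠ 0) (u : Coord) :
    fderiv ℝ transition p (Complex.I • u) = Complex.I • fderiv ℝ transition p u := by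
  simp only [fderiv_transition hp, Prod.smul_fst, Prod.smul_snd, Prod.smul_mk, smul_eq_mul]
  ext <;> simp only <;> ring

theorem hermitian_I_smul (p u v : Coord) :
    hermitian p (Complex.I • u) (Complex.I • v) = hermitian p u v := by
  rw [hermitian_smul_left, hermitian_smul_right, ← mul_assoc, Complex.mul_conj]
  simp

theorem isHyperkahler : IsHyperkahler metric hypercomplex where
  smooth_metric u v := by
    simp only [metric_eq_re]
    exact Complex.reCLM.contDiff.comp (contDiff_hermitian u v)
  bilinear p := ⟨LinearMap.mk₂ ℝ (metric p) (fun u u' v => metric_add_left p u u' v)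
    (fun c u v => metric_smul_left p u v c) (fun u v v' => metric_add_right p u v v')
    (fun c u v => metric_smul_right p u v c), fun u v => rfl⟩
  symmetric p u v := by
    rw [metric_eq_re, metric_eq_re, ← hermitian_conj, Complex.conj_re]
  positive p u hu := by
    rw [metric_eq_re]; exact hermitian_self_pos p u hu
  metric_transition p hp u v := by
    rw [metric_eq_re, hermitian_transition hp, metric_eq_re]
  smooth_structure := contDiff_hypercomplex
  square j p u := by
    fin_cases j
    · change structI p (structI p u) = -u
      rw [structI_apply, structI_apply, smul_smul, Complex.I_mul_I, neg_one_smul]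
    · exact structJ_structJ p u
    · change hypercomplex 2 p (hypercomplex 2 p u) = -u
      rw [hypercomplex_two_apply, hypercomplex_two_apply, structJ_smul, structJ_structJ, smul_smul]
      simp
  product p u := by
    rw [hypercomplex_zero, hypercomplex_one, hypercomplex_two_apply, structI_apply, structI_apply,
      structJ_smul]
    simp
  orthogonal j p u v := by
    rw [metric_eq_re, metric_eq_re]
    have hJ : (hermitian p (structJ p u) (structJ p v)).re = (hermitian p u v).re := by
      rw [hermitian_structJ_structJ, ← hermitian_conj, Complex.conj_re]
    fin_cases j
    · change (hermitian p (structI p u) (structI p v)).re = _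
      rw [structI_apply, structI_apply, hermitian_I_smul]
    · exact hJ
    · change (hermitian p (hypercomplex 2 p u) (hypercomplex 2 p v)).re = _
      rw [hypercomplex_two_apply, hypercomplex_two_apply, hermitian_I_smul, hJ]
  structure_transition j p hp u := by
    fin_cases j
    · change structI (transition p) _ = fderiv ℝ transition p (structI p u)
      rw [structI_apply, structI_apply, fderiv_transition_I_smul hp]
    · exact structJ_transition hp u
    · change hypercomplex 2 (transition p) _ = fderiv ℝ transition p (hypercomplex 2 p u)
      rw [hypercomplex_two_apply, hypercomplex_two_apply, fderiv_transition_I_smul hp,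
        structJ_transition hp]
  parallel p := by
    have hs (c : ℝ) (x : Coord) : c • x = (c : ℂ) • x := (Complex.coe_smul c x).symm
    refine ⟨LinearMap.mk₂ ℝ (christoffel p) (christoffel_add_left p)
      (fun c u v => by rw [hs, hs, christoffel_smul_left])
      (fun u v v' => by
        rw [christoffel_symm, christoffel_add_left, christoffel_symm p v, christoffel_symm p v'])
      (fun c u v => by rw [hs, hs, christoffel_smul_right]), ?_, ?_, ?_⟩
    · exact christoffel_symm p
    · intro u v w
      simp only [LinearMap.mk₂_apply]
      rw [fderiv_metric, fderiv_hermitian_eq_christoffel, Complex.add_re, metric_eq_re,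
        metric_eq_re]
    · intro j u v
      simp only [LinearMap.mk₂_apply]
      have hJ := fderiv_structJ_apply p u v
      fin_cases j
      · change fderiv ℝ structI p u v + christoffel p u (structI p v)
          - structI p (christoffel p u v) = 0
        rw [fderiv_structI, structI_apply, structI_apply, christoffel_smul_right]
        simp
      · change fderiv ℝ structJ p u v + christoffel p u (structJ p v)
          - structJ p (christoffel p u v) = 0
        rw [hJ]; abel
      · change fderiv ℝ (hypercomplex 2) p u v + christoffel p u (hypercomplex 2 p v)
          - hypercomplex 2 p (christoffel p u v) = 0
        rw [fderiv_hypercomplex_two, hypercomplex_two_apply, hypercomplex_two_apply,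
          christoffel_smul_right, hJ, smul_sub]
        abel

/-! ### The local coordinates `(ρ, φ, ψ, θ)` -/

/-- The first coordinate of the unit vector `z / |z|`. -/
def polarA (q : Fin 4 → ℝ) : ℂ :=
  (Real.cos (q 1) : ℂ) + Complex.I * (Real.sin (q 1) * Real.cos (q 2) : ℝ)

/-- The second coordinate of the unit vector `z / |z|`. -/
def polarB (q : Fin 4 → ℝ) : ℂ :=
  (Real.sin (q 1) * Real.sin (q 2) : ℝ) * Complex.exp (Complex.I * (q 3 : ℂ))

/-- The differential of `polarA`, in the direction `e`. -/
def polarDA (q e : Fin 4 → ℝ) : ℂ :=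
  (-(Real.sin (q 1) * e 1) : ℝ) + Complex.I *
    (Real.cos (q 1) * Real.cos (q 2) * e 1 - Real.sin (q 1) * Real.sin (q 2) * e 2 : ℝ)

/-- The differential of `polarB`, in the direction `e`. -/
def polarDB (q e : Fin 4 → ℝ) : ℂ :=
  ((Real.cos (q 1) * Real.sin (q 2) * e 1 + Real.sin (q 1) * Real.cos (q 2) * e 2 : ℝ)
    + Complex.I * (Real.sin (q 1) * Real.sin (q 2) * e 3 : ℝ))
      * Complex.exp (Complex.I * (q 3 : ℂ))

theorem polarMap_eq (q : Fin 4 → ℝ) :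
    polarMap q = (-polarA q / polarB q, (√((q 0) ^ 2 - 1) : ℂ) * polarB q ^ 2) := rfl

theorem polarB_ne_zero {q : Fin 4 → ℝ} (hq : q ∈ polarDomain) : polarB q ≠ 0 := by
  have h1 := (Real.sin_pos_of_mem_Ioo hq.2.1).ne'
  have h2 := (Real.sin_pos_of_mem_Ioo hq.2.2).ne'
  exact mul_ne_zero (Complex.ofReal_ne_zero.mpr (mul_ne_zero h1 h2)) (Complex.exp_ne_zero _)

theorem differentiableAt_polarMap {q : Fin 4 → ℝ} (hq : q ∈ polarDomain) :
    DifferentiableAt ℝ polarMap q := by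
  have h0 : (q 0) ^ 2 - 1 ≠ 0 := by nlinarith [hq.1]
  have hof {f : (Fin 4 → ℝ) → ℝ} (hf : DifferentiableAt ℝ f q) :
      DifferentiableAt ℝ (fun q => (f q : ℂ)) q :=
    Complex.ofRealCLM.differentiableAt.comp q hf
  have hA : DifferentiableAt ℝ polarA q :=
    (hof (by fun_prop)).add ((differentiableAt_const _).mul (hof (by fun_prop)))
  have hB : DifferentiableAt ℝ polarB q := by
    refine (hof (by fun_prop)).mul ?_
    exact (((differentiableAt_const _).mul (hof (by fun_prop)))).cexp
  refine DifferentiableAt.prodMk ?_ ?_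
  · simp only [div_eq_mul_inv]
    exact hA.neg.mul (hB.inv (polarB_ne_zero hq))
  · exact (hof (DifferentiableAt.sqrt (by fun_prop) h0)).mul (hB.pow 2)

theorem fderiv_polarMap {q : Fin 4 → ℝ} (hq : q ∈ polarDomain) (e : Fin 4 → ℝ) :
    fderiv ℝ polarMap q e =
      (-(polarDA q e * polarB q - polarA q * polarDB q e) / polarB q ^ 2,
        (q 0 * e 0 / √((q 0) ^ 2 - 1) : ℝ) * polarB q ^ 2
          + (√((q 0) ^ 2 - 1) : ℂ) * (2 * polarB q * polarDB q e)) := by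
  have h0 : (q 0) ^ 2 - 1 ≠ 0 := by nlinarith [hq.1]
  have hb := polarB_ne_zero hq
  -- differentiate along the line `t ↦ q + t e`
  have hl (i : Fin 4) : HasDerivAt (fun t : ℝ => q i + t * e i) (e i) 0 := by
    simpa using ((hasDerivAt_id (0 : ℝ)).mul_const (e i)).const_add (q i)
  have hA : HasDerivAt (fun t : ℝ => polarA (fun i => q i + t * e i)) (polarDA q e) 0 := by
    have := ((hl 1).cos.ofReal_comp).add
      (((hl 1).sin.mul (hl 2).cos).ofReal_comp.const_mul Complex.I)
    refine this.congr_deriv ?_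
    simp only [polarDA, zero_mul, add_zero]
    push_cast; ring
  have hB : HasDerivAt (fun t : ℝ => polarB (fun i => q i + t * e i)) (polarDB q e) 0 := by
    have := (((hl 1).sin.mul (hl 2).sin).ofReal_comp).mul
      (((hl 3).ofReal_comp.const_mul Complex.I).cexp)
    refine this.congr_deriv ?_
    simp only [polarDB, Pi.mul_apply, zero_mul, add_zero]
    push_cast; ring
  have hR : HasDerivAt (fun t : ℝ => ((√((q 0 + t * e 0) ^ 2 - 1) : ℝ) : ℂ))
      ((q 0 * e 0 / √((q 0) ^ 2 - 1) : ℝ) : ℂ) 0 := by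
    have := (((hl 0).pow 2).sub_const 1).sqrt (by simpa using h0)
    refine (this.ofReal_comp).congr_deriv ?_
    congr 1
    simp only [Pi.pow_apply, zero_mul, add_zero]
    rw [← mul_div_mul_left (q 0 * e 0) _ (two_ne_zero (α := ℝ))]
    congr 1
    norm_num; ring
  have e0 : (fun i => q i + (0 : ℝ) * e i) = q := by funext i; simp
  have h1 := (hA.neg.div hB (by rw [e0]; exact hb)).prodMk (hR.mul (hB.pow 2))
  have hline : HasDerivAt (fun t : ℝ => (fun i => q i + t * e i)) e 0 :=
    hasDerivAt_pi.mpr hl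
  have h2 := HasFDerivAt.comp_hasDerivAt_of_eq (x := (0 : ℝ))
    (differentiableAt_polarMap hq).hasFDerivAt hline e0.symm
  have h3 := h2.unique h1
  rw [h3]
  simp only [Pi.neg_apply, Pi.pow_apply, zero_mul, add_zero]
  ext
  · simp only; congr 1; ring
  · simp only; push_cast; ring

theorem polarA_mul_conj_add (q : Fin 4 → ℝ) :
    polarA q * conj (polarA q) + polarB q * conj (polarB q) = 1 := by
  have hE : Complex.exp (Complex.I * (q 3 : ℂ))
      * conj (Complex.exp (Complex.I * (q 3 : ℂ))) = 1 := by
    rw [← Complex.exp_conj, ← Complex.exp_add]; simp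
  have h1 : ((Real.sin (q 1)) : ℂ) ^ 2 + (Real.cos (q 1)) ^ 2 = 1 := by
    exact_mod_cast Real.sin_sq_add_cos_sq (q 1)
  have h2 : ((Real.sin (q 2)) : ℂ) ^ 2 + (Real.cos (q 2)) ^ 2 = 1 := by
    exact_mod_cast Real.sin_sq_add_cos_sq (q 2)
  simp only [polarA, polarB, map_add, map_mul, Complex.conj_ofReal, Complex.conj_I]
  push_cast [-Complex.ofReal_sin, -Complex.ofReal_cos]
  linear_combination (Real.sin (q 1) * Real.sin (q 2) : ℂ) ^ 2 * hE + h1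
    + (Real.sin (q 1) : ℂ) ^ 2 * h2
    - (Real.sin (q 1) * Real.cos (q 2) : ℂ) ^ 2 * Complex.I_mul_I

/-- The connection form `⟨dz, z⟩` of the Hopf fibration, for the unit vector `z = (a, b)`. -/
theorem polar_connection (q e : Fin 4 → ℝ) :
    conj (polarB q) * polarDB q e + conj (polarA q) * polarDA q e = Complex.I *
      (Real.cos (q 2) * e 1 - Real.cos (q 1) * Real.sin (q 1) * Real.sin (q 2) * e 2
        + Real.sin (q 1) ^ 2 * Real.sin (q 2) ^ 2 * e 3 : ℝ) := by
  have hE : Complex.exp (Complex.I * (q 3 : ℂ))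
      * conj (Complex.exp (Complex.I * (q 3 : ℂ))) = 1 := by
    rw [← Complex.exp_conj, ← Complex.exp_add]; simp
  have h1 : ((Real.sin (q 1)) : ℂ) ^ 2 + (Real.cos (q 1)) ^ 2 = 1 := by
    exact_mod_cast Real.sin_sq_add_cos_sq (q 1)
  have h2 : ((Real.sin (q 2)) : ℂ) ^ 2 + (Real.cos (q 2)) ^ 2 = 1 := by
    exact_mod_cast Real.sin_sq_add_cos_sq (q 2)
  simp only [polarA, polarB, polarDA, polarDB, map_add, map_mul, Complex.conj_ofReal,
    Complex.conj_I]
  push_cast [-Complex.ofReal_sin, -Complex.ofReal_cos]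
  generalize Complex.exp (Complex.I * (q 3 : ℂ)) = E at *
  generalize (Real.sin (q 1) : ℂ) = s1 at *
  generalize (Real.sin (q 2) : ℂ) = s2 at *
  generalize (Real.cos (q 1) : ℂ) = c1 at *
  generalize (Real.cos (q 2) : ℂ) = c2 at *
  have hI := Complex.I_sq
  generalize Complex.I = i at *
  generalize conj E = F at *
  grind

/-- The form `b da - a db`, which is `-b² dζ` in the chart `true`. -/
theorem polar_wronskian (q e : Fin 4 → ℝ) :
    polarDA q e * polarB q - polarA q * polarDB q e = Complex.exp (Complex.I * (q 3 : ℂ)) *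
      ((-(Real.sin (q 2) * e 1) - Real.cos (q 1) * Real.sin (q 1) * Real.cos (q 2) * e 2
        + Real.sin (q 1) ^ 2 * Real.sin (q 2) * Real.cos (q 2) * e 3 : ℝ)
      - Complex.I * (Real.sin (q 1) ^ 2 * e 2
        + Real.cos (q 1) * Real.sin (q 1) * Real.sin (q 2) * e 3 : ℝ)) := by
  have h1 : ((Real.sin (q 1)) : ℂ) ^ 2 + (Real.cos (q 1)) ^ 2 = 1 := by
    exact_mod_cast Real.sin_sq_add_cos_sq (q 1)
  have h2 : ((Real.sin (q 2)) : ℂ) ^ 2 + (Real.cos (q 2)) ^ 2 = 1 := by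
    exact_mod_cast Real.sin_sq_add_cos_sq (q 2)
  simp only [polarA, polarB, polarDA, polarDB]
  push_cast [-Complex.ofReal_sin, -Complex.ofReal_cos]
  generalize Complex.exp (Complex.I * (q 3 : ℂ)) = E at *
  generalize (Real.sin (q 1) : ℂ) = s1 at *
  generalize (Real.sin (q 2) : ℂ) = s2 at *
  generalize (Real.cos (q 1) : ℂ) = c1 at *
  generalize (Real.cos (q 2) : ℂ) = c2 at *
  have hI := Complex.I_sq
  generalize Complex.I = i at *
  grind

theorem width_polarMap {q : Fin 4 → ℝ} (hq : q ∈ polarDomain) :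
    (width (polarMap q) : ℂ) = 1 / (polarB q * conj (polarB q)) := by
  have hb := polarB_ne_zero hq
  have hb' : conj (polarB q) ≠ 0 := (map_ne_zero _).mpr hb
  rw [width_eq, polarMap_eq]
  simp only [map_div₀, map_neg]
  field_simp
  linear_combination polarA_mul_conj_add q

theorem radius_polarMap {q : Fin 4 → ℝ} (hq : q ∈ polarDomain) : radius (polarMap q) = q 0 := by
  have hb := polarB_ne_zero hq
  have hb' : conj (polarB q) ≠ 0 := (map_ne_zero _).mpr hb
  have h0 : 0 ≤ (q 0) ^ 2 - 1 := by nlinarith [hq.1]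
  have h1 : (radius (polarMap q) : ℂ) ^ 2 = ((q 0 : ℝ) : ℂ) ^ 2 := by
    have hs : ((√((q 0) ^ 2 - 1) : ℝ) : ℂ) ^ 2 = (q 0) ^ 2 - 1 := by
      rw [← Complex.ofReal_pow, Real.sq_sqrt h0]; push_cast; rfl
    rw [radius_sq_eq, width_polarMap hq, polarMap_eq]
    simp only [map_mul, map_pow, Complex.conj_ofReal]
    field_simp
    linear_combination hs
  have h2 : radius (polarMap q) ^ 2 = (q 0) ^ 2 := by exact_mod_cast h1
  exact (pow_left_inj₀ (radius_pos _).le (by linarith [hq.1]) two_ne_zero).mp h2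

theorem fibreForm_polarMap {q : Fin 4 → ℝ} (hq : q ∈ polarDomain) (e : Fin 4 → ℝ) :
    fibreForm (polarMap q) (fderiv ℝ polarMap q e) = polarB q / conj (polarB q) *
      ((q 0 * e 0 / √((q 0) ^ 2 - 1) : ℝ) + 2 * (√((q 0) ^ 2 - 1) : ℂ) *
        (conj (polarB q) * polarDB q e + conj (polarA q) * polarDA q e)) := by
  have hb := polarB_ne_zero hq
  have hb' : conj (polarB q) ≠ 0 := (map_ne_zero _).mpr hb
  rw [fibreForm_apply, width_polarMap hq, fderiv_polarMap hq, polarMap_eq]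
  simp only [map_div₀, map_neg]
  field_simp
  linear_combination (-2) * (√((q 0) ^ 2 - 1) : ℂ) * polarDB q e * polarA_mul_conj_add q

/-- The real part of the Hermitian form, written with the real components of the wronskian
(`x`, `y`) and of the fibre form (`m`, `l`). -/
theorem re_hermitian_aux {E : ℂ} (hE : E * conj E = 1) (r x y x' y' m m' k l l' : ℝ) :
    ((r : ℂ) * ((E * ((x : ℂ) - Complex.I * y)) * conj (E * ((x' : ℂ) - Complex.I * y')))
      + 1 / (4 * (r : ℂ)) * (((m : ℂ) + 2 * (k : ℂ) * (Complex.I * l))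
        * conj ((m' : ℂ) + 2 * (k : ℂ) * (Complex.I * l')))).re
      = r * (x * x' + y * y') + (m * m' + 4 * k ^ 2 * (l * l')) / (4 * r) := by
  have h1 : (r : ℂ) * ((E * ((x : ℂ) - Complex.I * y)) * conj (E * ((x' : ℂ) - Complex.I * y')))
      + 1 / (4 * (r : ℂ)) * (((m : ℂ) + 2 * (k : ℂ) * (Complex.I * l))
        * conj ((m' : ℂ) + 2 * (k : ℂ) * (Complex.I * l')))
      = ((r * (x * x' + y * y') + (m * m' + 4 * k ^ 2 * (l * l')) / (4 * r) : ℝ) : ℂ)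
        + Complex.I * ((r * (x * y' - y * x') + 2 * k * (l * m' - m * l') / (4 * r) : ℝ) : ℂ) := by
    simp only [map_mul, map_add, map_sub, Complex.conj_ofReal, Complex.conj_I, map_ofNat]
    push_cast
    linear_combination (r : ℂ) * (x - Complex.I * y) * (x' + Complex.I * y') * hE
      - ((r : ℂ) * y * y' + 4 * (k : ℂ) ^ 2 * l * l' / (4 * r)) * Complex.I_mul_I
  rw [h1, Complex.add_re, Complex.ofReal_re, Complex.I_mul_re, Complex.ofReal_im, neg_zero,
    add_zero]

theorem metric_polarMap {q : Fin 4 → ℝ} (hq : q ∈ polarDomain) (a b : Fin 4 → ℝ) :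
    metric (polarMap q) (fderiv ℝ polarMap q a) (fderiv ℝ polarMap q b) = polarMetric q a b := by
  have hb := polarB_ne_zero hq
  have hb' : conj (polarB q) ≠ 0 := (map_ne_zero _).mpr hb
  have h0 : 0 < (q 0) ^ 2 - 1 := by nlinarith [hq.1]
  have hq0 : q 0 ≠ 0 := by linarith [hq.1]
  have hE : Complex.exp (Complex.I * (q 3 : ℂ))
      * conj (Complex.exp (Complex.I * (q 3 : ℂ))) = 1 := by
    rw [← Complex.exp_conj, ← Complex.exp_add]; simp
  have hfst (e : Fin 4 → ℝ) : (fderiv ℝ polarMap q e).1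
      = -(polarDA q e * polarB q - polarA q * polarDB q e) / polarB q ^ 2 := by
    rw [fderiv_polarMap hq]
  have key : hermitian (polarMap q) (fderiv ℝ polarMap q a) (fderiv ℝ polarMap q b)
      = q 0 * ((polarDA q a * polarB q - polarA q * polarDB q a)
          * conj (polarDA q b * polarB q - polarA q * polarDB q b))
        + 1 / (4 * q 0) * (((q 0 * a 0 / √((q 0) ^ 2 - 1) : ℝ) + 2 * (√((q 0) ^ 2 - 1) : ℂ) *
            (conj (polarB q) * polarDB q a + conj (polarA q) * polarDA q a))
          * conj ((q 0 * b 0 / √((q 0) ^ 2 - 1) : ℝ) + 2 * (√((q 0) ^ 2 - 1) : ℂ) *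
            (conj (polarB q) * polarDB q b + conj (polarA q) * polarDA q b))) := by
    rw [hermitian, fibreForm_polarMap hq, fibreForm_polarMap hq, hfst, hfst, width_polarMap hq,
      radius_polarMap hq]
    simp only [map_mul, map_div₀, map_neg, map_pow, Complex.conj_conj]
    field_simp
  rw [metric_eq_re, key, polar_connection, polar_connection, polar_wronskian, polar_wronskian]
  have hs : √((q 0) ^ 2 - 1) ^ 2 = (q 0) ^ 2 - 1 := Real.sq_sqrt h0.le
  have hs0 : √((q 0) ^ 2 - 1) ≠ 0 := (Real.sqrt_pos.mpr h0).ne'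
  rw [re_hermitian_aux hE]
  have hm : q 0 * a 0 / √((q 0) ^ 2 - 1) * (q 0 * b 0 / √((q 0) ^ 2 - 1))
      = (q 0) ^ 2 * (a 0 * b 0) / ((q 0) ^ 2 - 1) := by
    rw [div_mul_div_comm, ← sq, hs]; ring
  rw [hm, hs]
  have h1 := Real.sin_sq_add_cos_sq (q 1)
  have h2 := Real.sin_sq_add_cos_sq (q 2)
  simp only [polarMetric]
  generalize Real.sin (q 1) = s1 at *
  generalize Real.sin (q 2) = s2 at *
  generalize Real.cos (q 1) = c1 at *
  generalize Real.cos (q 2) = c2 at *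
  have h0' := h0.ne'
  field_simp
  clear key hfst hE hb hb' hq hm hs hs0
  grind

/-- The field `polarField k` induces the velocity of the action of `polarMatrix k` on `(z₁, z₂)`. -/
theorem polarField_eq {q : Fin 4 → ℝ} (hq : q ∈ polarDomain) (k : Fin 4) :
    polarDA q (polarField k q) = polarMatrix k 0 0 * polarA q + polarMatrix k 0 1 * polarB q ∧
    polarDB q (polarField k q) = polarMatrix k 1 0 * polarA q + polarMatrix k 1 1 * polarB q ∧
    polarField k q 0 = 0 := by
  have hs1 := (Real.sin_pos_of_mem_Ioo hq.2.1).ne'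
  have hs2 := (Real.sin_pos_of_mem_Ioo hq.2.2).ne'
  have h1 := Real.sin_sq_add_cos_sq (q 1)
  have h2 := Real.sin_sq_add_cos_sq (q 2)
  have h3 := Real.sin_sq_add_cos_sq (q 3)
  have hE : Complex.exp (Complex.I * (q 3 : ℂ))
      = (Real.cos (q 3) : ℂ) + (Real.sin (q 3) : ℂ) * Complex.I := by
    rw [mul_comm, Complex.exp_mul_I]; push_cast; rfl
  have hd : Real.cos (q 2) ^ 2 * Real.cos (q 1) ^ 2 - Real.cos (q 2) ^ 2 - Real.cos (q 1) ^ 2 + 1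
      = Real.sin (q 1) ^ 2 * Real.sin (q 2) ^ 2 := by
    rw [Real.sin_sq, Real.sin_sq]; ring
  have hc : Real.cos (q 1) ^ 2 - 1 = -Real.sin (q 1) ^ 2 := by rw [Real.sin_sq]; ring
  simp only [polarDA, polarDB, polarA, polarB, hE, polarField, hd, hc]
  clear hE hd hc hq
  generalize Real.sin (q 1) = s1 at *
  generalize Real.sin (q 2) = s2 at *
  generalize Real.cos (q 1) = c1 at *
  generalize Real.cos (q 2) = c2 at *
  generalize Real.sin (q 3) = s3 at *
  generalize Real.cos (q 3) = c3 at *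
  -- in each case the components of the field become variables that satisfy relations without
  -- denominators
  fin_cases k
  · obtain ⟨x, hx⟩ : ∃ x, x = -(s2 * c1 / s1) := ⟨_, rfl⟩
    have hx' : s1 * x = -(s2 * c1) := by rw [hx]; field_simp
    simp only [Fin.zero_eta, Fin.isValue, Matrix.cons_val, ← hx]
    clear hx
    refine ⟨Complex.ext ?_ ?_, Complex.ext ?_ ?_, trivial⟩ <;> simp [polarMatrix] <;> grind
  · obtain ⟨x, hx⟩ : ∃ x, x = s1 * s2 ^ 2 * (c3 * c2 * c1 + s1 * s3) / (s1 ^ 2 * s2 ^ 2) :=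
      ⟨_, rfl⟩
    obtain ⟨y, hy⟩ : ∃ y, y = (s1 * c3 * c2 - s3 * c1) / (s1 * s2) := ⟨_, rfl⟩
    have hx' : s1 * x = c3 * c2 * c1 + s1 * s3 := by rw [hx]; field_simp
    have hy' : s1 * s2 * y = s1 * c3 * c2 - s3 * c1 := by rw [hy]; field_simp
    simp only [Fin.mk_one, Fin.isValue, Matrix.cons_val, ← hx, ← hy]
    clear hx hy
    refine ⟨Complex.ext ?_ ?_, Complex.ext ?_ ?_, trivial⟩ <;> simp [polarMatrix] <;> grind
  · obtain ⟨x, hx⟩ : ∃ x, x = -(s1 * s2 ^ 2 * (s1 * c3 - s3 * c1 * c2) / (s1 ^ 2 * s2 ^ 2)) :=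
      ⟨_, rfl⟩
    obtain ⟨y, hy⟩ : ∃ y, y = (s1 * s3 * c2 + c3 * c1) / (s1 * s2) := ⟨_, rfl⟩
    have hx' : s1 * x = -(s1 * c3 - s3 * c1 * c2) := by rw [hx]; field_simp
    have hy' : s1 * s2 * y = s1 * s3 * c2 + c3 * c1 := by rw [hy]; field_simp
    simp only [Fin.reduceFinMk, Fin.isValue, Matrix.cons_val, ← hx, ← hy]
    clear hx hy
    refine ⟨Complex.ext ?_ ?_, Complex.ext ?_ ?_, trivial⟩ <;> simp [polarMatrix] <;> grind
  · obtain ⟨x, hx⟩ : ∃ x, x = s2 * s1 * c1 / -s1 ^ 2 := ⟨_, rfl⟩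
    have hx' : s1 * x = -(s2 * c1) := by rw [hx]; field_simp
    have hy' : s1 ^ 2 * s2 ^ 2 / (s1 ^ 2 * s2 ^ 2) = 1 := by field_simp
    simp only [Fin.reduceFinMk, Fin.isValue, Matrix.cons_val, ← hx, hy']
    clear hx hy'
    refine ⟨Complex.ext ?_ ?_, Complex.ext ?_ ?_, trivial⟩ <;> simp [polarMatrix] <;> grind

theorem fderiv_polarMap_polarField (k : Fin 4) {q : Fin 4 → ℝ} (hq : q ∈ polarDomain) :
    fderiv ℝ polarMap q (polarField k q) = velocity true (polarMatrix k) (polarMap q) := by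
  have hb := polarB_ne_zero hq
  obtain ⟨h1, h2, h3⟩ := polarField_eq hq k
  rw [fderiv_polarMap hq, h1, h2, h3, polarMap_eq]
  simp only [velocity, mul_zero, zero_div, Complex.ofReal_zero, zero_mul, zero_add]
  ext
  · simp only []; field_simp; ring
  · simp only []; field_simp; ring

theorem polarMatrix_mem_u2 (k : Fin 4) : polarMatrix k ∈ u2 := by
  change (polarMatrix k).conjTranspose = -polarMatrix k
  fin_cases k <;> ext i j <;> fin_cases i <;> fin_cases j <;>
    simp [polarMatrix, Matrix.conjTranspose_apply]

theorem linearIndependent_polarMatrix : LinearIndependent ℝ polarMatrix := by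
  rw [Fintype.linearIndependent_iff]
  intro g hg
  have h00 := congrArg Complex.im (congrFun (congrFun hg 0) 0)
  have h11 := congrArg Complex.im (congrFun (congrFun hg 1) 1)
  have h10 := congrFun (congrFun hg 1) 0
  have h10r := congrArg Complex.re h10
  have h10i := congrArg Complex.im h10
  simp [Fin.sum_univ_four, polarMatrix] at h00 h11 h10r h10i
  intro i
  fin_cases i <;> simp <;> linarith

/-! ### Infinitesimal conformal symmetries -/

/-- The complex-linear part `∂X` of the derivative of a vector field. -/
def del (X : Coord → Coord) (p u : Coord) : Coord :=
  (dz (fun q => (X q).1) p * u.1 + dw (fun q => (X q).1) p * u.2,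
    dz (fun q => (X q).2) p * u.1 + dw (fun q => (X q).2) p * u.2)

/-- The complex-antilinear part `∂̄X` of the derivative of a vector field. -/
def delBar (X : Coord → Coord) (p u : Coord) : Coord :=
  (dzb (fun q => (X q).1) p * conj u.1 + dwb (fun q => (X q).1) p * conj u.2,
    dzb (fun q => (X q).2) p * conj u.1 + dwb (fun q => (X q).2) p * conj u.2)

theorem fderiv_eq_del_add_delBar {X : Coord → Coord} {p : Coord} (hX : DifferentiableAt ℝ X p)
    (u : Coord) : fderiv ℝ X p u = del X p u + delBar X p u := by
  rw [HasWirtinger.fderiv_prod_apply (hasWirtinger_of_differentiableAt hX.fst)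
    (hasWirtinger_of_differentiableAt hX.snd)]
  ext <;> simp only [del, delBar, Prod.fst_add, Prod.snd_add] <;> ring

theorem del_smul (X : Coord → Coord) (p u : Coord) (c : ℂ) :
    del X p (c • u) = c • del X p u := by
  ext <;> simp only [del, Prod.smul_fst, Prod.smul_snd, smul_eq_mul] <;> ring

theorem delBar_smul (X : Coord → Coord) (p u : Coord) (c : ℂ) :
    delBar X p (c • u) = conj c • delBar X p u := by
  ext <;> simp only [delBar, Prod.smul_fst, Prod.smul_snd, smul_eq_mul, map_mul] <;> ring

theorem delBar_add (X : Coord → Coord) (p u v : Coord) :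
    delBar X p (u + v) = delBar X p u + delBar X p v := by
  ext <;> simp only [delBar, Prod.fst_add, Prod.snd_add, map_add] <;> ring

/-- The part of type `(1,1)` of the Lie derivative `L_X g`, as a Hermitian form. -/
def lieHermitian (X : Coord → Coord) (p u v : Coord) : ℂ :=
  fderiv ℝ (fun q => hermitian q u v) p (X p) + hermitian p (del X p u) v
    + hermitian p u (del X p v)

/-- `X` is an infinitesimal conformal symmetry at `p`: the part of type `(2,0)` of `L_X g` vanishes,
which means that `∂̄X` is a multiple of `J`, and the part of type `(1,1)` is a multiple of `g`. -/
def IsConformalAt (X : Coord → Coord) (p : Coord) : Prop :=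
  ∃ c σ : ℂ, (∀ u, delBar X p u = c • structJ p u) ∧
    ∀ u v, lieHermitian X p u v = σ * hermitian p u v

/-- The relation `h(u, v) = ω(u, J v)`, differentiated along `X`: the `(1,1)`-part of `L_X g` is
governed by the antilinear part of `L_X J` and by the divergence `tr ∂X`, through which `X` acts on
`ω`. -/
theorem lieHermitian_eq_symplectic (X : Coord → Coord) (p u v : Coord) :
    lieHermitian X p u v = symplectic u
        (fderiv ℝ structJ p (X p) v - del X p (structJ p v) + structJ p (del X p v))
      + (dz (fun q => (X q).1) p + dw (fun q => (X q).2) p) * symplectic u (structJ p v) := by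
  rw [lieHermitian, fderiv_hermitian_eq_symplectic, hermitian_eq_symplectic,
    hermitian_eq_symplectic]
  simp only [symplectic, del, Prod.fst_add, Prod.snd_add, Prod.fst_sub, Prod.snd_sub]
  ring

theorem fderiv_structJ_smul (p x v : Coord) (c : ℂ) :
    fderiv ℝ structJ p x (c • v) = conj c • fderiv ℝ structJ p x v := by
  rw [fderiv_structJ_apply, fderiv_structJ_apply, structJ_smul, christoffel_smul_right,
    christoffel_smul_right, structJ_smul, smul_sub]

/-- The endomorphisms `a I + e₁ J + e₂ K`, with `e = e₁ + i e₂`. -/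
theorem mem_quaternionicStructure_iff {p : Coord} {B : Coord →L[ℝ] Coord} :
    B ∈ quaternionicStructure p ↔ ∃ (a : ℝ) (e : ℂ), ∀ u,
      B u = ((a : ℂ) * Complex.I) • u + e • structJ p u := by
  rw [quaternionicStructure, Submodule.mem_span_range_iff_exists_fun]
  constructor
  · rintro ⟨c, rfl⟩
    refine ⟨c 0, c 1 + c 2 * Complex.I, fun u => ?_⟩
    simp only [Fin.sum_univ_three, add_apply, smul_apply, hypercomplex_two_apply,
      hypercomplex_zero, hypercomplex_one, structI_apply, add_smul, mul_smul, Complex.coe_smul]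
    abel
  · rintro ⟨a, e, h⟩
    refine ⟨![a, e.re, e.im], ContinuousLinearMap.ext fun u => ?_⟩
    rw [h]
    simp only [Fin.sum_univ_three, add_apply, smul_apply, hypercomplex_two_apply,
      hypercomplex_zero, hypercomplex_one, structI_apply, Matrix.cons_val]
    conv_rhs => rw [← Complex.re_add_im e]
    simp only [add_smul, mul_smul, Complex.coe_smul]
    abel

theorem lieDerivEnd_apply (X : Coord → Coord) (A : Coord → Coord →L[ℝ] Coord) (p u : Coord) :
    lieDerivEnd X A p u
      = fderiv ℝ A p (X p) u - fderiv ℝ X p (A p u) + A p (fderiv ℝ X p u) := by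
  simp [lieDerivEnd]

/-- A map that anticommutes with `i` and is a multiple of the identity vanishes. -/
theorem eq_zero_of_antilinear_add_smul {T : Coord → Coord} {b : ℂ}
    (hT : ∀ u, T (Complex.I • u) = -(Complex.I • T u)) (h : ∀ u, T u + b • u = 0) (u : Coord) :
    T u = 0 := by
  have h1 := h u
  have h2 := h (Complex.I • u)
  rw [hT] at h2
  have hI := Complex.I_mul_I
  ext
  · have k1 := congrArg Prod.fst h1
    have k2 := congrArg Prod.fst h2
    simp only [Prod.fst_add, Prod.fst_neg, Prod.smul_fst, smul_eq_mul, Prod.fst_zero] at k1 k2 ⊢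
    linear_combination (1 / 2) * k1 + (Complex.I / 2) * k2
      - (b * u.1 - (T u).1) / 2 * hI
  · have k1 := congrArg Prod.snd h1
    have k2 := congrArg Prod.snd h2
    simp only [Prod.snd_add, Prod.snd_neg, Prod.smul_snd, smul_eq_mul, Prod.snd_zero] at k1 k2 ⊢
    linear_combination (1 / 2) * k1 + (Complex.I / 2) * k2
      - (b * u.2 - (T u).2) / 2 * hI

/-- If `L_X I` and `L_X J` are sections of the quaternionic structure, then `X` is conformal. -/
theorem isConformalAt_of_lieDerivEnd_mem {X : Coord → Coord} {p : Coord}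
    (hX : DifferentiableAt ℝ X p) (hI : lieDerivEnd X structI p ∈ quaternionicStructure p)
    (hJ : lieDerivEnd X structJ p ∈ quaternionicStructure p) : IsConformalAt X p := by
  obtain ⟨a, e, hI⟩ := mem_quaternionicStructure_iff.mp hI
  obtain ⟨a', e', hJ⟩ := mem_quaternionicStructure_iff.mp hJ
  have h1 (u : Coord) : (2 * Complex.I) • delBar X p u
      = ((a : ℂ) * Complex.I) • u + e • structJ p u := by
    rw [← hI u, lieDerivEnd_apply, fderiv_structI, structI_apply, structI_apply,
      fderiv_eq_del_add_delBar hX, fderiv_eq_del_add_delBar hX, del_smul, delBar_smul,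
      Complex.conj_I]
    simp only [zero_apply, zero_sub]
    module
  -- `L_X I = 2i ∂̄X` is antilinear, so that it has no component along `I`
  have h2 (u : Coord) : delBar X p u = (e / (2 * Complex.I)) • structJ p u := by
    have h3 := eq_zero_of_antilinear_add_smul
      (T := fun u => (2 * Complex.I) • delBar X p u - e • structJ p u) (b := -(a * Complex.I))
      (fun u => by
        simp only [delBar_smul, structJ_smul, Complex.conj_I]
        module)
      (fun u => by simp only [h1 u]; module) u
    rw [div_eq_inv_mul, mul_smul, ← sub_eq_zero.mp h3, smul_smul,
      inv_mul_cancel₀ (by simp), one_smul]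
  set c : ℂ := e / (2 * Complex.I) with hc
  -- the antilinear part of `L_X J` is a multiple of `J`; the contribution of `∂̄X = c J` is linear
  let A : Coord → Coord := fun v =>
    fderiv ℝ structJ p (X p) v - del X p (structJ p v) + structJ p (del X p v)
  have hA (v : Coord) : A v + (c - conj c - a' * Complex.I) • v = e' • structJ p v := by
    have h3 := hJ v
    rw [lieDerivEnd_apply, fderiv_eq_del_add_delBar hX, fderiv_eq_del_add_delBar hX, h2, h2,
      structJ_structJ, map_add, structJ_smul, structJ_structJ] at h3
    have h4 : e' • structJ p v = (fderiv ℝ structJ p (X p) v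
      - (del X p (structJ p v) + c • -v) + (structJ p (del X p v) + conj c • -v))
      - ((a' : ℂ) * Complex.I) • v := by
      rw [h3]; abel
    rw [h4]
    simp only [A]
    module
  have hAI (v : Coord) : A (Complex.I • v) = -(Complex.I • A v) := by
    simp only [A, fderiv_structJ_smul, structJ_smul, del_smul, Complex.conj_I]
    module
  have hA2 (v : Coord) : A v = e' • structJ p v := by
    have h3 := eq_zero_of_antilinear_add_smul (T := fun v => A v - e' • structJ p v)
      (b := c - conj c - a' * Complex.I)
      (fun v => by
        simp only [hAI, structJ_smul, Complex.conj_I]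
        module)
      (fun v => by rw [← hA v]; module) v
    exact sub_eq_zero.mp h3
  refine ⟨c, e' + (dz (fun q => (X q).1) p + dw (fun q => (X q).2) p), h2, fun u v => ?_⟩
  rw [lieHermitian_eq_symplectic, hermitian_eq_symplectic]
  change symplectic u (A v) + _ = _
  rw [hA2]
  simp only [symplectic, Prod.smul_fst, Prod.smul_snd, smul_eq_mul]
  ring

theorem lieDerivMetric_eq_re {X : Coord → Coord} {p : Coord} (hX : DifferentiableAt ℝ X p)
    (u v : Coord) : lieDerivMetric X p u v = (lieHermitian X p u v
      + (hermitian p (delBar X p u) v + hermitian p (delBar X p v) u)).re := by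
  rw [lieDerivMetric, fderiv_metric, metric_eq_re, metric_eq_re, fderiv_eq_del_add_delBar hX,
    fderiv_eq_del_add_delBar hX, hermitian_add_left, hermitian_add_right, lieHermitian]
  have h : (hermitian p (delBar X p v) u).re = (hermitian p u (delBar X p v)).re := by
    rw [← hermitian_conj, Complex.conj_re]
  simp only [Complex.add_re, h]
  ring

theorem fderiv_hermitian_smul (p x u v : Coord) (c d : ℂ) :
    fderiv ℝ (fun q => hermitian q (c • u) (d • v)) p x
      = c * conj d * fderiv ℝ (fun q => hermitian q u v) p x := by
  have e : (fun q => hermitian q (c • u) (d • v)) = fun q => (c * conj d) * hermitian q u v := by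
    funext q; rw [hermitian_smul_left, hermitian_smul_right]; ring
  rw [e, fderiv_const_mul ((contDiff_hermitian u v).differentiable (by simp) p)]
  simp

theorem lieHermitian_smul (X : Coord → Coord) (p u v : Coord) (c d : ℂ) :
    lieHermitian X p (c • u) (d • v) = c * conj d * lieHermitian X p u v := by
  rw [lieHermitian, fderiv_hermitian_smul, del_smul, del_smul]
  simp only [lieHermitian, hermitian_smul_left, hermitian_smul_right]
  ring

/-- Killing fields are conformal. -/
theorem isConformalAt_of_lieDerivMetric_eq_zero {X : Coord → Coord} {p : Coord}
    (hX : DifferentiableAt ℝ X p) (h : ∀ u v, lieDerivMetric X p u v = 0) :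
    IsConformalAt X p := by
  let S : Coord → Coord → ℂ := fun u v =>
    hermitian p (delBar X p u) v + hermitian p (delBar X p v) u
  have h0 (u v : Coord) : (lieHermitian X p u v).re + (S u v).re = 0 := by
    rw [← Complex.add_re, ← lieDerivMetric_eq_re hX, h]
  have hS (u v : Coord) (c : ℂ) : S u (c • v) = conj c * S u v := by
    simp only [S, delBar_smul, hermitian_smul_left, hermitian_smul_right]; ring
  have hS' (u v : Coord) : S u v = S v u := add_comm _ _
  have hH (u v : Coord) (c : ℂ) : lieHermitian X p u (c • v) = conj c * lieHermitian X p u v := by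
    have := lieHermitian_smul X p u v 1 c
    rwa [one_smul, one_mul] at this
  have h1 (u v : Coord) : (lieHermitian X p u v).re = 0 ∧ (S u v).re = 0 := by
    -- the parts of type `(1,1)` and `(2,0)` are separated by the substitution `(iu, iv)`
    have h2 := h0 (Complex.I • u) (Complex.I • v)
    rw [lieHermitian_smul, hS, hS', hS, hS' v u, ← mul_assoc, Complex.conj_I,
      show -Complex.I * -Complex.I = -1 by simp, show Complex.I * -Complex.I = 1 by simp] at h2
    have h3 := h0 u v
    simp only [one_mul, neg_one_mul, Complex.neg_re] at h2
    constructor <;> linarith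
  have h2 (u v : Coord) : lieHermitian X p u v = 0 ∧ S u v = 0 := by
    have h3 := h1 u (Complex.I • v)
    rw [hH, hS, Complex.conj_I] at h3
    simp only [neg_mul, Complex.neg_re, Complex.I_mul_re, neg_neg] at h3
    exact ⟨Complex.ext (h1 u v).1 h3.1, Complex.ext (h1 u v).2 h3.2⟩
  -- `S = 0` says that `h(∂̄X ·, ·)` is skew, hence a multiple of `conj ω = h(J ·, ·)`
  set e₁ : Coord := (1, 0)
  set e₂ : Coord := (0, 1)
  have he (u : Coord) : u = u.1 • e₁ + u.2 • e₂ := by ext <;> simp [e₁, e₂]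
  set c : ℂ := 2 * hermitian p (delBar X p e₁) e₂ with hc
  have h11 : hermitian p (delBar X p e₁) e₁ = 0 := by
    have := (h2 e₁ e₁).2
    simp only [S] at this
    linear_combination this / 2
  have h22 : hermitian p (delBar X p e₂) e₂ = 0 := by
    have := (h2 e₂ e₂).2
    simp only [S] at this
    linear_combination this / 2
  have h12 : hermitian p (delBar X p e₁) e₂ + hermitian p (delBar X p e₂) e₁ = 0 := (h2 e₁ e₂).2
  have key (e : Coord) (k1 : hermitian p (delBar X p e) e₁ = c * conj (symplectic e e₁))
      (k2 : hermitian p (delBar X p e) e₂ = c * conj (symplectic e e₂)) :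
      delBar X p e = c • structJ p e := by
    rw [← sub_eq_zero]
    refine eq_zero_of_hermitian_self (p := p) ?_
    set x := delBar X p e - c • structJ p e with hx
    have k3 (v : Coord) : hermitian p x v
        = hermitian p (delBar X p e) v - c * conj (symplectic e v) := by
      rw [← hermitian_structJ_left p, hx, sub_eq_add_neg, hermitian_add_left, ← neg_smul,
        hermitian_smul_left]
      ring
    rw [he x, hermitian_add_right, hermitian_smul_right, hermitian_smul_right, ← he x, k3, k3,
      k1, k2]
    ring
  refine ⟨c, 0, fun u => ?_, fun u v => by rw [(h2 u v).1, zero_mul]⟩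
  have k1 : delBar X p e₁ = c • structJ p e₁ := by
    refine key e₁ ?_ ?_
    · rw [h11]; simp [symplectic, e₁]
    · have : symplectic e₁ e₂ = 2⁻¹ := by simp [symplectic, e₁, e₂]
      rw [this, hc, map_inv₀, map_ofNat]; ring
  have k2 : delBar X p e₂ = c • structJ p e₂ := by
    refine key e₂ ?_ ?_
    · have : symplectic e₂ e₁ = -2⁻¹ := by simp [symplectic, e₁, e₂]; norm_num
      rw [this, hc, map_neg, map_inv₀, map_ofNat]; linear_combination h12
    · rw [h22]; simp [symplectic, e₂]
  rw [he u, delBar_add, delBar_smul, delBar_smul, k1, k2, map_add, structJ_smul, structJ_smul]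
  module

/-! ### The fields induced by matrices -/

theorem del_eq_of_hasWirtinger {X : Coord → Coord} {p : Coord} {a b c d a' b' c' d' : ℂ}
    (h1 : HasWirtinger (fun q => (X q).1) a b c d p)
    (h2 : HasWirtinger (fun q => (X q).2) a' b' c' d' p) (u : Coord) :
    del X p u = (a * u.1 + c * u.2, a' * u.1 + c' * u.2) := by
  rw [del, h1.dz_eq, h1.dw_eq, h2.dz_eq, h2.dw_eq]

theorem hasWirtinger_velocity_fst (A : Matrix (Fin 2) (Fin 2) ℂ) (p : Coord) :
    HasWirtinger (fun q => (velocity false A q).1) (A 1 1 - A 0 0 - 2 * A 0 1 * p.1) 0 0 0 p := by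
  simp only [velocity, sq]
  refine (((HasWirtinger.const (A 1 0) p).add ((HasWirtinger.fst p).const_mul (A 1 1 - A 0 0))).sub
    (((HasWirtinger.fst p).mul (HasWirtinger.fst p)).const_mul (A 0 1))).congr_values
      ?_ ?_ ?_ ?_ <;> ring

theorem hasWirtinger_velocity_snd (A : Matrix (Fin 2) (Fin 2) ℂ) (p : Coord) :
    HasWirtinger (fun q => (velocity false A q).2) (2 * p.2 * A 0 1) 0
      (2 * (A 0 0 + A 0 1 * p.1)) 0 p := by
  simp only [velocity]
  refine (((HasWirtinger.snd p).const_mul 2).mul ((HasWirtinger.const (A 0 0) p).add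
    ((HasWirtinger.fst p).const_mul (A 0 1)))).congr_values ?_ ?_ ?_ ?_ <;> ring

theorem del_velocity (A : Matrix (Fin 2) (Fin 2) ℂ) (p u : Coord) :
    del (velocity false A) p u = ((A 1 1 - A 0 0 - 2 * A 0 1 * p.1) * u.1,
      2 * p.2 * A 0 1 * u.1 + 2 * (A 0 0 + A 0 1 * p.1) * u.2) := by
  rw [del_eq_of_hasWirtinger (hasWirtinger_velocity_fst A p) (hasWirtinger_velocity_snd A p)]
  simp

theorem delBar_velocity (A : Matrix (Fin 2) (Fin 2) ℂ) (p u : Coord) :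
    delBar (velocity false A) p u = 0 := by
  rw [delBar, (hasWirtinger_velocity_fst A p).dzb_eq, (hasWirtinger_velocity_fst A p).dwb_eq,
    (hasWirtinger_velocity_snd A p).dzb_eq, (hasWirtinger_velocity_snd A p).dwb_eq]
  simp

theorem conj_entry_of_mem_u2 {A : Matrix (Fin 2) (Fin 2) ℂ} (hA : A ∈ u2) (i j : Fin 2) :
    conj (A i j) = -A j i := by
  have h : A.conjTranspose = -A := hA
  have := congrFun (congrFun h j) i
  simpa [Matrix.conjTranspose_apply] using this

/-- The `𝔲(2)`-fields preserve the Hermitian form. -/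
theorem lieHermitian_velocity {A : Matrix (Fin 2) (Fin 2) ℂ} (hA : A ∈ u2) (p u v : Coord) :
    lieHermitian (velocity false A) p u v = 0 := by
  have hr := radius_ne_zero p
  have hw := width_ne_zero p
  have hW := width_eq p
  rw [lieHermitian, (hasWirtinger_hermitian p u v).fderiv_apply, del_velocity, del_velocity]
  simp only [hermitian, fibreForm_apply, velocity, map_add, map_sub, map_mul, map_pow, map_ofNat,
    Complex.conj_ofReal, Complex.conj_conj, conj_entry_of_mem_u2 hA]
  generalize A 0 0 = a at *
  generalize A 1 0 = b at *
  generalize A 0 1 = c at *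
  generalize A 1 1 = d at *
  field_simp
  rw [hW]
  ring

/-! ### Conformal fields away from the zero section -/

/-- A vector field `Ψ` on `w ≠ 0` with `∂̄Ψ = J`. -/
def potential (p : Coord) : Coord :=
  (-(radius p / p.2), 2 * conj p.1 * radius p / width p)

theorem hasWirtinger_potential_fst {p : Coord} (hp : p.2 ≠ 0) :
    HasWirtinger (fun q => (potential q).1) (-(conj p.2 * width p * conj p.1 / radius p))
      (-(conj p.2 * width p * p.1 / radius p))
      (-(conj p.2 * width p ^ 2 / (2 * radius p * p.2)) + radius p / p.2 ^ 2)
      (-(width p ^ 2 / (2 * radius p))) p := by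
  have hr := radius_ne_zero p
  refine ((hasWirtinger_radius p).div (HasWirtinger.snd p) hp).neg.congr_values ?_ ?_ ?_ ?_ <;>
  · field_simp
    try ring

theorem hasWirtinger_potential_snd (p : Coord) :
    HasWirtinger (fun q => (potential q).2)
      (2 * conj p.1 * (p.2 * conj p.2 * conj p.1 / radius p - radius p * conj p.1 / width p ^ 2))
      (2 * radius p / width p
        + 2 * conj p.1 * (p.2 * conj p.2 * p.1 / radius p - radius p * p.1 / width p ^ 2))
      (conj p.1 * conj p.2 * width p / radius p) (conj p.1 * p.2 * width p / radius p) p := by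
  have hr := radius_ne_zero p
  have hw := width_ne_zero p
  refine ((((HasWirtinger.fst p).conj.const_mul 2).mul (hasWirtinger_radius p)).div
    (hasWirtinger_width p) hw).congr_values ?_ ?_ ?_ ?_ <;>
  · simp only [map_one, map_zero]
    field_simp
    try ring

theorem delBar_potential {p : Coord} (hp : p.2 ≠ 0) (u : Coord) :
    delBar potential p u = structJ p u := by
  have hr := radius_ne_zero p
  have hw := width_ne_zero p
  have hW := width_eq p
  rw [delBar, (hasWirtinger_potential_fst hp).dzb_eq, (hasWirtinger_potential_fst hp).dwb_eq,
    (hasWirtinger_potential_snd p).dzb_eq, (hasWirtinger_potential_snd p).dwb_eq, structJ_apply,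
    fibreForm_apply]
  simp only [map_add, map_mul, map_ofNat, Complex.conj_ofReal, Complex.conj_conj]
  ext
  · simp only []; field_simp; ring
  · simp only []; field_simp; rw [hW]; ring

/-- `J` has determinant one, so that `J (1, 0)` and `J (0, 1)` are independent. -/
theorem symplectic_structJ_basis (p : Coord) :
    (structJ p (1, 0)).1 * (structJ p (0, 1)).2 - (structJ p (1, 0)).2 * (structJ p (0, 1)).1
      = 1 := by
  have h1 : symplectic (structJ p (1, 0)) (structJ p (0, 1)) = 1 / 2 := by
    have h2 : symplectic (1, 0) (0, 1) = 2⁻¹ := by simp [symplectic]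
    rw [← hermitian_eq_symplectic, hermitian_structJ_left, h2, map_inv₀, map_ofNat, one_div]
  simp only [symplectic] at h1
  linear_combination 2 * h1

theorem contDiffOn_potential {V : Set Coord} (h0 : ∀ p ∈ V, p.2 ≠ 0) :
    ContDiffOn ℝ ∞ (fun q => (potential q).1) V ∧ ContDiffOn ℝ ∞ (fun q => (potential q).2) V := by
  refine ⟨?_, ?_⟩
  · simp only [potential, div_eq_mul_inv]
    exact (contDiff_radius.contDiffOn.mul (contDiff_snd.contDiffOn.inv h0)).neg
  · exact (ContDiff.div_of_ne_zero ((contDiff_const.mul contDiff_conj_fst).mul contDiff_radius)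
      contDiff_width width_ne_zero).contDiffOn

theorem dzb_dwb_comm {f : Coord → ℂ} {V : Set Coord} (hV : IsOpen V) (hf : ContDiffOn ℝ ∞ f V)
    {p : Coord} (hp : p ∈ V) : dzb (dwb f) p = dwb (dzb f) p :=
  wirtinger_comm ((hf.contDiffAt (hV.mem_nhds hp)).of_le (by norm_cast)) _ _ _ _

theorem wirtinger_eq_of_eq_mul {f g c : Coord → ℂ} {V : Set Coord} (hV : IsOpen V)
    (h : ∀ p ∈ V, f p = c p * g p) {p : Coord} (hp : p ∈ V) (hc : DifferentiableAt ℝ c p)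
    (hg : DifferentiableAt ℝ g p) (v : Coord) (s : ℂ) :
    wirtinger v s f p = wirtinger v s c p * g p + c p * wirtinger v s g p := by
  rw [← wirtinger_mul hc hg]
  refine wirtinger_congr ?_ v s
  filter_upwards [hV.mem_nhds hp] with q hq using h q hq

/-- A conformal field is `X = c Ψ + h` with holomorphic `c` and `h`. -/
theorem exists_holomorphic_decomposition {V : Set Coord} (hV : IsOpen V)
    (h0 : ∀ p ∈ V, p.2 ≠ 0) {X : Coord → Coord} (hX : ContDiffOn ℝ ∞ X V)
    (h : ∀ p ∈ V, IsConformalAt X p) :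
    ∃ c h₁ h₂ : Coord → ℂ, HolomorphicOn c V ∧ HolomorphicOn h₁ V ∧ HolomorphicOn h₂ V ∧
      ∀ p ∈ V, X p = (c p * (potential p).1 + h₁ p, c p * (potential p).2 + h₂ p) := by
  have hX1 : ContDiffOn ℝ ∞ (fun q => (X q).1) V := hX.fst
  have hX2 : ContDiffOn ℝ ∞ (fun q => (X q).2) V := hX.snd
  obtain ⟨hP1, hP2⟩ := contDiffOn_potential h0
  have hd {f : Coord → ℂ} (hf : ContDiffOn ℝ ∞ f V) {p : Coord} (hp : p ∈ V) :
      DifferentiableAt ℝ f p :=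
    (hf.differentiableOn (by simp)).differentiableAt (hV.mem_nhds hp)
  have hJ {p : Coord} (hp : p ∈ V) (u : Coord) := delBar_potential (h0 p hp) u
  have hΨ : ∀ p ∈ V, dwb (fun q => (potential q).1) p = -(width p ^ 2 / (2 * radius p)) :=
    fun p hp => (hasWirtinger_potential_fst (h0 p hp)).dwb_eq
  have hΨ0 : ∀ p ∈ V, dwb (fun q => (potential q).1) p ≠ 0 := fun p hp => by
    rw [hΨ p hp]
    exact neg_ne_zero.mpr (div_ne_zero (pow_ne_zero 2 (width_ne_zero p))
      (mul_ne_zero two_ne_zero (radius_ne_zero p)))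
  -- the multiple `c`, as a smooth function
  let c : Coord → ℂ := fun p =>
    dwb (fun q => (X q).1) p * (dwb (fun q => (potential q).1) p)⁻¹
  have hc : ContDiffOn ℝ ∞ c V :=
    (contDiffOn_wirtinger hV hX1 _ _).mul ((contDiffOn_wirtinger hV hP1 _ _).inv hΨ0)
  have hX' : ∀ p ∈ V, dzb (fun q => (X q).1) p = c p * dzb (fun q => (potential q).1) p ∧
      dwb (fun q => (X q).1) p = c p * dwb (fun q => (potential q).1) p ∧
      dzb (fun q => (X q).2) p = c p * dzb (fun q => (potential q).2) p ∧
      dwb (fun q => (X q).2) p = c p * dwb (fun q => (potential q).2) p := by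
    intro p hp
    obtain ⟨c', σ, h1, -⟩ := h p hp
    have k1 := h1 (1, 0)
    have k2 := h1 (0, 1)
    rw [← hJ hp] at k1 k2
    simp only [delBar, map_one, map_zero, mul_one, mul_zero, add_zero, zero_add, Prod.smul_mk,
      smul_eq_mul, Prod.mk.injEq] at k1 k2
    have hcc : c p = c' := by
      simp only [c]
      rw [k2.1, mul_assoc, mul_inv_cancel₀ (hΨ0 p hp), mul_one]
    rw [hcc]
    exact ⟨k1.1, k2.1, k1.2, k2.2⟩
  -- `∂̄∂̄X = 0` gives `∂̄c ∧ ∂̄Ψ = 0`, where the two components of `∂̄Ψ = J` are independent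
  have hcr : ∀ p ∈ V, dzb c p = 0 ∧ dwb c p = 0 := by
    intro p hp
    have e1 := dzb_dwb_comm hV hX1 hp
    have e2 := dzb_dwb_comm hV hX2 hp
    have e3 := dzb_dwb_comm hV hP1 hp
    have e4 := dzb_dwb_comm hV hP2 hp
    have w1 := contDiffOn_wirtinger hV hP1
    have w2 := contDiffOn_wirtinger hV hP2
    have k1 := wirtinger_eq_of_eq_mul hV (fun q hq => (hX' q hq).2.1) hp (hd hc hp)
      (hd (w1 (0, 1) (-1)) hp) (1, 0) (-1)
    have k2 := wirtinger_eq_of_eq_mul hV (fun q hq => (hX' q hq).1) hp (hd hc hp)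
      (hd (w1 (1, 0) (-1)) hp) (0, 1) (-1)
    have k3 := wirtinger_eq_of_eq_mul hV (fun q hq => (hX' q hq).2.2.2) hp (hd hc hp)
      (hd (w2 (0, 1) (-1)) hp) (1, 0) (-1)
    have k4 := wirtinger_eq_of_eq_mul hV (fun q hq => (hX' q hq).2.2.1) hp (hd hc hp)
      (hd (w2 (1, 0) (-1)) hp) (0, 1) (-1)
    have j1 := hJ hp (1, 0)
    have j2 := hJ hp (0, 1)
    have det := symplectic_structJ_basis p
    rw [← j1, ← j2] at det
    simp only [delBar, map_one, map_zero, mul_one, mul_zero, add_zero, zero_add] at det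
    simp only [dzb, dwb] at *
    have m1 := k1.symm.trans (e1.trans k2)
    have m2 := k3.symm.trans (e2.trans k4)
    rw [e3] at m1
    rw [e4] at m2
    generalize wirtinger (1, 0) (-1) c p = cz at *
    generalize wirtinger (0, 1) (-1) c p = cw at *
    constructor
    · linear_combination (-cz) * det
        - wirtinger (1, 0) (-1) (fun q => (potential q).2) p * m1
        + wirtinger (1, 0) (-1) (fun q => (potential q).1) p * m2
    · linear_combination (-cw) * det
        - wirtinger (0, 1) (-1) (fun q => (potential q).2) p * m1
        + wirtinger (0, 1) (-1) (fun q => (potential q).1) p * m2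
  have hch : HolomorphicOn c V := ⟨hc, fun p hp => (hcr p hp).1, fun p hp => (hcr p hp).2⟩
  have hol {f g : Coord → ℂ} (hf : ContDiffOn ℝ ∞ f V) (hg : ContDiffOn ℝ ∞ g V)
      (k1 : ∀ p ∈ V, dzb f p = c p * dzb g p) (k2 : ∀ p ∈ V, dwb f p = c p * dwb g p) :
      HolomorphicOn (fun p => f p - c p * g p) V := by
    refine HolomorphicOn.of_hasWirtinger (hf.sub (hc.mul hg)) fun p hp => ⟨_, _,
      ((hasWirtinger_of_differentiableAt (hd hf hp)).sub ((hch.hasWirtinger hV hp).mul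
        (hasWirtinger_of_differentiableAt (hd hg hp)))).congr_values rfl ?_ rfl ?_⟩
    · rw [k1 p hp]; ring
    · rw [k2 p hp]; ring
  refine ⟨c, _, _, hch, hol hX1 hP1 (fun p hp => (hX' p hp).1) (fun p hp => (hX' p hp).2.1),
    hol hX2 hP2 (fun p hp => (hX' p hp).2.2.1) (fun p hp => (hX' p hp).2.2.2), fun p hp => ?_⟩
  ext <;> simp only [] <;> ring

/-! ### The mixed component of the conformal Killing equation -/

theorem HolomorphicOn.const_mul {f : Coord → ℂ} {V : Set Coord} (hf : HolomorphicOn f V)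
    (hV : IsOpen V) (z : ℂ) : HolomorphicOn (fun q => z * f q) V :=
  (HolomorphicOn.const z V).mul hf hV

theorem HasWirtinger.congr_of_eqOn {f g : Coord → ℂ} {V : Set Coord} {a b c d : ℂ} {p : Coord}
    (hg : HasWirtinger g a b c d p) (hV : IsOpen V) (hp : p ∈ V) (h : ∀ q ∈ V, f q = g q) :
    HasWirtinger f a b c d p :=
  HasFDerivAt.congr_of_eventuallyEq hg (by filter_upwards [hV.mem_nhds hp] with q hq using h q hq)

/-- The mixed component of `L_X g` in the orthogonal frame that consists of the Euler field
`2w ∂_w` and of `W ∂_ζ - 2 ζ̄ w ∂_w`, the kernel of the fibre form. -/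
theorem lieHermitian_frame {X : Coord → Coord} {p : Coord} {a b c d a' b' c' d' : ℂ}
    (h1 : HasWirtinger (fun q => (X q).1) a b c d p)
    (h2 : HasWirtinger (fun q => (X q).2) a' b' c' d' p) :
    lieHermitian X p (0, 2 * p.2) (width p, -(2 * conj p.1 * p.2))
      = p.2 * width p / (2 * radius p) * (2 * conj p.2 * (X p).1
        - 2 * p.1 ^ 2 * conj p.2 * conj (X p).1 + 2 * p.1 * width p * conj (X p).2
        + 4 * radius p ^ 2 * c / width p ^ 2
        + conj (width p * (width p * a' - 2 * conj p.1 * p.2 * c')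
          + 2 * conj p.1 * p.2 * (width p * a - 2 * conj p.1 * p.2 * c))) := by
  have hr := radius_ne_zero p
  have hw := width_ne_zero p
  have hW := width_eq p
  rw [lieHermitian, (hasWirtinger_hermitian p _ _).fderiv_apply, del_eq_of_hasWirtinger h1 h2,
    del_eq_of_hasWirtinger h1 h2]
  simp only [hermitian, fibreForm_apply, map_add, map_sub, map_mul, map_ofNat, map_neg,
    Complex.conj_ofReal, Complex.conj_conj]
  field_simp
  rw [hW]
  ring

theorem hermitian_frame_eq_zero (p : Coord) :
    hermitian p (0, 2 * p.2) (width p, -(2 * conj p.1 * p.2)) = 0 := by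
  simp only [hermitian, fibreForm_apply p (width p, _)]
  rw [show (width p : ℂ) * -(2 * conj p.1 * p.2) + 2 * conj p.1 * p.2 * (width p : ℂ) = 0 by ring]
  simp

/-- The coefficients of `1`, `ζ̄`, `ζ̄²` in the expression `W² ∂_ζ h₂ + 2 ζ̄ W h₂ - 2 ζ̄² w h₁ + …`
through which `h` enters the mixed component of `L_X g`. -/
def mixedCoeff (h₁ h₂ : Coord → ℂ) : Fin 3 → Coord → ℂ :=
  let s₀ : Coord → ℂ := dz h₂
  let s₁ : Coord → ℂ := fun p => 2 * (h₂ p + p.1 * dz h₂ p - p.2 * dw h₂ p + p.2 * dz h₁ p)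
  ![s₀, s₁, fun p => p.1 * s₁ p - p.1 * p.1 * s₀ p - 2 * (p.2 * h₁ p)
    - 4 * (p.2 * p.2 * dw h₁ p)]

theorem holomorphicOn_mixedCoeff {h₁ h₂ : Coord → ℂ} {V : Set Coord} (hV : IsOpen V)
    (hh₁ : HolomorphicOn h₁ V) (hh₂ : HolomorphicOn h₂ V) (i : Fin 3) :
    HolomorphicOn (mixedCoeff h₁ h₂ i) V := by
  have z := HolomorphicOn.fst V
  have w := HolomorphicOn.snd V
  have k0 := hh₂.dz hV
  have k1 : HolomorphicOn (mixedCoeff h₁ h₂ 1) V :=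
    (((hh₂.add (z.mul k0 hV) hV).sub (w.mul (hh₂.dw hV) hV) hV).add
      (w.mul (hh₁.dz hV) hV) hV).const_mul hV 2
  have k2 : HolomorphicOn (mixedCoeff h₁ h₂ 2) V :=
    (((z.mul k1 hV).sub ((z.mul z hV).mul k0 hV) hV).sub ((w.mul hh₁ hV).const_mul hV 2) hV).sub
      (((w.mul w hV).mul (hh₁.dw hV) hV).const_mul hV 4) hV
  fin_cases i
  · exact k0
  · exact k1
  · exact k2

/-- The mixed component of the conformal Killing equation for `X = c Ψ + h`. -/
theorem mixed_equation {V : Set Coord} (hV : IsOpen V) (h0 : ∀ p ∈ V, p.2 ≠ 0)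
    {X : Coord → Coord} {c h₁ h₂ : Coord → ℂ} (hc : HolomorphicOn c V)
    (hh₁ : HolomorphicOn h₁ V) (hh₂ : HolomorphicOn h₂ V)
    (hX : ∀ p ∈ V, X p = (c p * (potential p).1 + h₁ p, c p * (potential p).2 + h₂ p))
    {p : Coord} (hp : p ∈ V) (h : IsConformalAt X p) :
    -2 * (p.2 * dw c p * radius p ^ 3) + 2 * (radius p * c p)
      + radius p ^ 2 * (2 * (p.2 * p.2 * dw h₁ p) + p.2 * h₁ p) - p.2 * h₁ p
      + 1 / 2 * (p.2 ^ 2 * width p ^ 2 * conj (mixedCoeff h₁ h₂ 0 p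
        + mixedCoeff h₁ h₂ 1 p * conj p.1 + mixedCoeff h₁ h₂ 2 p * conj p.1 ^ 2)) = 0 := by
  have hr := radius_ne_zero p
  have hw := width_ne_zero p
  have hW := width_eq p
  have hr2 := radius_sq_eq p
  have hp0 := h0 p hp
  have hp0' : conj p.2 ≠ 0 := (map_ne_zero _).mpr hp0
  obtain ⟨c', σ, -, hH⟩ := h
  have e1 := (((hc.hasWirtinger hV hp).mul (hasWirtinger_potential_fst hp0)).add
    (hh₁.hasWirtinger hV hp)).congr_of_eqOn (f := fun q => (X q).1) hV hp
      fun q hq => by rw [hX q hq]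
  have e2 := (((hc.hasWirtinger hV hp).mul (hasWirtinger_potential_snd p)).add
    (hh₂.hasWirtinger hV hp)).congr_of_eqOn (f := fun q => (X q).2) hV hp
      fun q hq => by rw [hX q hq]
  have key := hH (0, 2 * p.2) (width p, -(2 * conj p.1 * p.2))
  rw [hermitian_frame_eq_zero, mul_zero, lieHermitian_frame e1 e2] at key
  have key2 := (mul_eq_zero.mp key).resolve_left
    (div_ne_zero (mul_ne_zero hp0 hw) (mul_ne_zero two_ne_zero hr))
  rw [hX p hp] at key2
  have hr2' : (radius p : ℂ) ^ 2 - (1 + p.2 * conj p.2 * (width p : ℂ) ^ 2) = 0 := by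
    rw [hr2, sub_self]
  -- clear the denominators, and use the formula for `ρ²` to eliminate `w̄`
  have key3 := congrArg₂ (fun x y => p.2 ^ 2 * (width p : ℂ) ^ 2 / 2 * x
    + (p.2 * h₁ p - 2 * (radius p * c p)) * y) key2 hr2'
  simp only [mul_zero, add_zero] at key3
  refine Eq.trans ?_ key3
  simp only [potential, mixedCoeff, Matrix.cons_val, map_add, map_sub, map_mul, map_pow, map_ofNat,
    map_neg, map_div₀, Complex.conj_ofReal, Complex.conj_conj]
  field_simp
  rw [hW]
  ring

theorem HasWirtinger.eq_zero_of_eqOn {f : Coord → ℂ} {V : Set Coord} {a b c d : ℂ} {p : Coord}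
    (hf : HasWirtinger f a b c d p) (hV : IsOpen V) (hp : p ∈ V) (h : ∀ q ∈ V, f q = 0) :
    a = 0 ∧ b = 0 ∧ c = 0 ∧ d = 0 :=
  hf.eq_of_eventuallyEq (HasWirtinger.const 0 p)
    (by filter_upwards [hV.mem_nhds hp] with q hq using h q hq)

/-- The mixed equation relates powers of `ρ`, with holomorphic coefficients, to a term on which
`2w ∂_w` acts as multiplication by `4`. Hence `c = 0`, and the rest of the equation simplifies. -/
theorem eq_zero_of_mixed_equation {V : Set Coord} (hV : IsOpen V) (h0 : ∀ p ∈ V, p.2 ≠ 0)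
    {c h₁ : Coord → ℂ} {s : Fin 3 → Coord → ℂ} (hc : HolomorphicOn c V)
    (hh₁ : HolomorphicOn h₁ V) (hs : ∀ i, HolomorphicOn (s i) V)
    (h : ∀ p ∈ V, -2 * (p.2 * dw c p * radius p ^ 3) + 2 * (radius p * c p)
      + radius p ^ 2 * (2 * (p.2 * p.2 * dw h₁ p) + p.2 * h₁ p) - p.2 * h₁ p
      + 1 / 2 * (p.2 ^ 2 * width p ^ 2 * conj (s 0 p + s 1 p * conj p.1 + s 2 p * conj p.1 ^ 2))
        = 0) :
    ∀ p ∈ V, c p = 0 ∧ dw h₁ p = 0 ∧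
      s 0 p + s 1 p * conj p.1 + s 2 p * conj p.1 ^ 2 = -(2 * p.2 * conj (h₁ p)) := by
  have w := HolomorphicOn.snd V
  have hk : HolomorphicOn (fun p => p.2 * dw c p) V := w.mul (hc.dw hV) hV
  have hq : HolomorphicOn (fun p => p.2 * h₁ p) V := w.mul hh₁ hV
  have ha : HolomorphicOn (fun p => 2 * (p.2 * p.2 * dw h₁ p) + p.2 * h₁ p) V :=
    (((w.mul w hV).mul (hh₁.dw hV) hV).const_mul hV 2).add hq hV
  generalize hk' : (fun p : Coord => p.2 * dw c p) = k at hk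
  generalize hq' : (fun p : Coord => p.2 * h₁ p) = q at hq
  generalize ha' : (fun p : Coord => 2 * (p.2 * p.2 * dw h₁ p) + p.2 * h₁ p) = a at ha
  have h' : ∀ p ∈ V, -2 * (k p * (radius p * (radius p * radius p))) + 2 * (radius p * c p)
      + radius p * radius p * a p - q p
      + 1 / 2 * (p.2 * p.2 * (width p * width p) * conj (s 0 p + s 1 p * conj p.1
        + s 2 p * (conj p.1 * conj p.1))) = 0 := by
    intro p hp
    rw [← hk', ← hq', ← ha', ← sq (conj p.1)]
    linear_combination h p hp
  -- the coefficients of `ρ (2w ∂_w - 4)` applied to the equation, where `2w ρ ∂_w ρ = ρ² - 1`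
  let coeff : ℕ → Coord → ℂ := fun i => match i with
    | 0 => fun p => -2 * c p
    | 1 => fun p => 4 * q p - 2 * a p - 2 * (p.2 * dw q p)
    | 2 => fun p => 10 * k p - 6 * c p
    | 3 => fun p => 2 * (p.2 * dw a p) - 2 * a p
    | 4 => fun p => 2 * k p - 4 * (p.2 * dw k p)
    | _ => fun _ => 0
  have hcoeff : ∀ i, HolomorphicOn (coeff i) V := by
    intro i
    have k1 := (hq.const_mul hV 4).sub (ha.const_mul hV 2) hV
    rcases i with _ | _ | _ | _ | _ | i
    · exact hc.const_mul hV (-2)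
    · exact k1.sub ((w.mul (hq.dw hV) hV).const_mul hV 2) hV
    · exact (hk.const_mul hV 10).sub (hc.const_mul hV 6) hV
    · exact ((w.mul (ha.dw hV) hV).const_mul hV 2).sub (ha.const_mul hV 2) hV
    · exact (hk.const_mul hV 2).sub ((w.mul (hk.dw hV) hV).const_mul hV 4) hV
    · exact HolomorphicOn.const 0 V
  have hzero := coeff_eq_zero_of_sum_eq_zero hV (v := (0, 1)) (s := -1)
    (r := fun p => (radius p : ℂ)) (fun p _ => (hasWirtinger_radius p).differentiableAt)
    (fun p hp => by
      change dwb _ p ≠ 0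
      rw [(hasWirtinger_radius p).dwb_eq]
      exact div_ne_zero (mul_ne_zero (h0 p hp) (pow_ne_zero 2 (width_ne_zero p)))
        (mul_ne_zero two_ne_zero (radius_ne_zero p)))
    5 coeff (fun i p hp => (hcoeff i).differentiableAt hV hp) (fun i p hp => (hcoeff i).dwb_eq p hp)
    (fun p hp => by
      have hr := radius_ne_zero p
      have hr2 := radius_sq_eq p
      have hR := hasWirtinger_radius p
      have hW := hasWirtinger_width p
      have hz := (HasWirtinger.fst p).conj
      have hS := (((hs 0).hasWirtinger hV hp).add (((hs 1).hasWirtinger hV hp).mul hz)).add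
        (((hs 2).hasWirtinger hV hp).mul (hz.mul hz))
      have hF := ((((((hk.hasWirtinger hV hp).mul (hR.mul (hR.mul hR))).const_mul (-2)).add
        ((hR.mul (hc.hasWirtinger hV hp)).const_mul 2)).add
          ((hR.mul hR).mul (ha.hasWirtinger hV hp))).sub (hq.hasWirtinger hV hp)).add
        (((((HasWirtinger.snd p).mul (HasWirtinger.snd p)).mul (hW.mul hW)).mul
          hS.conj).const_mul (1 / 2))
      have hF0 := (hF.eq_zero_of_eqOn hV hp h').2.2.1
      have hp' := h' p hp
      have hkc : p.2 * dw c p = k p := by rw [← hk']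
      simp only [map_zero, zero_mul, mul_zero, add_zero] at hF0
      simp only [Finset.sum_range_succ, Finset.range_zero, Finset.sum_empty, coeff, pow_zero,
        pow_one]
      have hr3 : p.2 * conj p.2 * (width p : ℂ) ^ 2 = (radius p : ℂ) ^ 2 - 1 := by
        rw [hr2]; ring
      have hr4 : 2 * p.2 * (conj p.2 * (width p : ℂ) ^ 2 / (2 * radius p)) * radius p
          = (radius p : ℂ) ^ 2 - 1 := by
        rw [← hr3]; field_simp
      generalize conj p.2 * (width p : ℂ) ^ 2 / (2 * radius p) = x at *
      linear_combination (2 * p.2 * radius p) * hF0 - 4 * radius p * hp'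
        + (6 * k p * radius p ^ 2 - 2 * c p - 2 * radius p * a p) * hr4
        - 4 * (radius p : ℂ) ^ 2 * hkc)
  intro p hp
  have hp0 := h0 p hp
  -- the constant coefficient is `-2c`, and the linear one then gives `w² ∂_w h₁ = 0`
  have hcV : ∀ p ∈ V, c p = 0 := fun p hp => by
    have := hzero 0 (by norm_num) p hp
    simpa [coeff] using this
  have h1 := hzero 1 (by norm_num) p hp
  have hdq : dw q p = h₁ p + p.2 * dw h₁ p := by
    rw [← hq', ((HasWirtinger.snd p).mul (hh₁.hasWirtinger hV hp)).dw_eq]; ring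
  have hdh : dw h₁ p = 0 := by
    simp only [coeff, hdq] at h1
    rw [← hq', ← ha'] at h1
    have h2 : p.2 * p.2 * dw h₁ p = 0 := by linear_combination (-1 / 6) * h1
    exact (mul_eq_zero.mp h2).resolve_left (mul_ne_zero hp0 hp0)
  refine ⟨hcV p hp, hdh, ?_⟩
  have h2 := h p hp
  have hdc : dw c p = 0 := wirtinger_eq_zero hV hcV hp _ _
  rw [hcV p hp, hdh, hdc, radius_sq_eq] at h2
  have h3 : p.2 ^ 2 * (width p : ℂ) ^ 2 * (2 * conj p.2 * h₁ p
      + conj (s 0 p + s 1 p * conj p.1 + s 2 p * conj p.1 ^ 2)) = 0 := by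
    linear_combination 2 * h2
  have h4 := (mul_eq_zero.mp h3).resolve_left
    (mul_ne_zero (pow_ne_zero 2 hp0) (pow_ne_zero 2 (width_ne_zero p)))
  have h5 := congrArg conj h4
  rw [map_add, Complex.conj_conj] at h5
  simp only [map_mul, map_ofNat, Complex.conj_conj, map_zero] at h5
  linear_combination h5

/-- The case of a quadratic relation, with the coefficients written out. -/
theorem coeff_eq_zero_of_quadratic {V : Set Coord} (hV : IsOpen V) {v : Coord} {s : ℂ}
    {r : Coord → ℂ} (hr : ∀ p ∈ V, DifferentiableAt ℝ r p)
    (hr0 : ∀ p ∈ V, wirtinger v s r p ≠ 0) (a b c : Coord → ℂ)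
    (ha : ∀ p ∈ V, DifferentiableAt ℝ a p ∧ wirtinger v s a p = 0)
    (hb : ∀ p ∈ V, DifferentiableAt ℝ b p ∧ wirtinger v s b p = 0)
    (hc : ∀ p ∈ V, DifferentiableAt ℝ c p ∧ wirtinger v s c p = 0)
    (h : ∀ p ∈ V, a p + b p * r p + c p * r p ^ 2 = 0) :
    ∀ p ∈ V, a p = 0 ∧ b p = 0 ∧ c p = 0 := by
  have key := coeff_eq_zero_of_sum_eq_zero hV hr hr0 3
    (fun i => match i with | 0 => a | 1 => b | 2 => c | _ => fun _ => 0)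
    (fun i p hp => match i with
      | 0 => (ha p hp).1 | 1 => (hb p hp).1 | 2 => (hc p hp).1
      | (n + 3) => differentiableAt_const _)
    (fun i p hp => match i with
      | 0 => (ha p hp).2 | 1 => (hb p hp).2 | 2 => (hc p hp).2
      | (n + 3) => by simp [wirtinger])
    (fun p hp => by simpa [Finset.sum_range_succ] using h p hp)
  exact fun p hp => ⟨key 0 (by norm_num) p hp, key 1 (by norm_num) p hp, key 2 (by norm_num) p hp⟩

theorem dz_fst (p : Coord) : dz (fun q => q.1) p = 1 := (HasWirtinger.fst p).dz_eq

theorem dzb_conj_fst (p : Coord) : dzb (fun q => conj q.1) p = 1 := by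
  rw [(HasWirtinger.fst p).conj.dzb_eq, map_one]

/-- The solutions `h` of the simplified mixed equation. The coefficients `sᵢ / 2w` are constant,
which makes `h₁` a quadratic polynomial in `ζ`. -/
theorem exists_coefficients {V : Set Coord} (hV : IsOpen V) (hV' : IsConnected V)
    (h0 : ∀ p ∈ V, p.2 ≠ 0) {h₁ h₂ : Coord → ℂ}
    (hh₁ : HolomorphicOn h₁ V) (hh₂ : HolomorphicOn h₂ V) (hw : ∀ p ∈ V, dw h₁ p = 0)
    (h : ∀ p ∈ V, mixedCoeff h₁ h₂ 0 p + mixedCoeff h₁ h₂ 1 p * conj p.1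
      + mixedCoeff h₁ h₂ 2 p * conj p.1 ^ 2 = -(2 * p.2 * conj (h₁ p))) :
    ∃ k b₀ b₁ : ℂ, conj b₁ = -b₁ ∧ ∀ p ∈ V,
      h₁ p = -conj b₀ + b₁ * p.1 - b₀ * p.1 ^ 2 ∧ h₂ p = 2 * p.2 * (k + b₀ * p.1) := by
  have hs := holomorphicOn_mixedCoeff hV hh₁ hh₂
  have w := HolomorphicOn.snd V
  have z := HolomorphicOn.fst V
  have h2w : HolomorphicOn (fun p : Coord => 2 * p.2) V := w.const_mul hV 2
  have h2w0 : ∀ p ∈ V, 2 * p.2 ≠ 0 := fun p hp => mul_ne_zero two_ne_zero (h0 p hp)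
  let t : Fin 3 → Coord → ℂ := fun i p => mixedCoeff h₁ h₂ i p / (2 * p.2)
  have ht (i : Fin 3) : HolomorphicOn (t i) V := (hs i).div h2w hV h2w0
  have hst (i : Fin 3) : ∀ p ∈ V, mixedCoeff h₁ h₂ i p = 2 * p.2 * t i p := fun p hp => by
    have := h0 p hp
    simp only [t]; field_simp
  have hrel : ∀ p ∈ V, t 0 p + t 1 p * conj p.1 + t 2 p * (conj p.1 * conj p.1)
      + conj (h₁ p) = 0 := by
    intro p hp
    have h1 := h p hp
    rw [hst 0 p hp, hst 1 p hp, hst 2 p hp] at h1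
    refine (mul_eq_zero.mp ?_).resolve_left (h2w0 p hp)
    linear_combination h1
  -- `∂/∂ζ` and `∂/∂w` of the relation are polynomial identities in `ζ̄` over holomorphic functions
  have hder : ∀ p ∈ V,
      (dz (t 0) p + dz (t 1) p * conj p.1 + dz (t 2) p * conj p.1 ^ 2 = 0) ∧
      (dw (t 0) p + dw (t 1) p * conj p.1 + dw (t 2) p * conj p.1 ^ 2 = 0) := by
    intro p hp
    have hz := (HasWirtinger.fst p).conj
    have hF := (((((ht 0).hasWirtinger hV hp).add (((ht 1).hasWirtinger hV hp).mul hz)).add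
        (((ht 2).hasWirtinger hV hp).mul (hz.mul hz)))).add (hh₁.hasWirtinger hV hp).conj
    obtain ⟨e1, -, e2, -⟩ := hF.eq_zero_of_eqOn hV hp hrel
    simp only [map_zero, zero_mul, mul_zero, add_zero] at e1 e2
    exact ⟨by linear_combination e1, by linear_combination e2⟩
  have hpoly := coeff_eq_zero_of_quadratic hV (v := (1, 0)) (s := -1) (r := fun p => conj p.1)
    (fun p _ => (HasWirtinger.fst p).conj.differentiableAt)
    (fun p _ => by
      change dzb _ p ≠ 0
      rw [dzb_conj_fst]; exact one_ne_zero)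
  have hDz (i : Fin 3) : ∀ p ∈ V, DifferentiableAt ℝ (dz (t i)) p ∧
      wirtinger (1, 0) (-1) (dz (t i)) p = 0 := fun p hp =>
    ⟨((ht i).dz hV).differentiableAt hV hp, ((ht i).dz hV).dzb_eq p hp⟩
  have hDw (i : Fin 3) : ∀ p ∈ V, DifferentiableAt ℝ (dw (t i)) p ∧
      wirtinger (1, 0) (-1) (dw (t i)) p = 0 := fun p hp =>
    ⟨((ht i).dw hV).differentiableAt hV hp, ((ht i).dw hV).dzb_eq p hp⟩
  have hz0 := hpoly _ _ _ (hDz 0) (hDz 1) (hDz 2) (fun p hp => (hder p hp).1)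
  have hw0 := hpoly _ _ _ (hDw 0) (hDw 1) (hDw 2) (fun p hp => (hder p hp).2)
  have hconst (i : Fin 3) : ∃ b, ∀ p ∈ V, t i p = b := by
    refine (ht i).eq_const hV hV'.isPreconnected (fun p hp => ?_) (fun p hp => ?_)
    · obtain ⟨e0, e1, e2⟩ := hz0 p hp
      fin_cases i <;> assumption
    · obtain ⟨e0, e1, e2⟩ := hw0 p hp
      fin_cases i <;> assumption
  obtain ⟨b₀, hb₀⟩ := hconst 0
  obtain ⟨b₁, hb₁⟩ := hconst 1
  obtain ⟨b₂, hb₂⟩ := hconst 2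
  have s0 : ∀ p ∈ V, dz h₂ p = 2 * p.2 * b₀ := fun p hp => by
    rw [← hb₀ p hp, ← hst 0 p hp]; rfl
  have s1 : ∀ p ∈ V, 2 * (h₂ p + p.1 * dz h₂ p - p.2 * dw h₂ p + p.2 * dz h₁ p)
      = 2 * p.2 * b₁ := fun p hp => by
    rw [← hb₁ p hp, ← hst 1 p hp]; rfl
  have s2 : ∀ p ∈ V, h₁ p = -b₂ + b₁ * p.1 - b₀ * p.1 ^ 2 := fun p hp => by
    have e2 : p.1 * mixedCoeff h₁ h₂ 1 p - p.1 * p.1 * mixedCoeff h₁ h₂ 0 p - 2 * (p.2 * h₁ p)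
        - 4 * (p.2 * p.2 * dw h₁ p) = 2 * p.2 * t 2 p := hst 2 p hp
    rw [hst 0 p hp, hst 1 p hp, hb₀ p hp, hb₁ p hp, hb₂ p hp, hw p hp] at e2
    refine sub_eq_zero.mp ((mul_eq_zero.mp ?_).resolve_left (h2w0 p hp))
    linear_combination -e2
  -- with the formula for `h₁`, the relation is a quadratic polynomial identity in `ζ`
  have hconj : ∀ p ∈ V, (conj b₀ - b₂) + (conj b₁ + b₁) * p.1 + (conj b₂ - b₀) * p.1 ^ 2 = 0 := by
    intro p hp
    have e := congrArg conj (hrel p hp)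
    rw [hb₀ p hp, hb₁ p hp, hb₂ p hp] at e
    simp only [map_add, map_mul, Complex.conj_conj, map_zero] at e
    rw [s2 p hp] at e
    linear_combination e
  have hC (x : ℂ) : ∀ p ∈ V, DifferentiableAt ℝ (fun _ : Coord => x) p ∧
      wirtinger (1, 0) 1 (fun _ => x) p = 0 := fun p _ =>
    ⟨differentiableAt_const x, by simp [wirtinger]⟩
  have hquad := coeff_eq_zero_of_quadratic hV (v := (1, 0)) (s := 1) (r := fun p => p.1)
    (fun p _ => (HasWirtinger.fst p).differentiableAt)
    (fun p _ => by
      change dz _ p ≠ 0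
      rw [dz_fst]; exact one_ne_zero) _ _ _ (hC _) (hC _) (hC _) hconj
  obtain ⟨p₀, hp₀⟩ := hV'.nonempty
  obtain ⟨q0, q1, -⟩ := hquad p₀ hp₀
  have hb2 : b₂ = conj b₀ := by linear_combination -q0
  have hdz₁ : ∀ p ∈ V, dz h₁ p = b₁ - 2 * b₀ * p.1 := by
    intro p hp
    have e := (((HasWirtinger.const (-b₂) p).add ((HasWirtinger.fst p).const_mul b₁)).sub
      (((HasWirtinger.fst p).mul (HasWirtinger.fst p)).const_mul b₀)).congr_of_eqOn hV hp
        (f := h₁) (fun q hq => by rw [s2 q hq]; ring)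
    rw [e.dz_eq]; ring
  -- `h₂` is homogeneous of degree one in `w`
  have hE : ∀ p ∈ V, p.2 * dw h₂ p = h₂ p := fun p hp => by
    have := s1 p hp
    rw [s0 p hp, hdz₁ p hp] at this
    linear_combination (-1 / 2) * this
  obtain ⟨k, hk⟩ : ∃ k, ∀ p ∈ V, h₂ p / (2 * p.2) - b₀ * p.1 = k := by
    refine ((hh₂.div h2w hV h2w0).sub (z.const_mul hV b₀) hV).eq_const hV hV'.isPreconnected
      (fun p hp => ?_) (fun p hp => ?_)
    · have hp0 := h0 p hp
      have e := ((hh₂.hasWirtinger hV hp).div ((HasWirtinger.snd p).const_mul 2) (h2w0 p hp)).sub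
        ((HasWirtinger.fst p).const_mul b₀)
      rw [e.dz_eq, s0 p hp]
      field_simp
      ring
    · have hp0 := h0 p hp
      have e := ((hh₂.hasWirtinger hV hp).div ((HasWirtinger.snd p).const_mul 2) (h2w0 p hp)).sub
        ((HasWirtinger.fst p).const_mul b₀)
      rw [e.dw_eq, ← hE p hp]
      field_simp
      ring
  refine ⟨k, b₀, b₁, by linear_combination q1, fun p hp => ⟨by rw [s2 p hp, hb2], ?_⟩⟩
  have hp0 := h0 p hp
  rw [← hk p hp]
  field_simp
  ring

/-! ### Local classification of conformal fields -/

theorem lieHermitian_congr {X Y : Coord → Coord} {p : Coord} (h : X =ᶠ[nhds p] Y) (u v : Coord) :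
    lieHermitian X p u v = lieHermitian Y p u v := by
  have h1 : (fun q => (X q).1) =ᶠ[nhds p] fun q => (Y q).1 := h.fun_comp Prod.fst
  have h2 : (fun q => (X q).2) =ᶠ[nhds p] fun q => (Y q).2 := h.fun_comp Prod.snd
  simp only [lieHermitian, del, dz, dw, wirtinger_congr h1, wirtinger_congr h2, h.eq_of_nhds]

/-- The diagonal components of `L_X g` in the orthogonal frame, for a matrix whose traceless part is
skew-Hermitian. -/
theorem lieHermitian_velocity_diagonal {A : Matrix (Fin 2) (Fin 2) ℂ}
    (h₁ : conj (A 0 1) = -A 1 0) (h₂ : conj (A 1 0) = -A 0 1)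
    (h₃ : conj (A 1 1) = conj (A 0 0) - A 1 1 + A 0 0) (p : Coord) :
    lieHermitian (velocity false A) p (0, 2 * p.2) (0, 2 * p.2)
      = (A 0 0 + conj (A 0 0)) * (p.2 * conj p.2 * width p ^ 2)
        * (2 * radius p ^ 2 - p.2 * conj p.2 * width p ^ 2) / radius p ^ 3 ∧
    lieHermitian (velocity false A) p (width p, -(2 * conj p.1 * p.2))
        (width p, -(2 * conj p.1 * p.2))
      = (A 0 0 + conj (A 0 0)) * (p.2 * conj p.2 * width p ^ 2) / radius p := by
  have hr := radius_ne_zero p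
  have hw := width_ne_zero p
  have hW := width_eq p
  rw [lieHermitian, lieHermitian, (hasWirtinger_hermitian p _ _).fderiv_apply,
    (hasWirtinger_hermitian p _ _).fderiv_apply, del_velocity, del_velocity]
  simp only [hermitian, fibreForm_apply, velocity, map_add, map_sub, map_mul, map_pow, map_ofNat,
    Complex.conj_ofReal, Complex.conj_conj, map_neg, map_zero, h₁, h₂, h₃]
  generalize A 0 0 = a at *
  generalize A 1 0 = b at *
  generalize A 0 1 = c at *
  generalize A 1 1 = d at *
  constructor
  · field_simp
    rw [hW]
    ring
  · field_simp
    rw [hW]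
    ring

/-- Dilations of `ℂ²`, which correspond to the real part of `A 0 0`, are not conformal: the two
diagonal components of `L_X g` would have to be in the ratio of those of `g`. -/
theorem re_eq_zero_of_isConformalAt {A : Matrix (Fin 2) (Fin 2) ℂ}
    (h₁ : conj (A 0 1) = -A 1 0) (h₂ : conj (A 1 0) = -A 0 1)
    (h₃ : conj (A 1 1) = conj (A 0 0) - A 1 1 + A 0 0) {p : Coord} (hp : p.2 ≠ 0)
    {X : Coord → Coord} (hX : X =ᶠ[nhds p] velocity false A) (h : IsConformalAt X p) :
    conj (A 0 0) = -A 0 0 := by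
  have hr := radius_ne_zero p
  have hw := width_ne_zero p
  have hr2 := radius_sq_eq p
  have hp' : conj p.2 ≠ 0 := (map_ne_zero _).mpr hp
  obtain ⟨c, σ, -, hH⟩ := h
  obtain ⟨e1, e2⟩ := lieHermitian_velocity_diagonal h₁ h₂ h₃ p
  rw [← lieHermitian_congr hX, hH] at e1 e2
  have f1 : hermitian p (0, 2 * p.2) (0, 2 * p.2) = p.2 * conj p.2 * width p ^ 2 / radius p := by
    simp only [hermitian, fibreForm_apply, map_zero, map_add, map_mul, map_ofNat,
      Complex.conj_ofReal, Complex.conj_conj]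
    field_simp
    ring
  have f2 : hermitian p (width p, -(2 * conj p.1 * p.2)) (width p, -(2 * conj p.1 * p.2))
      = radius p := by
    simp only [hermitian, fibreForm_apply, map_neg, map_add, map_mul, map_ofNat,
      Complex.conj_ofReal, Complex.conj_conj]
    field_simp
    ring
  rw [f1] at e1
  rw [f2] at e2
  have hS : p.2 * conj p.2 * (width p : ℂ) ^ 2 ≠ 0 :=
    mul_ne_zero (mul_ne_zero hp hp') (pow_ne_zero 2 hw)
  generalize p.2 * conj p.2 * (width p : ℂ) ^ 2 = S at *
  generalize (radius p : ℂ) = r at *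
  obtain ⟨t, ht⟩ : ∃ t, t = A 0 0 + conj (A 0 0) := ⟨_, rfl⟩
  rw [← ht] at e1 e2
  have e3 : σ * r ^ 2 = t * S := by field_simp at e2; exact e2
  have e4 : σ * r ^ 2 = t * (2 * r ^ 2 - S) := by
    field_simp at e1
    linear_combination e1
  linear_combination (e3 - e4) / 2 - t * hr2 - ht

/-- A conformal field on a connected open set disjoint from the zero section is a `𝔲(2)`-field. -/
theorem exists_velocity_of_isConnected {V : Set Coord} (hV : IsOpen V) (hV' : IsConnected V)
    (h0 : ∀ p ∈ V, p.2 ≠ 0) {X : Coord → Coord} (hX : ContDiffOn ℝ ∞ X V)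
    (h : ∀ p ∈ V, IsConformalAt X p) :
    ∃ A ∈ u2, ∀ p ∈ V, X p = velocity false A p := by
  obtain ⟨c, h₁, h₂, hc, hh₁, hh₂, hXc⟩ := exists_holomorphic_decomposition hV h0 hX h
  have key := eq_zero_of_mixed_equation hV h0 hc hh₁ (holomorphicOn_mixedCoeff hV hh₁ hh₂)
    fun p hp => mixed_equation hV h0 hc hh₁ hh₂ hXc hp (h p hp)
  obtain ⟨k, b₀, b₁, hb₁, hk⟩ := exists_coefficients hV hV' h0 hh₁ hh₂
    (fun p hp => (key p hp).2.1) (fun p hp => (key p hp).2.2)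
  let A : Matrix (Fin 2) (Fin 2) ℂ := !![k, b₀; -conj b₀, k + b₁]
  have hXA : ∀ p ∈ V, X p = velocity false A p := by
    intro p hp
    rw [hXc p hp, (key p hp).1, (hk p hp).1, (hk p hp).2]
    simp only [velocity, A, Matrix.of_apply, Matrix.cons_val]
    ext <;> simp only [] <;> ring
  obtain ⟨p, hp⟩ := hV'.nonempty
  have hkk : conj k = -k := re_eq_zero_of_isConformalAt (A := A) (by simp [A]) (by simp [A])
    (by simp [A, hb₁]; ring) (h0 p hp)
    (by filter_upwards [hV.mem_nhds hp] with q hq using hXA q hq) (h p hp)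
  refine ⟨A, ?_, hXA⟩
  change A.conjTranspose = -A
  ext i j
  fin_cases i <;> fin_cases j <;> simp [A, Matrix.conjTranspose_apply, hkk, hb₁]
  ring

/-- The punctured disc is the image of a half-plane under the exponential map. -/
theorem isConnected_punctured_ball {r : ℝ} (hr : 0 < r) :
    IsConnected (Metric.ball (0 : ℂ) r \ {0}) := by
  have h : Metric.ball (0 : ℂ) r \ {0} = Complex.exp '' {z | z.re < Real.log r} := by
    ext z
    simp only [Set.mem_sdiff, Metric.mem_ball, dist_zero_right, Set.mem_singleton_iff,
      Set.mem_image, Set.mem_ofPred_eq]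
    constructor
    · rintro ⟨h1, h2⟩
      exact ⟨Complex.log z, by
        rw [Complex.log_re]; exact Real.log_lt_log (norm_pos_iff.mpr h2) h1, Complex.exp_log h2⟩
    · rintro ⟨x, hx, rfl⟩
      refine ⟨?_, Complex.exp_ne_zero x⟩
      rw [Complex.norm_exp]
      exact (Real.lt_log_iff_exp_lt hr).mp hx
  rw [h]
  have hc : IsConnected {z : ℂ | z.re < Real.log r} :=
    ⟨⟨((Real.log r - 1 : ℝ) : ℂ), by
      change ((Real.log r - 1 : ℝ) : ℂ).re < Real.log r
      rw [Complex.ofReal_re]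
      linarith⟩, (convex_halfSpace_re_lt _).isPreconnected⟩
  exact hc.image _ Complex.continuous_exp.continuousOn

theorem continuous_velocity (A : Matrix (Fin 2) (Fin 2) ℂ) : Continuous (velocity false A) := by
  unfold velocity
  fun_prop

/-- Conformal fields are `𝔲(2)`-fields locally. -/
theorem exists_velocity_local {V : Set Coord} (hV : IsOpen V) {p : Coord} (hp : p ∈ V)
    {X : Coord → Coord} (hX : ContDiffOn ℝ ∞ X V) (h : ∀ p ∈ V, IsConformalAt X p) :
    ∃ V' ⊆ V, IsOpen V' ∧ p ∈ V' ∧ ∃ A ∈ u2, ∀ q ∈ V', X q = velocity false A q := by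
  obtain ⟨r, hr, hrV⟩ := Metric.isOpen_iff.mp hV p hp
  by_cases hp0 : p.2 = 0
  · -- on the zero section, a ball minus the zero section is still connected, and dense in the ball
    refine ⟨Metric.ball p r, hrV, Metric.isOpen_ball, Metric.mem_ball_self hr, ?_⟩
    let V₀ : Set Coord := Metric.ball p.1 r ×ˢ (Metric.ball (0 : ℂ) r \ {0})
    have hball : Metric.ball p r = Metric.ball p.1 r ×ˢ Metric.ball (0 : ℂ) r := by
      rw [← hp0, ball_prod_same]
    have hV₀ : V₀ = Metric.ball p r ∩ {q | q.2 ≠ 0} := by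
      rw [hball]
      ext q
      simp only [V₀, Set.mem_prod, Set.mem_sdiff, Set.mem_inter_iff, Set.mem_singleton_iff,
        Set.mem_ofPred_eq, ne_eq, and_assoc]
    have hopen : IsOpen V₀ :=
      Metric.isOpen_ball.prod (Metric.isOpen_ball.sdiff isClosed_singleton)
    have hsub : V₀ ⊆ Metric.ball p r := by rw [hV₀]; exact Set.inter_subset_left
    obtain ⟨A, hA, hXA⟩ := exists_velocity_of_isConnected hopen
      ((Metric.isConnected_ball hr).prod (isConnected_punctured_ball hr)) (fun q hq => hq.2.2)
      (hX.mono (hsub.trans hrV)) (fun q hq => h q (hrV (hsub hq)))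
    refine ⟨A, hA, ?_⟩
    have hdense : Dense {q : Coord | q.2 ≠ 0} :=
      (dense_compl_singleton (0 : ℂ)).preimage isOpenMap_snd
    refine Set.EqOn.of_subset_closure (s := V₀) hXA (hX.continuousOn.mono hrV)
      (continuous_velocity A).continuousOn hsub ?_
    rw [hV₀]
    exact hdense.open_subset_closure_inter Metric.isOpen_ball
  · have hr' : 0 < min r ‖p.2‖ := lt_min hr (norm_pos_iff.mpr hp0)
    have hsub : Metric.ball p (min r ‖p.2‖) ⊆ V :=
      (Metric.ball_subset_ball (min_le_left _ _)).trans hrV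
    refine ⟨_, hsub, Metric.isOpen_ball, Metric.mem_ball_self hr', ?_⟩
    refine exists_velocity_of_isConnected Metric.isOpen_ball (Metric.isConnected_ball hr') ?_
      (hX.mono hsub) (fun q hq => h q (hsub hq))
    intro q hq hq0
    have h1 : dist q.2 p.2 < ‖p.2‖ := by
      rw [Metric.mem_ball, Prod.dist_eq] at hq
      exact ((le_max_right _ _).trans_lt hq).trans_le (min_le_right _ _)
    rw [hq0, dist_zero_left] at h1
    exact lt_irrefl _ h1

/-! ### Matrix fields are infinitesimal quaternionic isometries -/

/-- The matrix `A` in the coordinates `(z₂, -z₁)`, which describe the chart `true` in the same way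
as `(z₁, z₂)` describe the chart `false`. -/
def rotate (A : Matrix (Fin 2) (Fin 2) ℂ) : Matrix (Fin 2) (Fin 2) ℂ :=
  !![A 1 1, -A 1 0; -A 0 1, A 0 0]

theorem rotate_rotate (A : Matrix (Fin 2) (Fin 2) ℂ) : rotate (rotate A) = A := by
  ext i j
  fin_cases i <;> fin_cases j <;> simp [rotate]

theorem rotate_mem_u2 {A : Matrix (Fin 2) (Fin 2) ℂ} (hA : A ∈ u2) : rotate A ∈ u2 := by
  have h := conj_entry_of_mem_u2 hA
  change (rotate A).conjTranspose = -rotate A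
  ext i j
  fin_cases i <;> fin_cases j <;> simp [rotate, Matrix.conjTranspose_apply, h]

theorem velocity_true (A : Matrix (Fin 2) (Fin 2) ℂ) :
    velocity true A = velocity false (rotate A) := by
  funext p
  simp only [velocity, rotate, Matrix.of_apply, Matrix.cons_val]
  ext <;> simp only <;> ring

theorem exists_velocity_eq (i : Bool) {A : Matrix (Fin 2) (Fin 2) ℂ} (hA : A ∈ u2) :
    ∃ B ∈ u2, velocity i A = velocity false B := by
  cases i
  · exact ⟨A, hA, rfl⟩
  · exact ⟨rotate A, rotate_mem_u2 hA, velocity_true A⟩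

theorem velocity_transition (i : Bool) (A : Matrix (Fin 2) (Fin 2) ℂ) {p : Coord} (hp : p.1 ≠ 0) :
    velocity (!i) A (transition p) = fderiv ℝ transition p (velocity i A p) := by
  rw [fderiv_transition hp]
  cases i <;> simp only [velocity, transition, Bool.not_false, Bool.not_true] <;>
    (ext <;> simp only <;> field_simp <;> ring)

theorem contDiff_velocity (i : Bool) (A : Matrix (Fin 2) (Fin 2) ℂ) :
    ContDiff ℝ ∞ (velocity i A) := by
  cases i <;> unfold velocity <;> fun_prop

theorem lieDerivMetric_velocity {A : Matrix (Fin 2) (Fin 2) ℂ} (hA : A ∈ u2) (i : Bool)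
    (p u v : Coord) : lieDerivMetric (velocity i A) p u v = 0 := by
  obtain ⟨B, hB, h⟩ := exists_velocity_eq i hA
  rw [h, lieDerivMetric_eq_re ((contDiff_velocity false B).differentiable (by simp) p),
    lieHermitian_velocity hB, delBar_velocity, delBar_velocity]
  simp [hermitian]

/-- Sections of the quaternionic structure have differentiable coefficients: since `I (0, 1)` has no
`ζ`-component, the coefficient of `J` is read off from the `ζ`-components on `(0, 1)`. -/
theorem exists_coefficients_of_mem {V : Set Coord} (hV : IsOpen V)
    {A : Coord → Coord →L[ℝ] Coord} (hA : ContDiffOn ℝ ∞ A V)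
    (hQ : ∀ p ∈ V, A p ∈ quaternionicStructure p) {p : Coord} (hp : p ∈ V) :
    ∃ (a : Coord → ℝ) (e : Coord → ℂ), DifferentiableAt ℝ a p ∧ DifferentiableAt ℝ e p ∧
      ∀ q ∈ V, ∀ u, A q u = ((a q : ℂ) * Complex.I) • u + e q • structJ q u := by
  choose! a e h using fun q hq => mem_quaternionicStructure_iff.mp (hQ q hq)
  have hd : DifferentiableAt ℝ A p :=
    (hA.differentiableOn (by simp)).differentiableAt (hV.mem_nhds hp)
  have hdA : DifferentiableAt ℝ (fun q => A q (0, 1)) p := hd.clm_apply (differentiableAt_const _)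
  have hdJ : DifferentiableAt ℝ (fun q => structJ q (0, 1)) p :=
    (contDiff_structJ_apply _).differentiable (by simp) p
  have hne (q : Coord) : (structJ q (0, 1)).1 ≠ 0 := by
    have hr := radius_ne_zero q
    have hw := width_ne_zero q
    simp only [structJ_apply, fibreForm_apply, mul_one, mul_zero, add_zero, Complex.conj_ofReal]
    exact mul_ne_zero (neg_ne_zero.mpr (div_ne_zero hw (mul_ne_zero two_ne_zero hr))) hw
  have he : DifferentiableAt ℝ e p := by
    have hd' : DifferentiableAt ℝ (fun q => (A q (0, 1)).1 * ((structJ q (0, 1)).1)⁻¹) p :=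
      DifferentiableAt.mul hdA.fst (DifferentiableAt.inv hdJ.fst (hne p))
    refine hd'.congr_of_eventuallyEq ?_
    filter_upwards [hV.mem_nhds hp] with q hq
    have := congrArg Prod.fst (h q hq (0, 1))
    simp only [Prod.fst_add, Prod.smul_fst, smul_eq_mul, mul_zero, zero_add] at this
    rw [this, mul_assoc, mul_inv_cancel₀ (hne q), mul_one]
  refine ⟨a, e, ?_, he, h⟩
  refine (Complex.imCLM.differentiableAt.comp p
    (hdA.snd.sub (he.mul hdJ.snd))).congr_of_eventuallyEq ?_
  filter_upwards [hV.mem_nhds hp] with q hq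
  have := congrArg Prod.snd (h q hq (0, 1))
  simp only [Prod.snd_add, Prod.smul_snd, smul_eq_mul, mul_one] at this
  simp [this]

/-- Fields of type `(1,0)` that preserve the Hermitian form are quaternionic symmetries: `L_X I = 0`
and `L_X J` is a multiple of `J`, by the relation between `J`, the Hermitian form and the
holomorphic symplectic form. -/
theorem lieDerivEnd_mem {X : Coord → Coord} {V : Set Coord} (hV : IsOpen V)
    (hX : ∀ p ∈ V, DifferentiableAt ℝ X p) (hX₁ : ∀ p ∈ V, ∀ u, delBar X p u = 0)
    (hX₂ : ∀ p ∈ V, ∀ u v, lieHermitian X p u v = 0)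
    {A : Coord → Coord →L[ℝ] Coord} (hA : ContDiffOn ℝ ∞ A V)
    (hQ : ∀ p ∈ V, A p ∈ quaternionicStructure p) {p : Coord} (hp : p ∈ V) :
    lieDerivEnd X A p ∈ quaternionicStructure p := by
  obtain ⟨a, e, ha, he, h⟩ := exists_coefficients_of_mem hV hA hQ hp
  have hd : DifferentiableAt ℝ A p :=
    (hA.differentiableOn (by simp)).differentiableAt (hV.mem_nhds hp)
  have hdX (u : Coord) : fderiv ℝ X p u = del X p u := by
    rw [fderiv_eq_del_add_delBar (hX p hp), hX₁ p hp, add_zero]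
  set t : ℂ := dz (fun q => (X q).1) p + dw (fun q => (X q).2) p with ht
  -- the vanishing of the `(1,1)`-part of `L_X g` determines `L_X J`
  have hJ (v : Coord) :
      fderiv ℝ structJ p (X p) v - del X p (structJ p v) + structJ p (del X p v)
        = -t • structJ p v := by
    refine eq_of_symplectic_eq fun u => ?_
    have := lieHermitian_eq_symplectic X p u v
    rw [hX₂ p hp, ← ht] at this
    simp only [symplectic, Prod.smul_fst, Prod.smul_snd, smul_eq_mul] at this ⊢
    linear_combination -this
  have hdA (u : Coord) : fderiv ℝ A p (X p) u
      = ((fderiv ℝ a p (X p) : ℂ) * Complex.I) • u + (fderiv ℝ e p (X p) • structJ p u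
        + e p • fderiv ℝ structJ p (X p) u) := by
    have h1 : HasFDerivAt (fun q => A q u) ((fderiv ℝ A p).flip u) p := by
      simpa using hd.hasFDerivAt.clm_apply (hasFDerivAt_const u p)
    have hdJ : DifferentiableAt ℝ structJ p := contDiff_structJ.differentiable (by simp) p
    have h2 : HasFDerivAt (fun q => structJ q u) ((fderiv ℝ structJ p).flip u) p := by
      simpa using hdJ.hasFDerivAt.clm_apply (hasFDerivAt_const u p)
    have h3 := (((Complex.ofRealCLM.hasFDerivAt.comp p ha.hasFDerivAt).mul_const
      Complex.I).smul_const u).add (he.hasFDerivAt.smul h2)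
    have h4 := h1.unique (h3.congr_of_eventuallyEq (by
      filter_upwards [hV.mem_nhds hp] with q hq
      simpa using h q hq u))
    have h5 := congrArg (fun L => L (X p)) h4
    simp only [ContinuousLinearMap.flip_apply] at h5
    rw [h5]
    simp [add_comm, mul_comm]
  refine mem_quaternionicStructure_iff.mpr
    ⟨fderiv ℝ a p (X p), fderiv ℝ e p (X p) - e p * t, fun u => ?_⟩
  rw [lieDerivEnd_apply, hdA, hdX, hdX, h p hp u, h p hp (del X p u)]
  have hadd (x y : Coord) : del X p (x + y) = del X p x + del X p y := by
    ext <;> simp only [del, Prod.fst_add, Prod.snd_add] <;> ring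
  rw [hadd, del_smul, del_smul]
  have := congrArg (fun x => e p • x) (hJ u)
  simp only [smul_add, smul_sub, neg_smul, smul_neg, smul_smul] at this
  rw [sub_smul]
  linear_combination (exp := 1) this

/-! ### The topology of the manifold -/

theorem chart_eq_chart_iff {i j : Bool} {p q : Coord} : chart i p = chart j q ↔
    (i = j ∧ p = q) ∨ (i ≠ j ∧ p.1 ≠ 0 ∧ q = transition p) :=
  Quotient.eq

theorem chart_transition (i : Bool) {p : Coord} (hp : p.1 ≠ 0) :
    chart (!i) (transition p) = chart i p :=
  (chart_eq_chart_iff.mpr (Or.inr ⟨(Bool.not_ne_self i).symm, hp, rfl⟩)).symm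

theorem exists_chart_eq (x : Space) : ∃ i p, chart i p = x := by
  induction x using Quotient.inductionOn with
  | h a => exact ⟨a.1, a.2, rfl⟩

instance : ConnectedSpace Space := by
  have h (i : Bool) : IsConnected (Set.range (chart i)) := isConnected_range (continuous_chart i)
  have hne : (Set.range (chart false) ∩ Set.range (chart true)).Nonempty :=
    ⟨chart false (1, 0), ⟨_, rfl⟩, transition (1, 0), chart_transition false one_ne_zero⟩
  rw [connectedSpace_iff_univ]
  convert (h false).union hne (h true)
  symm
  rw [Set.eq_univ_iff_forall]
  intro x
  obtain ⟨i, p, rfl⟩ := exists_chart_eq x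
  cases i
  · exact Or.inl ⟨p, rfl⟩
  · exact Or.inr ⟨p, rfl⟩

theorem isOpenMap_chart (i : Bool) : IsOpenMap (chart i) := by
  intro V hV
  have h (j : Bool) : IsOpen (chart j ⁻¹' (chart i '' V)) := by
    by_cases hij : i = j
    · subst hij
      convert hV
      refine Set.preimage_image_eq V fun p q hpq => ?_
      simpa using chart_eq_chart_iff.mp hpq
    · have hc : ContinuousOn transition {p : Coord | p.1 ≠ 0} := by
        intro p hp
        have hp' : p.1 ≠ 0 := hp
        unfold transition
        fun_prop (disch := assumption)
      have ho : IsOpen {p : Coord | p.1 ≠ 0} := isOpen_ne_fun continuous_fst continuous_const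
      convert hc.isOpen_inter_preimage ho hV using 1
      ext p
      simp only [Set.mem_preimage, Set.mem_image, Set.mem_inter_iff, Set.mem_ofPred_eq]
      constructor
      · rintro ⟨q, hq, hqp⟩
        rcases chart_eq_chart_iff.mp hqp.symm with ⟨h, -⟩ | ⟨-, hp, rfl⟩
        · exact absurd h.symm hij
        · exact ⟨hp, hq⟩
      · rintro ⟨hp, hq⟩
        exact ⟨_, hq, (chart_eq_chart_iff.mpr (Or.inr ⟨Ne.symm hij, hp, rfl⟩)).symm⟩
  refine isQuotientMap_quotient_mk'.isOpen_preimage.mp ?_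
  have e : (Quotient.mk gluing) ⁻¹' (chart i '' V)
      = ⋃ j, ({j} : Set Bool) ×ˢ (chart j ⁻¹' (chart i '' V)) := by
    ext ⟨j, p⟩
    simp only [Set.mem_preimage, Set.mem_iUnion, Set.mem_prod, Set.mem_singleton_iff,
      exists_eq_left']
    rfl
  exact e ▸ isOpen_iUnion fun j => (isOpen_discrete {j}).prod (h j)

/-! ### From local to global -/

theorem velocity_add (i : Bool) (A B : Matrix (Fin 2) (Fin 2) ℂ) (p : Coord) :
    velocity i (A + B) p = velocity i A p + velocity i B p := by
  cases i <;> simp only [velocity, Matrix.add_apply] <;>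
    (ext <;> simp only [Prod.fst_add, Prod.snd_add] <;> ring)

theorem velocity_smul (i : Bool) (c : ℝ) (A : Matrix (Fin 2) (Fin 2) ℂ) (p : Coord) :
    velocity i (c • A) p = c • velocity i A p := by
  cases i <;> simp only [velocity, Matrix.smul_apply, Complex.real_smul] <;>
    (ext <;> simp only [Prod.smul_fst, Prod.smul_snd, Complex.real_smul] <;> ring)

theorem eq_of_velocity_false_eq {A B : Matrix (Fin 2) (Fin 2) ℂ} {V : Set Coord} (hV : IsOpen V)
    {p : Coord} (hp : p ∈ V) (h : ∀ q ∈ V, velocity false A q = velocity false B q) : A = B := by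
  have h1 : ∀ q ∈ V, A 0 0 + A 0 1 * q.1 = B 0 0 + B 0 1 * q.1 := by
    intro q hq
    have e : (fun q => (velocity false A q).2) =ᶠ[nhds q] fun q => (velocity false B q).2 := by
      filter_upwards [hV.mem_nhds hq] with x hx
      rw [h x hx]
    have h2 : dw (fun q => (velocity false A q).2) q = dw (fun q => (velocity false B q).2) q :=
      wirtinger_congr e _ _
    rw [(hasWirtinger_velocity_snd A q).dw_eq, (hasWirtinger_velocity_snd B q).dw_eq] at h2
    linear_combination h2 / 2
  obtain ⟨r, hr, hrV⟩ := Metric.isOpen_iff.mp hV p hp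
  have hr0 : ((r / 2 : ℝ) : ℂ) ≠ 0 := Complex.ofReal_ne_zero.mpr (half_pos hr).ne'
  have hq : (p.1 + (r / 2 : ℝ), p.2) ∈ V := by
    refine hrV ?_
    rw [Metric.mem_ball, Prod.dist_eq, dist_self, dist_self_add_left, Complex.norm_real,
      Real.norm_of_nonneg (half_pos hr).le]
    exact max_lt (half_lt_self hr) hr
  have h01 : A 0 1 = B 0 1 :=
    mul_right_cancel₀ hr0 (by linear_combination h1 _ hq - h1 p hp)
  have h00 : A 0 0 = B 0 0 := by linear_combination h1 p hp - p.1 * h01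
  have e1 := congrArg Prod.fst (h _ hq)
  have e2 := congrArg Prod.fst (h p hp)
  simp only [velocity] at e1 e2
  have h11 : A 1 1 = B 1 1 := mul_right_cancel₀ hr0
    (by linear_combination e1 - e2 + (r / 2 : ℝ) * h00
      + ((r / 2 : ℝ) ^ 2 + 2 * p.1 * (r / 2 : ℝ)) * h01)
  have h10 : A 1 0 = B 1 0 := by linear_combination e2 - p.1 * h11 + p.1 * h00 + p.1 ^ 2 * h01
  ext i j
  fin_cases i <;> fin_cases j <;> assumption

/-- A matrix is determined by its field on a nonempty open set. -/
theorem eq_of_velocity_eq {i : Bool} {A B : Matrix (Fin 2) (Fin 2) ℂ} {V : Set Coord}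
    (hV : IsOpen V) {p : Coord} (hp : p ∈ V) (h : ∀ q ∈ V, velocity i A q = velocity i B q) :
    A = B := by
  cases i
  · exact eq_of_velocity_false_eq hV hp h
  · simp only [velocity_true] at h
    rw [← rotate_rotate A, eq_of_velocity_false_eq hV hp h, rotate_rotate]

variable {U : TopologicalSpace.Opens Space}

theorem isConformalAt_of_mem_symmetryAlgebra {X : Bool → Coord → Coord}
    (hX : X ∈ symmetryAlgebra U) (i : Bool) {p : Coord} (hp : chart i p ∈ U) :
    IsConformalAt (X i) p := by
  have h (j : Fin 3) : lieDerivEnd (X i) (hypercomplex j) p ∈ quaternionicStructure p :=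
    hX.2 i _ (isOpen_chart_preimage U i) subset_rfl _ (contDiff_hypercomplex j).contDiffOn
      (fun q _ => Submodule.subset_span ⟨j, rfl⟩) p hp
  exact isConformalAt_of_lieDerivEnd_mem (differentiableAt_of_mem hX.1 hp) (h 0) (h 1)

theorem isConformalAt_of_mem_isometryAlgebra {X : Bool → Coord → Coord}
    (hX : X ∈ isometryAlgebra U) (i : Bool) {p : Coord} (hp : chart i p ∈ U) :
    IsConformalAt (X i) p :=
  isConformalAt_of_lieDerivMetric_eq_zero (differentiableAt_of_mem hX.1 hp) (hX.2 i p hp)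

/-- Near each point, a conformal field on the manifold is induced by an element of `𝔲(2)`. -/
theorem exists_velocity_nhds {X : Bool → Coord → Coord} (hX : X ∈ vectorFields U)
    (h : ∀ i p, chart i p ∈ U → IsConformalAt (X i) p) {x : Space} (hx : x ∈ U) :
    ∃ A ∈ u2, ∃ O : Set Space, IsOpen O ∧ x ∈ O ∧
      ∀ i p, chart i p ∈ O → X i p = velocity i A p := by
  obtain ⟨i, p, rfl⟩ := exists_chart_eq x
  obtain ⟨V, -, hV, hpV, B, hB, hXB⟩ :=
    exists_velocity_local (isOpen_chart_preimage U i) hx (hX.1 i) fun q hq => h i q hq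
  obtain ⟨A, hA, hAB⟩ : ∃ A ∈ u2, velocity i A = velocity false B := by
    cases i
    · exact ⟨B, hB, rfl⟩
    · exact ⟨rotate B, rotate_mem_u2 hB, by rw [velocity_true, rotate_rotate]⟩
  refine ⟨A, hA, chart i '' V, isOpenMap_chart i V hV, ⟨p, hpV, rfl⟩, ?_⟩
  rintro j q ⟨p', hp', hpq⟩
  rcases chart_eq_chart_iff.mp hpq with ⟨rfl, rfl⟩ | ⟨hij, h0, rfl⟩
  · rw [hXB p' hp', hAB]
  · obtain rfl : j = !i := Bool.eq_not_of_ne hij.symm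
    rw [hX.2.1 i p' h0, velocity_transition i A h0, hXB p' hp', hAB]

/-- A conformal field on a connected open subset of the manifold is induced by an element of
`𝔲(2)`. -/
theorem exists_fundamentalField_eq (hU : IsConnected (U : Set Space)) {X : Bool → Coord → Coord}
    (hX : X ∈ vectorFields U) (h : ∀ i p, chart i p ∈ U → IsConformalAt (X i) p) :
    ∃ A ∈ u2, X = fundamentalField U A := by
  choose! A hA O hO hxO hXA using fun x (hx : x ∈ U) => exists_velocity_nhds hX h hx
  have hloc : ∀ x ∈ U, ∀ y ∈ U, y ∈ O x → A x = A y := by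
    intro x hx y hy hyx
    obtain ⟨i, p, rfl⟩ := exists_chart_eq y
    refine eq_of_velocity_eq (i := i) (V := chart i ⁻¹' (O x ∩ O (chart i p)))
      (((hO x hx).inter (hO _ hy)).preimage (continuous_chart i)) ⟨hyx, hxO _ hy⟩ fun q hq => ?_
    rw [← hXA x hx i q hq.1, ← hXA _ hy i q hq.2]
  have hconst : ∀ x ∈ U, ∀ y ∈ U, A x = A y := by
    intro x hx y hy
    refine hU.isPreconnected.induction₂ (fun x y => A x = A y) ?_
      (fun _ _ _ _ _ _ => Eq.trans) (fun _ _ _ _ => Eq.symm) hx hy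
    intro x hx
    filter_upwards [mem_nhdsWithin_of_mem_nhds ((hO x hx).mem_nhds (hxO x hx)),
      self_mem_nhdsWithin] with y hy hyU using hloc x hx y hyU hy
  obtain ⟨x, hx⟩ := hU.nonempty
  refine ⟨A x, hA x hx, ?_⟩
  funext i p
  by_cases hp : chart i p ∈ U
  · rw [fundamentalField, if_pos hp, hXA _ hp i p (hxO _ hp), hconst x hx _ hp]
  · rw [fundamentalField, if_neg hp, hX.2.2 i p hp]

theorem fundamentalField_eventuallyEq (A : Matrix (Fin 2) (Fin 2) ℂ) {i : Bool} {p : Coord}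
    (hp : chart i p ∈ U) : fundamentalField U A i =ᶠ[nhds p] velocity i A := by
  filter_upwards [(isOpen_chart_preimage U i).mem_nhds hp] with q hq
  exact if_pos hq

theorem fundamentalField_mem_vectorFields (U : TopologicalSpace.Opens Space)
    (A : Matrix (Fin 2) (Fin 2) ℂ) : fundamentalField U A ∈ vectorFields U := by
  refine ⟨fun i => (contDiff_velocity i A).contDiffOn.congr fun p hp => if_pos hp,
    fun i p hp => ?_, fun i p hp => if_neg hp⟩
  have e := chart_transition i hp
  by_cases h : chart i p ∈ U
  · rw [fundamentalField, fundamentalField, if_pos h, if_pos (e ▸ h), velocity_transition i A hp]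
  · rw [fundamentalField, fundamentalField, if_neg h, if_neg (e ▸ h), map_zero]

theorem fundamentalField_mem_isometryAlgebra {A : Matrix (Fin 2) (Fin 2) ℂ} (hA : A ∈ u2) :
    fundamentalField U A ∈ isometryAlgebra U := by
  refine ⟨fundamentalField_mem_vectorFields U A, fun i p hp u v => ?_⟩
  have h := fundamentalField_eventuallyEq A hp
  rw [lieDerivMetric, h.fderiv_eq, h.eq_of_nhds]
  exact lieDerivMetric_velocity hA i p u v

theorem fundamentalField_mem_symmetryAlgebra {A : Matrix (Fin 2) (Fin 2) ℂ} (hA : A ∈ u2) :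
    fundamentalField U A ∈ symmetryAlgebra U := by
  refine ⟨fundamentalField_mem_vectorFields U A, fun i V hV hVU S hS hQ p hp => ?_⟩
  have h := fundamentalField_eventuallyEq A (hVU hp)
  rw [lieDerivEnd, h.fderiv_eq, h.eq_of_nhds]
  obtain ⟨B, hB, hAB⟩ := exists_velocity_eq i hA
  rw [hAB]
  exact lieDerivEnd_mem hV (fun q _ => (contDiff_velocity false B).differentiable (by simp) q)
    (fun q _ u => delBar_velocity B q u) (fun q _ u v => lieHermitian_velocity hB q u v) hS hQ hp

theorem symmetryAlgebra_eq_isometryAlgebra (hU : IsConnected (U : Set Space)) :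
    symmetryAlgebra U = isometryAlgebra U := by
  ext X
  constructor
  · intro hX
    obtain ⟨A, hA, rfl⟩ := exists_fundamentalField_eq hU hX.1
      fun i p hp => isConformalAt_of_mem_symmetryAlgebra hX i hp
    exact fundamentalField_mem_isometryAlgebra hA
  · intro hX
    obtain ⟨A, hA, rfl⟩ := exists_fundamentalField_eq hU hX.1
      fun i p hp => isConformalAt_of_mem_isometryAlgebra hX i hp
    exact fundamentalField_mem_symmetryAlgebra hA

/-! ### The isomorphism of Lie algebras -/

/-- The linear map `A ↦ X_{-A}` from `𝔲(2)` to the symmetry algebra. -/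
def fundamentalMap (U : TopologicalSpace.Opens Space) : u2 →ₗ[ℝ] symmetryAlgebra U where
  toFun A := ⟨fundamentalField U (-(A : Matrix (Fin 2) (Fin 2) ℂ)),
    fundamentalField_mem_symmetryAlgebra (neg_mem A.2)⟩
  map_add' A B := by
    ext1
    funext i p
    change fundamentalField U (-(A.1 + B.1)) i p
      = fundamentalField U (-A.1) i p + fundamentalField U (-B.1) i p
    simp only [fundamentalField, neg_add, velocity_add]
    split_ifs <;> simp
  map_smul' c A := by
    ext1
    funext i p
    change fundamentalField U (-(c • A.1)) i p = c • fundamentalField U (-A.1) i p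
    simp only [fundamentalField, ← smul_neg, velocity_smul]
    split_ifs <;> simp

theorem fundamentalMap_bijective (hU : IsConnected (U : Set Space)) :
    Function.Bijective (fundamentalMap U) := by
  constructor
  · intro A B hAB
    obtain ⟨x, hx⟩ := hU.nonempty
    obtain ⟨i, p, rfl⟩ := exists_chart_eq x
    have h := congrArg Subtype.val hAB
    refine Subtype.ext (neg_injective (eq_of_velocity_eq (i := i) (isOpen_chart_preimage U i) hx
      fun q hq => ?_))
    have hq' : chart i q ∈ U := hq
    have := congrFun (congrFun h i) q
    simpa only [fundamentalMap, LinearMap.coe_mk, AddHom.coe_mk, fundamentalField, if_pos hq']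
      using this
  · rintro ⟨X, hX⟩
    obtain ⟨A, hA, rfl⟩ := exists_fundamentalField_eq hU hX.1
      fun i p hp => isConformalAt_of_mem_symmetryAlgebra hX i hp
    refine ⟨-⟨A, hA⟩, Subtype.ext ?_⟩
    change fundamentalField U (-(-A)) = _
    rw [neg_neg]

/-- A skew-Hermitian matrix is given by the imaginary parts of its diagonal entries and by the entry
above the diagonal. -/
def u2Equiv : u2 ≃ₗ[ℝ] ℝ × ℝ × ℂ where
  toFun A := ((A.1 0 0).im, (A.1 1 1).im, A.1 0 1)
  invFun v := ⟨!![v.1 * Complex.I, v.2.2; -conj v.2.2, v.2.1 * Complex.I], by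
    change Matrix.conjTranspose _ = -_
    ext i j
    fin_cases i <;> fin_cases j <;> simp [Matrix.conjTranspose_apply]⟩
  map_add' A B := by simp
  map_smul' c A := by simp
  left_inv A := by
    have h := conj_entry_of_mem_u2 A.2
    have key {z : ℂ} (hz : conj z = -z) : (z.im : ℂ) * Complex.I = z := by
      have := congrArg Complex.re hz
      simp only [Complex.conj_re, Complex.neg_re] at this
      apply Complex.ext <;> simp
      linarith
    ext i j
    fin_cases i <;> fin_cases j <;> simp [key, h]
  right_inv v := by simp

theorem finrank_u2 : Module.finrank ℝ u2 = 4 := by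
  rw [u2Equiv.finrank_eq]
  simp [Complex.finrank_real_complex]

theorem fderiv_velocity (A : Matrix (Fin 2) (Fin 2) ℂ) (p u : Coord) :
    fderiv ℝ (velocity false A) p u = ((A 1 1 - A 0 0 - 2 * A 0 1 * p.1) * u.1,
      2 * p.2 * A 0 1 * u.1 + 2 * (A 0 0 + A 0 1 * p.1) * u.2) := by
  rw [HasWirtinger.fderiv_prod_apply (hasWirtinger_velocity_fst A p)
    (hasWirtinger_velocity_snd A p)]
  ext <;> simp only <;> ring

theorem rotate_mul_sub_mul (A B : Matrix (Fin 2) (Fin 2) ℂ) :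
    rotate (A * B - B * A) = rotate A * rotate B - rotate B * rotate A := by
  ext i j
  fin_cases i <;> fin_cases j <;>
    simp [rotate, Matrix.mul_apply, Fin.sum_univ_two] <;> ring

theorem rotate_neg (A : Matrix (Fin 2) (Fin 2) ℂ) : rotate (-A) = -rotate A := by
  ext i j
  fin_cases i <;> fin_cases j <;> simp [rotate]

/-- The map `A ↦ X_{-A}` respects brackets. -/
theorem velocity_lie (i : Bool) (A B : Matrix (Fin 2) (Fin 2) ℂ) (p : Coord) :
    velocity i (-(A * B - B * A)) p
      = VectorField.lieBracket ℝ (velocity i (-A)) (velocity i (-B)) p := by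
  have h (A B : Matrix (Fin 2) (Fin 2) ℂ) : velocity false (-(A * B - B * A)) p
      = VectorField.lieBracket ℝ (velocity false (-A)) (velocity false (-B)) p := by
    rw [VectorField.lieBracket, fderiv_velocity, fderiv_velocity]
    simp only [velocity, Matrix.neg_apply, Matrix.sub_apply, Matrix.mul_apply, Fin.sum_univ_two]
    ext <;> simp only [Prod.fst_sub, Prod.snd_sub] <;> ring
  cases i
  · exact h A B
  · simp only [velocity_true, rotate_neg, rotate_mul_sub_mul]
    exact h _ _

theorem fundamentalField_lie (A B : Matrix (Fin 2) (Fin 2) ℂ) (i : Bool) (p : Coord) :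
    fundamentalField U (-(A * B - B * A)) i p = VectorField.lieBracket ℝ
      (fundamentalField U (-A) i) (fundamentalField U (-B) i) p := by
  by_cases hp : chart i p ∈ U
  · have hA := fundamentalField_eventuallyEq (-A) hp
    have hB := fundamentalField_eventuallyEq (-B) hp
    rw [hA.lieBracket_vectorField_eq hB, ← velocity_lie]
    exact if_pos hp
  · simp [VectorField.lieBracket, fundamentalField, hp]

end EguchiHanson

end

theorem mainTheorem4 :
    -- the Eguchi--Hanson manifold is connected, and `(g, I, J, K)` is a hyperkähler structure on it
    ConnectedSpace EguchiHanson.Space ∧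
    EguchiHanson.IsHyperkahler EguchiHanson.metric EguchiHanson.hypercomplex ∧
    -- in the coordinates `(ρ, φ, ψ, θ)` the metric has the stated form
    (∀ q ∈ EguchiHanson.polarDomain, DifferentiableAt ℝ EguchiHanson.polarMap q ∧
      ∀ a b, EguchiHanson.metric (EguchiHanson.polarMap q)
        (fderiv ℝ EguchiHanson.polarMap q a) (fderiv ℝ EguchiHanson.polarMap q b) =
          EguchiHanson.polarMetric q a b) ∧
    -- and the fields `v₁, …, v₄` are those induced by four independent elements of `𝔲(2)`
    (∀ k, EguchiHanson.polarMatrix k ∈ EguchiHanson.u2) ∧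
    LinearIndependent ℝ EguchiHanson.polarMatrix ∧
    (∀ k, ∀ q ∈ EguchiHanson.polarDomain,
      fderiv ℝ EguchiHanson.polarMap q (EguchiHanson.polarField k q) =
        EguchiHanson.velocity true (EguchiHanson.polarMatrix k) (EguchiHanson.polarMap q)) ∧
    -- on the whole manifold, and on each of its connected open subsets, the quaternionic symmetry
    -- algebra is the isometry algebra, of dimension 4, and consists of the fields induced by `𝔲(2)`
    ∀ U : TopologicalSpace.Opens EguchiHanson.Space, IsConnected (U : Set EguchiHanson.Space) →
      EguchiHanson.symmetryAlgebra U = EguchiHanson.isometryAlgebra U ∧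
      Module.finrank ℝ (EguchiHanson.symmetryAlgebra U) = 4 ∧
      ∃ Φ : EguchiHanson.u2 ≃ₗ[ℝ] EguchiHanson.symmetryAlgebra U,
        (∀ A, (Φ A : Bool → EguchiHanson.Coord → EguchiHanson.Coord) =
          EguchiHanson.fundamentalField U (-(A : Matrix (Fin 2) (Fin 2) ℂ))) ∧
        ∀ A B i p, (Φ ⁅A, B⁆ : Bool → EguchiHanson.Coord → EguchiHanson.Coord) i p =
          VectorField.lieBracket ℝ
            ((Φ A : Bool → EguchiHanson.Coord → EguchiHanson.Coord) i)
            ((Φ B : Bool → EguchiHanson.Coord → EguchiHanson.Coord) i) p := by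
  refine ⟨inferInstance, EguchiHanson.isHyperkahler,
    fun q hq => ⟨EguchiHanson.differentiableAt_polarMap hq, EguchiHanson.metric_polarMap hq⟩,
    EguchiHanson.polarMatrix_mem_u2, EguchiHanson.linearIndependent_polarMatrix,
    fun k q hq => EguchiHanson.fderiv_polarMap_polarField k hq, fun U hU => ?_⟩
  let Φ := LinearEquiv.ofBijective (EguchiHanson.fundamentalMap U)
    (EguchiHanson.fundamentalMap_bijective hU)
  exact ⟨EguchiHanson.symmetryAlgebra_eq_isometryAlgebra hU,
    Φ.finrank_eq.symm.trans EguchiHanson.finrank_u2, Φ, fun A => rfl,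
    fun A B i p => EguchiHanson.fundamentalField_lie A B i p⟩
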